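/- **Setting (submodular matroid secretary problem with shortlists).** Let $\mathcal M=(\mathcal N,\mathcal I)$ be a matroid of finite rank $k\ge 1$, let $\mathcal U\subseteq\mathcal N$ be a nonempty set of $n$ items, and let $f$ be a nonnegative, monotone and submodular function on the subsets of $\mathcal U$. The items arrive one at a time over $n$ rounds, in a uniformly random order. In each round the algorithm irrevocably decides whether to add the arriving item to a shortlist $A$. A randomized online algorithm is a fixed program (it may depend on $\varepsilon$ only) of a unit-cost random access machine with word addition and subtraction, uniformly random integers, real addition, subtraction and comparison, and insertion into, deletion from and membership tests for stored sets of items, each in unit time. It is told $n$ and $k$. Its only access to $f$ and $\mathcal M$ is through a value oracle returning $f(S)$ and an independence oracle deciding $S\in\mathcal I$, for sets $S$ of items that have already arrived; a query to a stored set takes unit time. When it halts, it returns the shortlist $A$ and a set $A^*$. Put $$\mathrm{OPT}=\max_{S\subseteq\mathcal U,\ S\in\mathcal I}f(S),\qquad \mathrm{ALG}=\mathbb E\Big[\max_{S\subseteq A,\ S\in\mathcal I}f(S)\Big],$$ the expectation being over the arrival order and the random choices of the algorithm. **Theorem.** There are a real polynomial $p$ and a constant $C_0$ such that for every $\varepsilon>0$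 there are a randomized online algorithm and constants $C_\varepsilon, D_\varepsilon$ for which the following holds for all $\mathcal M,k,\mathcal U,n,f$ as above. 1. (Running time.) For every arrival order and all random choices, the algorithm halts within $C_\varepsilon\, nk$ steps. 2. (Shortlist.) For every arrival order and all random choices, $|A|\le C_0\,2^{p(1/\varepsilon)}\,k$, $A^*\subseteq A$ and $A^*\in\mathcal I$. 3. (Competitive ratio.) $$\mathrm{ALG}\ \ge\ \tfrac12\Big(1-\frac1{e^2}-\varepsilon-\frac{D_\varepsilon}{k}\Big)\,\mathrm{OPT},\qquad\text{and also}\qquad \mathbb E[f(A^*)]\ \ge\ \tfrac12\Big(1-\frac1{e^2}-\varepsilon-\frac{D_\varepsilon}{k}\Big)\,\mathrm{OPT}.$$ -/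

import Mathlib

namespace Shortlist

/-! ## Matroid constraint and objective -/

/-- `f` is monotone and submodular on the subsets of `U`. -/
structure IsMonotoneSubmodularOn {α : Type*} [DecidableEq α] (U : Finset α)
    (f : Finset α → ℝ) : Prop where
  monotone : ∀ S T : Finset α, S ⊆ T → T ⊆ U → f S ≤ f T
  submodular : ∀ S T : Finset α, S ⊆ U → T ⊆ U → f (S ∪ T) + f (S ∩ T) ≤ f S + f T

open Classical in
/-- The maximum of `f S` over the independent sets `S ⊆ A`. -/
noncomputable def bestValue {α : Type*} (M : Matroid α) (f : Finset α → ℝ) (A : Finset α) : ℝ :=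
  (A.powerset.filter fun S : Finset α => M.Indep (S : Set α)).sup' ⟨∅, by simp⟩ f

/-! ## Randomized online algorithms

An online algorithm is one fixed program of a unit-cost random access machine. Its memory consists
of arrays of words (natural numbers), of reals and of sets of items; `word a i` is entry `i` of
array `a`, where `a` is fixed in the program text and `i` is computed. Items are named by their
arrival position. Words can be added and subtracted (truncated), but not multiplied. A program has
finitely many expressions, each of fixed size, so that evaluating one of them takes a bounded
number of elementary operations and oracle queries. -/

/-- Oracle access to an instance whose `n` items are named by their arrival position. -/
structure Oracle (n : ℕ) where
  /-- the value oracle -/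
  value : Finset (Fin n) → ℝ
  /-- the independence oracle -/
  indep : Finset (Fin n) → Prop

/-- Word expressions: `read a i` is entry `i` of word array `a`. -/
inductive WordExp where
  | lit (c : ℕ)
  | read (a : ℕ) (i : WordExp)
  | add (x y : WordExp)
  | sub (x y : WordExp)

/-- Real expressions: `read a i` is entry `i` of real array `a`, and `value a i` is the answer of
the value oracle to entry `i` of set array `a`. -/
inductive RealExp where
  | read (a : ℕ) (i : WordExp)
  | value (a : ℕ) (i : WordExp)
  | add (x y : RealExp)
  | sub (x y : RealExp)

/-- Tests: `mem x a i` asks whether item `x` lies in entry `i` of set array `a`, and `indep a i` is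
the answer of the independence oracle to that entry. -/
inductive Test where
  | wordLt (x y : WordExp)
  | realLt (x y : RealExp)
  | mem (x : WordExp) (a : ℕ) (i : WordExp)
  | indep (a : ℕ) (i : WordExp)
  | not (b : Test)
  | and (b c : Test)

/-- Programs. -/
inductive Program where
  /-- do nothing -/
  | skip
  /-- write the value of `e` to entry `i` of word array `a` -/
  | setWord (a : ℕ) (i e : WordExp)
  /-- write a fresh uniformly random element of `{0, …, m}` to entry `i` of word array `a` -/
  | random (a : ℕ) (i m : WordExp)
  /-- write the value of `e` to entry `i` of real array `a` -/
  | setReal (a : ℕ) (i : WordExp) (e : RealExp)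
  /-- insert item `x` into entry `i` of set array `a`; no effect unless `x` has arrived -/
  | insert (a : ℕ) (i x : WordExp)
  /-- erase item `x` from entry `i` of set array `a` -/
  | erase (a : ℕ) (i x : WordExp)
  /-- start the next round: the next item arrives (no effect after the last item) -/
  | next
  /-- put the item that has just arrived on the shortlist -/
  | select
  | seq (p q : Program)
  | ite (b : Test) (p q : Program)
  | while (b : Test) (p : Program)

/-- The memory of the machine, the number of rounds started so far, and the shortlist. -/
structure Store (n : ℕ) where
  word : ℕ → ℕ → ℕ
  real : ℕ → ℕ → ℝ
  set : ℕ → ℕ → Finset (Fin n)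
  arrived : ℕ
  shortlist : Finset (Fin n)

/-- `{x}` if item `x` exists and has arrived, and `∅` otherwise. -/
def Store.item {n : ℕ} (s : Store n) (x : ℕ) : Finset (Fin n) :=
  Finset.univ.filter fun j => j.val = x ∧ j.val < s.arrived

/-- `g` with the value at `(a, i)` replaced by `v`. -/
def write {β : Type*} (g : ℕ → ℕ → β) (a i : ℕ) (v : β) : ℕ → ℕ → β :=
  Function.update g a (Function.update (g a) i v)

def WordExp.eval {n : ℕ} (s : Store n) : WordExp → ℕ
  | lit c => c
  | read a i => s.word a (i.eval s)
  | add x y => x.eval s + y.eval s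
  | sub x y => x.eval s - y.eval s

noncomputable def RealExp.eval {n : ℕ} (O : Oracle n) (s : Store n) : RealExp → ℝ
  | read a i => s.real a (i.eval s)
  | value a i => O.value (s.set a (i.eval s))
  | add x y => x.eval O s + y.eval O s
  | sub x y => x.eval O s - y.eval O s

def Test.Holds {n : ℕ} (O : Oracle n) (s : Store n) : Test → Prop
  | wordLt x y => x.eval s < y.eval s
  | realLt x y => x.eval O s < y.eval O s
  | mem x a i => (s.item (x.eval s) ∩ s.set a (i.eval s)).Nonempty
  | indep a i => O.indep (s.set a (i.eval s))
  | not b => ¬ b.Holds O s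
  | and b c => b.Holds O s ∧ c.Holds O s

/-- A configuration: the list of programs still to be executed, and the store. -/
structure Config (n : ℕ) where
  todo : List Program
  store : Store n

open Classical in
/-- The law of the configuration after one step. A configuration with nothing left to execute has
halted and stays as it is. -/
noncomputable def step {n : ℕ} (O : Oracle n) : Config n → PMF (Config n)
  | ⟨[], s⟩ => PMF.pure ⟨[], s⟩
  | ⟨.skip :: K, s⟩ => PMF.pure ⟨K, s⟩
  | ⟨.setWord a i e :: K, s⟩ =>
      PMF.pure ⟨K, { s with word := write s.word a (i.eval s) (e.eval s) }⟩
  | ⟨.random a i m :: K, s⟩ =>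
      (PMF.uniformOfFintype (Fin (m.eval s + 1))).map fun r =>
        ⟨K, { s with word := write s.word a (i.eval s) r.val }⟩
  | ⟨.setReal a i e :: K, s⟩ =>
      PMF.pure ⟨K, { s with real := write s.real a (i.eval s) (e.eval O s) }⟩
  | ⟨.insert a i x :: K, s⟩ =>
      PMF.pure ⟨K, { s with
        set := write s.set a (i.eval s) (s.set a (i.eval s) ∪ s.item (x.eval s)) }⟩
  | ⟨.erase a i x :: K, s⟩ =>
      PMF.pure ⟨K, { s with
        set := write s.set a (i.eval s) (s.set a (i.eval s) \ s.item (x.eval s)) }⟩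
  | ⟨.next :: K, s⟩ => PMF.pure ⟨K, { s with arrived := min (s.arrived + 1) n }⟩
  | ⟨.select :: K, s⟩ =>
      PMF.pure ⟨K, { s with shortlist := s.shortlist ∪ s.item (s.arrived - 1) }⟩
  | ⟨.seq p q :: K, s⟩ => PMF.pure ⟨p :: q :: K, s⟩
  | ⟨.ite b p q :: K, s⟩ => PMF.pure (if b.Holds O s then ⟨p :: K, s⟩ else ⟨q :: K, s⟩)
  | ⟨.while b p :: K, s⟩ =>
      PMF.pure (if b.Holds O s then ⟨p :: .while b p :: K, s⟩ else ⟨K, s⟩)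

/-- The law of the configuration after `t` steps. -/
noncomputable def stepMany {n : ℕ} (O : Oracle n) : ℕ → Config n → PMF (Config n)
  | 0, c => PMF.pure c
  | t + 1, c => (step O c).bind (stepMany O t)

/-- The initial configuration: entries `0` and `1` of word array `0` hold the number `n` of items
and the rank `k`; every other word and real is `0`, every set is empty, and no item has arrived. -/
def initial (P : Program) (n k : ℕ) : Config n where
  todo := [P]
  store :=
    { word := fun a i => if a = 0 ∧ i = 0 then n else if a = 0 ∧ i = 1 then k else 0
      real := fun _ _ => 0
      set := fun _ _ => ∅
      arrived := 0
      shortlist := ∅ }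

def Config.Halted {n : ℕ} (c : Config n) : Prop := c.todo = []

/-- What the machine returns: the shortlist, and entry `0` of set array `0` as the solution. -/
def Config.output {n : ℕ} (c : Config n) : Finset (Fin n) × Finset (Fin n) :=
  (c.store.shortlist, c.store.set 0 0)

/-! ## Items in random order -/

section RandomOrder

variable {α : Type*} [DecidableEq α] (M : Matroid α) (f : Finset α → ℝ) (U : Finset α)

/-- An arrival order of the items: `σ t` is the item that arrives in round `t`. -/
abbrev Order (U : Finset α) : Type _ := Fin U.card ≃ {x // x ∈ U}

/-- The items that arrive at the positions in `S`. -/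
def items {U : Finset α} (σ : Order U) (S : Finset (Fin U.card)) : Finset α :=
  S.map (σ.toEmbedding.trans (Function.Embedding.subtype _))

/-- The oracles, when the items arrive in the order `σ`. -/
def oracle {U : Finset α} (σ : Order U) : Oracle U.card where
  value S := f (items σ S)
  indep S := M.Indep (items σ S : Set α)

/-- The law of the configuration of program `P` after `T` steps, when the items arrive in the
order `σ` and the program is told the number of items and `k`. -/
noncomputable def run (P : Program) (k T : ℕ) {U : Finset α} (σ : Order U) :
    PMF (Config U.card) :=
  stepMany (oracle M f σ) T (initial P U.card k)

/-- The expected value of `g A B`, where `A` is the shortlist and `B` the solution that `P` returns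
after `T` steps, over the uniformly random arrival order and the random choices of `P`. -/
noncomputable def expectation (P : Program) (k T : ℕ) (g : Finset α → Finset α → ℝ) : ℝ :=
  (∑ σ : Order U, ∑ o : Finset (Fin U.card) × Finset (Fin U.card),
    (((run M f P k T σ).map Config.output) o).toReal * g (items σ o.1) (items σ o.2)) /
    (Fintype.card (Order U) : ℝ)

end RandomOrder

end Shortlist

/-!
# Submodular matroid secretaries with shortlists

The algorithm depends on an integer `Q` of order `1 / ε`. If there are at most `410 * Q ^ 9 * k`
items, all of them are put on the shortlist, and the offline greedy algorithm finds half of the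
optimum (`greedy_spec`). Otherwise the first items, a fraction `1 / Q` of all, serve as a sample
only; the value `v` that the greedy algorithm reaches on them is the level of a local search on the
other items. The local search maintains an independent set `S`. It swaps an arriving item into `S`,
possibly in exchange for one element, if this increases `f S` by more than a fraction `1 / (Q * k)`
of `v` and of `f S`; the item is then accepted, that is, shortlisted. With probability `1 / Q`,
however, an arriving item is ignored, and a random one of the items accepted earlier is tried again.

*The ratio.* Let `O` be an optimal set. For every independent set `S` the swaps of the elements of
`O` into `S` have total gain at least `f O - 2 * f S` (`IsMonotoneSubmodularOn.exists_weights`).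
Consider the elements of `O` after a fraction `t` of the rounds. One that has not arrived arrives
next with the same probability as every other item to come. One that has arrived and been rejected
has left no trace in the state of the algorithm, so that its arrival may be moved to the present
(`Dynamics.Improves.expect_freshGain_remove`). The gain of one that has been accepted is realized by
a retry with a probability per round that does not depend on the number of items, so that such gains
are negligible in the sum over all rounds. Altogether the expected value `u` of `S` satisfies
`u' ≥ f O - 2 * u` up to small errors, which yields `(1 - exp (-2)) / 2 * f O` at the end
(`le_of_delayed_recurrence`, `Dynamics.Improves.le_average`).

*The shortlist.* At most `200 * Q ^ 7 * k` items may be accepted. This bound is not attained if the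
sample is calibrated, since then every accepted item, except for a few of the most valuable ones,
increases a bounded potential (`Invariant`, `dynamics_improves`). By Chebyshev's inequality for
sampling without replacement, most samples are calibrated (`exists_calibrated`).

*The program.* Running times and expected values are tracked by the predicate `Guarantee`, which is
closed under the steps of the machine. The local search is first analysed as a process on abstract
states, and the program is shown to simulate it (`guarantee_mainProgram`). The oracles name items by
their arrival positions; `expect_dynamics_map` translates between positions and items, and
`sum_order_eq_sum_average` isolates the order of the items behind the sample.
-/

namespace Shortlist

/-! ### A program logic with running times -/

section Logic

variable {n : ℕ}

/-- The law of the output after `t` steps. -/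
noncomputable def law (O : Oracle n) (t : ℕ) (c : Config n) :
    PMF (Finset (Fin n) × Finset (Fin n)) :=
  (stepMany O t c).map Config.output

/-- From the configuration `c` the machine halts within `T` steps whatever its random choices are,
its output then satisfies `Post`, and the expected value of `φ` at the output is at least `V`.
Everything is claimed for each number `t ≥ T` of steps, so that computations of different lengths
on different random branches need not be aligned. -/
def Guarantee (O : Oracle n) (φ : Finset (Fin n) × Finset (Fin n) → ℝ)
    (Post : Finset (Fin n) × Finset (Fin n) → Prop) (T : ℕ) (c : Config n) (V : ℝ) : Prop :=
  ∀ t, T ≤ t → (∀ c' ∈ (stepMany O t c).support, c'.Halted ∧ Post c'.output) ∧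
    V ≤ ∑ o, (law O t c o).toReal * φ o

variable {O : Oracle n} {φ : Finset (Fin n) × Finset (Fin n) → ℝ}
  {Post : Finset (Fin n) × Finset (Fin n) → Prop}

lemma stepMany_nil (s : Store n) (t : ℕ) : stepMany O t ⟨[], s⟩ = PMF.pure ⟨[], s⟩ := by
  induction t with
  | zero => rfl
  | succ t ih => simp [stepMany, step, PMF.pure_bind, ih]

lemma Guarantee.halt {s : Store n} {V : ℝ} (hP : Post (s.shortlist, s.set 0 0))
    (hV : V ≤ φ (s.shortlist, s.set 0 0)) : Guarantee O φ Post 0 ⟨[], s⟩ V := by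
  intro t _
  refine ⟨?_, ?_⟩
  · intro c' hc'
    rw [stepMany_nil, PMF.support_pure, Set.mem_singleton_iff] at hc'
    subst hc'
    exact ⟨rfl, hP⟩
  · have : law O t ⟨[], s⟩ = PMF.pure (s.shortlist, s.set 0 0) := by
      rw [law, stepMany_nil, PMF.pure_map]; rfl
    rw [this, Finset.sum_eq_single (s.shortlist, s.set 0 0)]
    · simpa [PMF.pure_apply] using hV
    · intro b _ hb; simp [PMF.pure_apply, hb]
    · simp

lemma Guarantee.mono {T T' : ℕ} {c : Config n} {V V' : ℝ} (h : Guarantee O φ Post T c V)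
    (hT : T ≤ T') (hV : V' ≤ V) : Guarantee O φ Post T' c V' :=
  fun t ht => ⟨(h t (hT.trans ht)).1, hV.trans (h t (hT.trans ht)).2⟩

lemma Guarantee.step_pure {T : ℕ} {c c' : Config n} {V : ℝ} (hs : step O c = PMF.pure c')
    (h : Guarantee O φ Post T c' V) : Guarantee O φ Post (T + 1) c V := by
  intro t ht
  obtain ⟨t, rfl⟩ : ∃ t', t = t' + 1 := ⟨t - 1, by omega⟩
  have : stepMany O (t + 1) c = stepMany O t c' := by
    rw [stepMany, hs, PMF.pure_bind]
  rw [law, this]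
  exact h t (by omega)

/-- A random choice yields the average of what its outcomes guarantee. -/
lemma Guarantee.random {T : ℕ} {s : Store n} {K : List Program} {a : ℕ} {i m : WordExp}
    {V : Fin (m.eval s + 1) → ℝ}
    (h : ∀ r : Fin (m.eval s + 1), Guarantee O φ Post T
      ⟨K, { s with word := write s.word a (i.eval s) r.val }⟩ (V r)) :
    Guarantee O φ Post (T + 1) ⟨.random a i m :: K, s⟩
      ((∑ r, V r) / ((m.eval s + 1 : ℕ) : ℝ)) := by
  intro t ht
  obtain ⟨t, rfl⟩ : ∃ t', t = t' + 1 := ⟨t - 1, by omega⟩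
  set g : Fin (m.eval s + 1) → Config n :=
    fun r => ⟨K, { s with word := write s.word a (i.eval s) r.val }⟩ with hg
  have hstep : stepMany O (t + 1) ⟨.random a i m :: K, s⟩ =
      (PMF.uniformOfFintype (Fin (m.eval s + 1))).bind fun r => stepMany O t (g r) := by
    rw [stepMany, step, PMF.bind_map]; rfl
  refine ⟨?_, ?_⟩
  · intro c' hc'
    rw [hstep, PMF.mem_support_bind_iff] at hc'
    obtain ⟨r, -, hr⟩ := hc'
    exact (h r t (by omega)).1 c' hr
  · have key : ∀ o, (law O (t + 1) ⟨.random a i m :: K, s⟩ o).toReal =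
        ∑ r, ((m.eval s + 1 : ℕ) : ℝ)⁻¹ * (law O t (g r) o).toReal := by
      intro o
      rw [law, hstep, PMF.map_bind, PMF.bind_apply, tsum_fintype, ENNReal.toReal_sum]
      · refine Finset.sum_congr rfl fun r _ => ?_
        rw [ENNReal.toReal_mul, PMF.uniformOfFintype_apply, ENNReal.toReal_inv, Fintype.card_fin,
          ENNReal.toReal_natCast]
        rfl
      · intro r _
        exact ENNReal.mul_ne_top (PMF.apply_ne_top _ _) (PMF.apply_ne_top _ _)
    simp_rw [key, Finset.sum_mul]
    rw [Finset.sum_comm, div_eq_inv_mul, Finset.mul_sum]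
    refine Finset.sum_le_sum fun r _ => ?_
    simp_rw [mul_assoc, ← Finset.mul_sum]
    exact mul_le_mul_of_nonneg_left (h r t (by omega)).2 (by positivity)

/-- Started in the store `s`, the program `p` takes at most `T` steps and ends in a store satisfying
`R`; this is phrased as a rule for guarantees of any continuation. -/
def Runs (O : Oracle n) (p : Program) (s : Store n) (T : ℕ) (R : Store n → Prop) : Prop :=
  ∀ (φ : Finset (Fin n) × Finset (Fin n) → ℝ) (Post : Finset (Fin n) × Finset (Fin n) → Prop)
    (K : List Program) (T' : ℕ) (V : ℝ),
    (∀ s', R s' → Guarantee O φ Post T' ⟨K, s'⟩ V) → Guarantee O φ Post (T + T') ⟨p :: K, s⟩ V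

variable {p q : Program} {s : Store n} {T : ℕ} {R : Store n → Prop}

lemma Runs.mono {T₁ : ℕ} {R₁ : Store n → Prop} (h : Runs O p s T₁ R₁) (hT : T₁ ≤ T)
    (hR : ∀ s', R₁ s' → R s') : Runs O p s T R := fun φ Post K T' V hK =>
  (h φ Post K T' V fun s' hs' => hK s' (hR s' hs')).mono (by omega) le_rfl

lemma Runs.of_step {s' : Store n} (hs : ∀ K, step O ⟨p :: K, s⟩ = PMF.pure ⟨K, s'⟩) (hR : R s') :
    Runs O p s 1 R := fun φ Post K T' V hK => by
  rw [add_comm]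
  exact (hK s' hR).step_pure (hs K)

lemma Runs.skip (hR : R s) : Runs O .skip s 1 R := .of_step (fun _ => by simp only [step]) hR

lemma Runs.setWord {a : ℕ} {i e : WordExp}
    (hR : R { s with word := write s.word a (i.eval s) (e.eval s) }) :
    Runs O (.setWord a i e) s 1 R := .of_step (fun _ => by simp only [step]) hR

lemma Runs.setReal {a : ℕ} {i : WordExp} {e : RealExp}
    (hR : R { s with real := write s.real a (i.eval s) (e.eval O s) }) :
    Runs O (.setReal a i e) s 1 R := .of_step (fun _ => by simp only [step]) hR

lemma Runs.insert {a : ℕ} {i x : WordExp}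
    (hR : R { s with set := write s.set a (i.eval s) (s.set a (i.eval s) ∪ s.item (x.eval s)) }) :
    Runs O (.insert a i x) s 1 R := .of_step (fun _ => by simp only [step]) hR

lemma Runs.erase {a : ℕ} {i x : WordExp}
    (hR : R { s with set := write s.set a (i.eval s) (s.set a (i.eval s) \ s.item (x.eval s)) }) :
    Runs O (.erase a i x) s 1 R := .of_step (fun _ => by simp only [step]) hR

lemma Runs.next (hR : R { s with arrived := min (s.arrived + 1) n }) :
    Runs O .next s 1 R := .of_step (fun _ => by simp only [step]) hR

lemma Runs.select (hR : R { s with shortlist := s.shortlist ∪ s.item (s.arrived - 1) }) :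
    Runs O .select s 1 R := .of_step (fun _ => by simp only [step]) hR

lemma Runs.seq {T₁ T₂ : ℕ} {R₁ : Store n → Prop} (hp : Runs O p s T₁ R₁)
    (hq : ∀ s', R₁ s' → Runs O q s' T₂ R) : Runs O (.seq p q) s (T₁ + T₂ + 1) R := by
  intro φ Post K T' V hK
  have := hp φ Post (q :: K) (T₂ + T') V fun s' hs' => hq s' hs' φ Post K T' V hK
  exact (Guarantee.step_pure (by simp only [step]) this).mono (by omega) le_rfl

lemma Runs.ite {b : Test} (hp : b.Holds O s → Runs O p s T R)
    (hq : ¬ b.Holds O s → Runs O q s T R) : Runs O (.ite b p q) s (T + 1) R := by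
  intro φ Post K T' V hK
  by_cases hb : b.Holds O s
  · exact (Guarantee.step_pure (by simp only [step, hb, if_true])
      (hp hb φ Post K T' V hK)).mono (by omega) le_rfl
  · exact (Guarantee.step_pure (by simp only [step, hb, if_false])
      (hq hb φ Post K T' V hK)).mono (by omega) le_rfl

/-- The rule for loops that run a known number `m` of times; `I i` is the invariant after `i`
rounds. -/
lemma Runs.while {b : Test} {m : ℕ} {I : ℕ → Store n → Prop} (h0 : I 0 s)
    (hb : ∀ i s, i < m → I i s → b.Holds O s ∧ Runs O p s T (I (i + 1)))
    (hm : ∀ s, I m s → ¬ b.Holds O s) :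
    Runs O (.while b p) s (m * (T + 1) + 1) (I m) := by
  suffices H : ∀ j i s, i + j = m → I i s → Runs O (.while b p) s (j * (T + 1) + 1) (I m) from
    H m 0 s (by omega) h0
  intro j
  induction j with
  | zero =>
    intro i s hi hs φ Post K T' V hK
    obtain rfl : i = m := by omega
    have hnb := hm s hs
    exact (Guarantee.step_pure (by simp only [step, hnb, if_false]) (hK s hs)).mono
      (by omega) le_rfl
  | succ j ih =>
    intro i s hi hs φ Post K T' V hK
    obtain ⟨hbs, hbody⟩ := hb i s (by omega) hs
    have h1 := hbody φ Post (.while b p :: K) ((j * (T + 1) + 1) + T') V fun s' hs' =>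
      ih (i + 1) s' (by omega) hs' φ Post K T' V hK
    refine (Guarantee.step_pure (by simp only [step, hbs, if_true]) h1).mono ?_ le_rfl
    rw [Nat.succ_mul]; omega

lemma write_apply {β : Type*} (g : ℕ → ℕ → β) (a i : ℕ) (v : β) (a' i' : ℕ) :
    write g a i v a' i' = if a' = a ∧ i' = i then v else g a' i' := by
  unfold write
  by_cases h : a' = a
  · subst h; by_cases h2 : i' = i
    · subst h2; simp
    · simp [h2]
  · simp [h]

end Logic

/-! ### Submodular functions and matroid exchange -/

section Submodular

variable {α : Type*} {M : Matroid α} {U : Finset α} {f : Finset α → ℝ}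

lemma le_bestValue {A S : Finset α} (hS : S ⊆ A) (hI : M.Indep (S : Set α)) :
    f S ≤ bestValue M f A := by
  classical
  exact Finset.le_sup' f (by simp [hS, hI])

lemma exists_eq_bestValue (M : Matroid α) (f : Finset α → ℝ) (A : Finset α) :
    ∃ S ⊆ A, M.Indep (S : Set α) ∧ f S = bestValue M f A := by
  classical
  obtain ⟨S, hS, h⟩ := Finset.exists_mem_eq_sup'
    (s := A.powerset.filter fun S : Finset α => M.Indep (S : Set α)) ⟨∅, by simp⟩ f
  refine ⟨S, ?_, ?_, ?_⟩
  · simp at hS; exact hS.1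
  · simp at hS; exact hS.2
  · rw [← h]; unfold bestValue; congr

variable [DecidableEq α]

/-- Marginal values decrease; for `e ∈ Y` this is monotonicity. -/
lemma IsMonotoneSubmodularOn.marginal_le (hf : IsMonotoneSubmodularOn U f) {X Y : Finset α} {e : α}
    (hXY : X ⊆ Y) (hY : Y ⊆ U) (he : e ∈ U) :
    f (insert e Y) - f Y ≤ f (insert e X) - f X := by
  by_cases heY : e ∈ Y
  · rw [Finset.insert_eq_of_mem heY, sub_self, sub_nonneg]
    exact hf.monotone _ _ (Finset.subset_insert _ _)
      (Finset.insert_subset he (hXY.trans hY))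
  · have h := hf.submodular (insert e X) Y (Finset.insert_subset he (hXY.trans hY)) hY
    have h1 : insert e X ∪ Y = insert e Y := by
      rw [Finset.insert_union, Finset.union_eq_right.2 hXY]
    have h2 : insert e X ∩ Y = X := by
      rw [Finset.insert_inter_of_notMem heY, Finset.inter_eq_left.2 hXY]
    rw [h1, h2] at h
    linarith

/-- A linear order on `O`, given by the sets `P o` of predecessors, and the telescoping sums along
it. -/
lemma exists_predecessors (f : Finset α → ℝ) (O : Finset α) :
    ∃ P : α → Finset α, (∀ o ∈ O, P o ⊆ O ∧ o ∉ P o) ∧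
      ∀ R ⊆ O, ∀ T, ∑ o ∈ R, (f (insert o (T ∪ (P o ∩ R))) - f (T ∪ (P o ∩ R))) =
        f (T ∪ R) - f T := by
  induction O using Finset.induction_on with
  | empty => exact ⟨fun _ => ∅, by simp, by simp⟩
  | insert a O ha ih =>
    obtain ⟨P, hP, hsum⟩ := ih
    refine ⟨Function.update P a O, ?_, ?_⟩
    · intro o ho
      by_cases hoa : o = a
      · subst hoa; simp [ha]
      · rw [Function.update_of_ne hoa]
        have ho' : o ∈ O := by simpa [hoa] using ho
        exact ⟨(hP o ho').1.trans (Finset.subset_insert _ _), (hP o ho').2⟩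
    · intro R hR T
      have key : ∀ R' ⊆ O, ∀ R'', R'' ∩ O = R' →
          ∑ o ∈ R', (f (insert o (T ∪ (Function.update P a O o ∩ R''))) -
            f (T ∪ (Function.update P a O o ∩ R''))) = f (T ∪ R') - f T := by
        intro R' hR' R'' h
        rw [← hsum R' hR' T]
        refine Finset.sum_congr rfl fun o ho => ?_
        have hoO := hR' ho
        have hoa : o ≠ a := fun h => ha (h ▸ hoO)
        rw [Function.update_of_ne hoa]
        have : P o ∩ R'' = P o ∩ R' := by
          rw [← h, ← Finset.inter_assoc, Finset.inter_right_comm,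
            Finset.inter_eq_left.2 (hP o hoO).1]
        rw [this]
      by_cases haR : a ∈ R
      · have hR' : R.erase a ⊆ O := by
          intro x hx
          rw [Finset.mem_erase] at hx
          simpa [hx.1] using hR hx.2
        have hRO : R ∩ O = R.erase a := by
          ext x
          simp only [Finset.mem_inter, Finset.mem_erase]
          constructor
          · rintro ⟨h1, h2⟩; exact ⟨fun h => ha (h ▸ h2), h1⟩
          · rintro ⟨h1, h2⟩; exact ⟨h2, hR' (by simp [h1, h2])⟩
        rw [← Finset.add_sum_erase R _ haR, key _ hR' R hRO, Function.update_self,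
          Finset.inter_comm, hRO, ← Finset.union_insert, Finset.insert_erase haR]
        ring
      · have hR' : R ⊆ O := fun x hx => by
          have := hR hx
          rw [Finset.mem_insert] at this
          exact this.resolve_left fun h => haR (h ▸ hx)
        exact key R hR' R (Finset.inter_eq_left.2 hR')

/-- The losses from erasing the elements of `S` one at a time add up to at most `f S - f ∅`. -/
lemma IsMonotoneSubmodularOn.sum_erase_le (hf : IsMonotoneSubmodularOn U f) {S G : Finset α}
    (hS : S ⊆ U) (hG : G ⊆ S) : ∑ g ∈ G, (f S - f (S.erase g)) ≤ f S - f ∅ := by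
  obtain ⟨P, hP, hsum⟩ := exists_predecessors f S
  have h := hsum S subset_rfl ∅
  rw [Finset.empty_union] at h
  rw [← h]
  have hnn : ∀ g ∈ S, 0 ≤ f S - f (S.erase g) := fun g _ =>
    sub_nonneg.2 (hf.monotone _ _ (Finset.erase_subset _ _) hS)
  refine (Finset.sum_le_sum_of_subset_of_nonneg hG fun g hg _ => hnn g hg).trans
    (Finset.sum_le_sum fun g hg => ?_)
  have h1 := hf.marginal_le (X := ∅ ∪ (P g ∩ S)) (Y := S.erase g) (e := g) ?_
    ((Finset.erase_subset _ _).trans hS) (hS hg)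
  · rwa [Finset.insert_erase hg] at h1
  · intro x hx
    simp only [Finset.empty_union, Finset.mem_inter] at hx
    exact Finset.mem_erase.2 ⟨fun h => (hP g hg).2 (h ▸ hx.1), hx.2⟩

/-- Every element of `D` can be exchanged for an element of `S` of its own. By Hall's theorem this
follows from the fact that `D` is spanned by the elements of `S` available for exchange. -/
lemma exists_injOn_exchange {S D : Finset α} (hS : M.Indep (S : Set α))
    (hD : M.Indep (D : Set α)) (hDS : Disjoint D S)
    (hdep : ∀ o ∈ D, ¬ M.Indep (insert o S : Finset α)) :
    ∃ φ : α → α, Set.InjOn φ D ∧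
      ∀ o ∈ D, φ o ∈ S ∧ M.Indep ((insert o S).erase (φ o) : Finset α) := by
  classical
  let t : D → Finset α := fun o => S.filter fun g => M.Indep ((insert o.1 S).erase g : Finset α)
  have hall : ∀ s : Finset D, s.card ≤ (s.biUnion t).card := by
    intro s
    have hcl : ((s.map (Function.Embedding.subtype _) : Finset α) : Set α) ⊆
        M.closure ((s.biUnion t : Finset α) : Set α) := by
      intro o ho
      simp only [Finset.coe_map, Set.mem_image, Finset.mem_coe] at ho
      obtain ⟨⟨o, hoD⟩, hos, rfl⟩ := ho
      simp only [Function.Embedding.subtype_apply]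
      have hoS : o ∉ (S : Set α) := fun h => Finset.disjoint_left.1 hDS hoD h
      have hoE : o ∈ M.E := hD.subset_ground hoD
      have hocl : o ∈ M.closure (S : Set α) := by
        by_contra hcon
        refine hdep o hoD ?_
        rw [Finset.coe_insert]
        exact (hS.notMem_closure_iff_of_notMem hoS).1 hcon
      have hC := hS.fundCircuit_isCircuit hocl hoS
      refine M.closure_subset_closure ?_
        (hC.mem_closure_sdiff_singleton_of_mem (M.mem_fundCircuit o S))
      rintro g ⟨hg, hgo⟩
      have hgS : g ∈ S := by
        have := M.fundCircuit_subset_insert o S hg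
        rcases this with h | h
        · exact absurd h hgo
        · exact h
      simp only [Finset.coe_biUnion, Set.mem_iUnion, Finset.mem_coe]
      refine ⟨⟨o, hoD⟩, hos, ?_⟩
      simp only [t, Finset.mem_filter]
      refine ⟨hgS, ?_⟩
      have := (hS.mem_fundCircuit_iff hocl hoS).1 hg
      simpa using this
    have hind : M.Indep ((s.map (Function.Embedding.subtype _) : Finset α) : Set α) :=
      hD.subset fun x hx => by
        simp only [Finset.coe_map, Set.mem_image, Finset.mem_coe] at hx
        obtain ⟨y, -, rfl⟩ := hx
        exact y.2
    have h1 := hind.encard_le_eRk_of_subset hcl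
    rw [Matroid.eRk_closure_eq] at h1
    have h2 := h1.trans (M.eRk_le_encard _)
    rw [Set.encard_coe_eq_coe_finsetCard, Set.encard_coe_eq_coe_finsetCard, Finset.card_map] at h2
    exact_mod_cast h2
  obtain ⟨g, hg, hgt⟩ := (Finset.all_card_le_biUnion_card_iff_exists_injective t).1 hall
  refine ⟨fun o => if h : o ∈ D then g ⟨o, h⟩ else o, ?_, ?_⟩
  · intro x hx y hy hxy
    have hx' : x ∈ D := hx
    have hy' : y ∈ D := hy
    simp only [hx', hy', dif_pos] at hxy
    exact congrArg Subtype.val (hg hxy)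
  · intro o ho
    have := hgt ⟨o, ho⟩
    simp only [t, Finset.mem_filter] at this
    simpa [ho] using this

/-- `T` arises from `S` by adding `e` and removing at most one element, and satisfies `I`. -/
def IsSwap (I : Finset α → Prop) (S : Finset α) (e : α) (T : Finset α) : Prop :=
  I T ∧ (T = insert e S ∨ ∃ g ∈ S, T = (insert e S).erase g)

/-- Weights `w` of the elements of a set `O`, bounded by their values and adding up to `f O`, that
bound `f` from below on the subsets of `O` and bound the swap gains `ψ` that an independent set `S`
offers to the elements of `O`; if `f S` is below half of `f O`, then these gains are large in
total. -/
lemma IsMonotoneSubmodularOn.exists_weights (hf : IsMonotoneSubmodularOn U f) (h0 : 0 ≤ f ∅)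
    {O : Finset α} (hO : O ⊆ U) (hOI : M.Indep (O : Set α)) :
    ∃ w : α → ℝ, (∀ o ∈ O, 0 ≤ w o ∧ w o ≤ f {o}) ∧ ∑ o ∈ O, w o = f O - f ∅ ∧
      (∀ R ⊆ O, f ∅ + ∑ o ∈ R, w o ≤ f R) ∧
      ∀ S ⊆ U, M.Indep (S : Set α) → ∃ ψ : α → ℝ,
        (∀ o ∈ O \ S, ψ o ≤ w o ∧
          ∃ T, IsSwap (fun T => M.Indep (T : Set α)) S o T ∧ ψ o ≤ f T - f S) ∧
        f O - 2 * f S ≤ ∑ o ∈ O \ S, ψ o := by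
  classical
  obtain ⟨P, hP, hsum⟩ := exists_predecessors f O
  have hPU : ∀ o ∈ O, P o ⊆ U := fun o ho => (hP o ho).1.trans hO
  -- The weight of `o` is its marginal value over its predecessors in `O`.
  refine ⟨fun o => f (insert o (P o)) - f (P o), ?_, ?_, ?_, ?_⟩
  · intro o ho
    refine ⟨sub_nonneg.2 (hf.monotone _ _ (Finset.subset_insert _ _)
      (Finset.insert_subset (hO ho) (hPU o ho))), ?_⟩
    have h := hf.marginal_le (Finset.empty_subset _) (hPU o ho) (hO ho)
    have h1 : (insert o ∅ : Finset α) = {o} := rfl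
    rw [h1] at h
    linarith
  · have h := hsum O subset_rfl ∅
    simp only [Finset.empty_union] at h
    rw [← h]
    refine Finset.sum_congr rfl fun o ho => ?_
    rw [Finset.inter_eq_left.2 (hP o ho).1]
  · intro R hR
    have h := hsum R hR ∅
    simp only [Finset.empty_union] at h
    rw [← le_sub_iff_add_le', ← h]
    exact Finset.sum_le_sum fun o ho => hf.marginal_le Finset.inter_subset_left
      (hPU o (hR ho)) (hO (hR ho))
  · intro S hSU hSI
    -- The elements of `D` need an exchange; `l o` is the value lost by erasing the partner of `o`.
    set D := (O \ S).filter fun o => ¬ M.Indep (insert o S : Finset α) with hDdef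
    have hDO : D ⊆ O := fun x hx => by
      simp only [hDdef, Finset.mem_filter, Finset.mem_sdiff] at hx; exact hx.1.1
    obtain ⟨φ, hinj, hφ⟩ := exists_injOn_exchange (M := M) (S := S) (D := D) hSI
      (hOI.subset (Finset.coe_subset.2 hDO))
      (Finset.disjoint_left.2 fun x hx hxS => by
        simp only [hDdef, Finset.mem_filter, Finset.mem_sdiff] at hx; exact hx.1.2 hxS)
      (fun o ho => by simp only [hDdef, Finset.mem_filter] at ho; exact ho.2)
    let l : α → ℝ := fun o => if o ∈ D then f S - f (S.erase (φ o)) else 0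
    have hl : ∀ o, 0 ≤ l o := fun o => by
      simp only [l]; split_ifs
      · exact sub_nonneg.2 (hf.monotone _ _ (Finset.erase_subset _ _) hSU)
      · exact le_rfl
    refine ⟨fun o => f (insert o (S ∪ P o)) - f (S ∪ P o) - l o, ?_, ?_⟩
    · intro o ho
      rw [Finset.mem_sdiff] at ho
      have hSP : S ∪ P o ⊆ U := Finset.union_subset hSU (hPU o ho.1)
      refine ⟨?_, ?_⟩
      · have := hf.marginal_le (X := P o) Finset.subset_union_right hSP (hO ho.1)
        have := hl o
        simp only
        linarith
      · by_cases hoD : o ∈ D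
        · obtain ⟨h1, h2⟩ := hφ o hoD
          refine ⟨_, ⟨h2, Or.inr ⟨_, h1, rfl⟩⟩, ?_⟩
          have hne : φ o ≠ o := fun h => ho.2 (h ▸ h1)
          have := hf.marginal_le (X := S.erase (φ o)) (e := o)
            ((Finset.erase_subset _ _).trans Finset.subset_union_left) hSP (hO ho.1)
          rw [Finset.erase_insert_of_ne hne.symm]
          simp only [l, hoD, if_true]
          linarith
        · have hind : M.Indep (insert o S : Finset α) := by
            by_contra h
            exact hoD (by simp only [hDdef, Finset.mem_filter, Finset.mem_sdiff]; exact ⟨ho, h⟩)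
          refine ⟨_, ⟨hind, Or.inl rfl⟩, ?_⟩
          have := hf.marginal_le (X := S) (e := o) Finset.subset_union_left hSP (hO ho.1)
          simp only [l, hoD, if_false]
          linarith
    · rw [Finset.sum_sub_distrib]
      have h1 : ∑ o ∈ O \ S, (f (insert o (S ∪ P o)) - f (S ∪ P o)) = f (S ∪ O) - f S := by
        have h := hsum O subset_rfl S
        rw [← h]
        have : ∀ o ∈ O, P o ∩ O = P o := fun o ho => Finset.inter_eq_left.2 (hP o ho).1
        rw [← Finset.sum_subset (Finset.sdiff_subset (s := O) (t := S))]
        · refine Finset.sum_congr rfl fun o ho => ?_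
          rw [this o (Finset.mem_sdiff.1 ho).1]
        · intro o ho hoS
          have hoS' : o ∈ S := by simpa [ho] using hoS
          rw [Finset.insert_eq_of_mem (Finset.mem_union_left _ hoS'), sub_self]
      have h2 : ∑ o ∈ O \ S, l o ≤ f S - f ∅ := by
        have hDS : D ⊆ O \ S := Finset.filter_subset _ _
        rw [← Finset.sum_subset hDS (fun o _ ho => by simp [l, ho])]
        have : ∑ o ∈ D, l o = ∑ g ∈ D.image φ, (f S - f (S.erase g)) := by
          rw [Finset.sum_image hinj]
          exact Finset.sum_congr rfl fun o ho => by simp [l, ho]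
        rw [this]
        refine hf.sum_erase_le hSU ?_
        intro g hg
        obtain ⟨o, ho, rfl⟩ := Finset.mem_image.1 hg
        exact (hφ o ho).1
      have h3 := hf.monotone O (S ∪ O) Finset.subset_union_right (Finset.union_subset hSU hO)
      rw [h1]
      linarith

end Submodular

/-! ### The offline greedy algorithm -/

section Greedy

open Classical in
/-- Scanning the list `l` for a candidate of largest value, starting from the pair `b` of a value
and a choice: a later candidate wins only if its value is strictly larger. -/
noncomputable def bestOf {γ : Type*} (cand : γ → Prop) (val : γ → ℝ) (b : ℝ × γ) (l : List γ) :
    ℝ × γ :=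
  l.foldl (fun b x => if cand x ∧ b.1 < val x then (val x, x) else b) b

lemma bestOf_append_singleton {γ : Type*} (cand : γ → Prop) (val : γ → ℝ) (b : ℝ × γ) (l : List γ)
    (x : γ) [Decidable (cand x ∧ (bestOf cand val b l).1 < val x)] :
    bestOf cand val b (l ++ [x]) =
      if cand x ∧ (bestOf cand val b l).1 < val x then (val x, x) else bestOf cand val b l := by
  simp only [bestOf, List.foldl_append, List.foldl_cons, List.foldl_nil]
  congr

lemma bestOf_spec {γ : Type*} (cand : γ → Prop) (val : γ → ℝ) (b : ℝ × γ) (l : List γ) :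
    b.1 ≤ (bestOf cand val b l).1 ∧ (∀ x ∈ l, cand x → val x ≤ (bestOf cand val b l).1) ∧
      (bestOf cand val b l = b ∨
        ∃ x ∈ l, cand x ∧ b.1 < val x ∧ bestOf cand val b l = (val x, x)) := by
  classical
  induction l using List.reverseRecOn with
  | nil => simp [bestOf]
  | append_singleton l x ih =>
    obtain ⟨h1, h2, h3⟩ := ih
    rw [bestOf_append_singleton]
    split_ifs with h
    · refine ⟨h1.trans h.2.le, ?_, Or.inr ⟨x, by simp, h.1, h1.trans_lt h.2, rfl⟩⟩
      intro y hy hcy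
      rcases List.mem_append.1 hy with hy | hy
      · exact (h2 y hy hcy).trans h.2.le
      · rw [List.mem_singleton] at hy; subst hy; exact le_rfl
    · refine ⟨h1, ?_, ?_⟩
      · intro y hy hcy
        rcases List.mem_append.1 hy with hy | hy
        · exact h2 y hy hcy
        · rw [List.mem_singleton] at hy; subst hy
          by_contra hlt
          exact h ⟨hcy, not_le.1 hlt⟩
      · rcases h3 with h3 | ⟨y, hy, h3⟩
        · exact Or.inl h3
        · exact Or.inr ⟨y, by simp [hy], h3⟩

variable {α : Type*} [DecidableEq α]

/-- `S` with the optional element inserted. -/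
def insertOpt (c : Option α) (S : Finset α) : Finset α := c.elim S fun x => insert x S

/-- `S` with the optional element erased. -/
def eraseOpt (c : Option α) (S : Finset α) : Finset α := c.elim S fun x => S.erase x

/-- The best way to enlarge `G` by an element of `l`, with the value that it leads to; the choice is
`none` if no element increases the value. -/
noncomputable def greedyChoice (F : Finset α → ℝ) (I : Finset α → Prop) (l : List α)
    (G : Finset α) : ℝ × Option α :=
  bestOf (fun c => (∀ x ∈ c, x ∉ G) ∧ I (insertOpt c G)) (fun c => F (insertOpt c G)) (F G, none)
    (l.map some)

/-- One round of the greedy algorithm. -/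
noncomputable def greedyRound (F : Finset α → ℝ) (I : Finset α → Prop) (l : List α)
    (G : Finset α) : Finset α :=
  insertOpt (greedyChoice F I l G).2 G

/-- The result of `k` rounds of the greedy algorithm on the elements of `l`. -/
noncomputable def greedy (F : Finset α → ℝ) (I : Finset α → Prop) (l : List α) (k : ℕ) :
    Finset α :=
  (greedyRound F I l)^[k] ∅

variable {M : Matroid α} {U : Finset α} {f : Finset α → ℝ}

lemma IsMonotoneSubmodularOn.union_le_of_marginal_le (hf : IsMonotoneSubmodularOn U f)
    {G R : Finset α} (hG : G ⊆ U) (hR : R ⊆ U) (h : ∀ o ∈ R, f (insert o G) ≤ f G) :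
    f (G ∪ R) ≤ f G := by
  induction R using Finset.induction_on with
  | empty => simp
  | insert a R ha ih =>
    have h1 := ih ((Finset.subset_insert _ _).trans hR) fun o ho =>
      h o (Finset.mem_insert_of_mem ho)
    have h2 := hf.marginal_le (X := G) (Y := G ∪ R) (e := a) Finset.subset_union_left
      (Finset.union_subset hG ((Finset.subset_insert _ _).trans hR))
      (hR (Finset.mem_insert_self _ _))
    have h3 := h a (Finset.mem_insert_self _ _)
    rw [Finset.union_insert]
    linarith

/-- If `x` extends `G`, then it can be added to an independent set `J` at the cost of at most one
element outside `G`: a circuit in `insert x J` is not contained in `insert x G`. -/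
lemma exists_insert_erase_indep {G J : Finset α} {x : α} (hJ : M.Indep (J : Set α))
    (hx : M.Indep (insert x G : Finset α)) (hxJ : x ∉ J) :
    M.Indep (insert x J : Finset α) ∨
      ∃ o ∈ J, o ∉ G ∧ M.Indep (insert x (J.erase o) : Finset α) := by
  by_cases hcl : x ∈ M.closure (J : Set α)
  · right
    have hxJ' : x ∉ (J : Set α) := hxJ
    have hC := hJ.fundCircuit_isCircuit hcl hxJ'
    have : ¬ M.fundCircuit x J ⊆ ((insert x G : Finset α) : Set α) := fun h =>
      hC.not_indep (hx.subset h)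
    obtain ⟨o, ho, hoG⟩ := Set.not_subset.1 this
    rw [Finset.mem_coe, Finset.mem_insert, not_or] at hoG
    have hoJ : o ∈ J := (M.fundCircuit_subset_insert x J ho).resolve_left hoG.1
    refine ⟨o, hoJ, hoG.2, ?_⟩
    have h := (hJ.mem_fundCircuit_iff hcl hxJ').1 ho
    rw [← Finset.erase_insert_of_ne (Ne.symm hoG.1)]
    simpa using h
  · left
    rw [Finset.coe_insert]
    have hxE : x ∈ M.E := hx.subset_ground (by simp)
    exact (hJ.notMem_closure_iff_of_notMem hxJ).1 hcl

/-- Half of the optimum is guaranteed by maintaining an independent set `G ∪ R` such that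
`f (G ∪ R) + f G` does not decrease while `G` grows. -/
lemma greedy_spec (hf : IsMonotoneSubmodularOn U f) (h0 : 0 ≤ f ∅) {k : ℕ} (hk : M.eRank = k)
    {l : List α} (hl : ∀ x ∈ l, x ∈ U) {G : Finset α}
    (hG : G = greedy f (fun S => M.Indep (S : Set α)) l k) :
    (∀ x ∈ G, x ∈ l) ∧ M.Indep (G : Set α) ∧
      ∀ R : Finset α, (∀ x ∈ R, x ∈ l) → M.Indep (R : Set α) → f R ≤ 2 * f G := by
  subst hG
  set I : Finset α → Prop := fun S => M.Indep (S : Set α) with hIdef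
  -- Every round adds an element until no element increases the value.
  have main : ∀ j, (∀ x ∈ greedy f I l j, x ∈ l) ∧ M.Indep (greedy f I l j : Set α) ∧
      ((greedy f I l j).card = j ∨
        ∀ x ∈ l, M.Indep (insert x (greedy f I l j) : Finset α) →
          f (insert x (greedy f I l j)) ≤ f (greedy f I l j)) ∧
      ∀ R : Finset α, (∀ x ∈ R, x ∈ l) → M.Indep (R : Set α) → ∃ R', (∀ x ∈ R', x ∈ l) ∧
        M.Indep (greedy f I l j ∪ R' : Finset α) ∧
        f R ≤ f (greedy f I l j ∪ R') + f (greedy f I l j) := by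
    intro j
    induction j with
    | zero =>
      refine ⟨by simp [greedy], by simp [greedy], by simp [greedy], fun R hR hRI => ⟨R, hR, ?_, ?_⟩⟩
      · simpa [greedy] using hRI
      · simpa [greedy] using h0
    | succ j ih =>
      have hsucc : greedy f I l (j + 1) = greedyRound f I l (greedy f I l j) := by
        simp only [greedy, Function.iterate_succ_apply']
      generalize greedy f I l j = G at ih hsucc
      rw [hsucc]
      clear hsucc
      obtain ⟨hGl, hGI, hcard, hR⟩ := ih
      have hGU : G ⊆ U := fun x hx => hl x (hGl x hx)
      obtain ⟨h1, h2, h3⟩ := bestOf_spec (fun c => (∀ x ∈ c, x ∉ G) ∧ I (insertOpt c G))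
        (fun c => f (insertOpt c G)) (f G, none) (l.map some)
      change _ ≤ (greedyChoice f I l G).1 at h1
      change ∀ x ∈ _, _ → _ ≤ (greedyChoice f I l G).1 at h2
      change greedyChoice f I l G = _ ∨ ∃ x ∈ _, _ ∧ _ ∧ greedyChoice f I l G = _ at h3
      have hmax : ∀ x ∈ l, M.Indep (insert x G : Finset α) →
          f (insert x G) ≤ (greedyChoice f I l G).1 := by
        intro x hx hxI
        by_cases hxG : x ∈ G
        · rw [Finset.insert_eq_of_mem hxG]; exact h1
        · exact h2 (some x) (List.mem_map_of_mem hx) ⟨by simpa using hxG, hxI⟩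
      rcases h3 with h3 | ⟨c, hc, ⟨hcG, hcI⟩, hlt, hceq⟩
      · have hround : greedyRound f I l G = G := by simp [greedyRound, h3, insertOpt]
        rw [hround]
        refine ⟨hGl, hGI, Or.inr ?_, hR⟩
        rwa [h3] at hmax
      · obtain ⟨x, hx, rfl⟩ := List.mem_map.1 hc
        have hround : greedyRound f I l G = insert x G := by simp [greedyRound, hceq, insertOpt]
        have hxG : x ∉ G := by simpa using hcG
        have hxI : M.Indep (insert x G : Finset α) := hcI
        have hltx : f G < f (insert x G) := hlt
        rw [hround]
        rw [hceq] at hmax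
        have hxU : insert x G ⊆ U := Finset.insert_subset (hl x hx) hGU
        refine ⟨?_, hxI, Or.inl ?_, ?_⟩
        · intro y hy
          rcases Finset.mem_insert.1 hy with rfl | hy
          · exact hx
          · exact hGl y hy
        · rw [Finset.card_insert_of_notMem hxG]
          rcases hcard with hcard | hstall
          · rw [hcard]
          · exact absurd (hstall x hx hxI) (not_le.2 hltx)
        · intro R hRl hRI
          obtain ⟨R', hR'l, hR'I, hle⟩ := hR R hRl hRI
          have hR'U : R' ⊆ U := fun y hy => hl y (hR'l y hy)
          have hgain : ∀ o ∈ R', f (insert o G) ≤ f (insert x G) := fun o ho =>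
            hmax o (hR'l o ho) (hR'I.subset (by
              intro y hy
              simp only [Finset.coe_insert, Set.mem_insert_iff, Finset.mem_coe] at hy
              rcases hy with rfl | hy <;> simp [*]))
          by_cases hxR : x ∈ G ∪ R'
          · have hxR' : x ∈ R' := (Finset.mem_union.1 hxR).resolve_left hxG
            refine ⟨R', hR'l, ?_, ?_⟩
            · rwa [Finset.insert_union, Finset.insert_eq_of_mem hxR]
            · rw [Finset.insert_union, Finset.insert_eq_of_mem hxR]; linarith
          · rcases exists_insert_erase_indep (M := M) hR'I hxI hxR with h | ⟨o, ho, hoG, h⟩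
            · refine ⟨R', hR'l, by rwa [Finset.insert_union], ?_⟩
              have := hf.monotone (G ∪ R') (insert x G ∪ R')
                (by rw [Finset.insert_union]; exact Finset.subset_insert _ _)
                (Finset.union_subset hxU hR'U)
              linarith
            · have hoR : o ∈ R' := (Finset.mem_union.1 ho).resolve_left hoG
              have heq : (G ∪ R').erase o = G ∪ R'.erase o := by
                rw [Finset.erase_union_distrib, Finset.erase_eq_of_notMem hoG]
              rw [heq] at h
              refine ⟨R'.erase o, fun y hy => hR'l y (Finset.mem_of_mem_erase hy),
                by rwa [Finset.insert_union], ?_⟩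
              have hEU : R'.erase o ⊆ U := (Finset.erase_subset _ _).trans hR'U
              have e1 := hf.monotone (G ∪ R'.erase o) (insert x G ∪ R'.erase o)
                (by rw [Finset.insert_union]; exact Finset.subset_insert _ _)
                (Finset.union_subset hxU hEU)
              have e2 := hf.marginal_le (X := G) (Y := G ∪ R'.erase o) (e := o)
                Finset.subset_union_left (Finset.union_subset hGU hEU) (hR'U hoR)
              rw [← Finset.union_insert, Finset.insert_erase hoR] at e2
              have e3 := hgain o hoR
              linarith
  obtain ⟨h1, h2, h3, h4⟩ := main k
  refine ⟨h1, h2, fun R hRl hRI => ?_⟩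
  obtain ⟨R', hR'l, hR'I, hle⟩ := h4 R hRl hRI
  have hGU : greedy f I l k ⊆ U := fun x hx => hl x (h1 x hx)
  have : f (greedy f I l k ∪ R') ≤ f (greedy f I l k) := by
    rcases h3 with h3 | h3
    -- A solution with `k` elements is a basis, so that `R'` adds nothing.
    · have hcard : (greedy f I l k ∪ R').card ≤ k := by
        have := hR'I.encard_le_eRank
        rw [hk, Set.encard_coe_eq_coe_finsetCard] at this
        exact_mod_cast this
      have := Finset.eq_of_subset_of_card_le (Finset.subset_union_left (s₁ := greedy f I l k)
        (s₂ := R')) (by rw [h3]; exact hcard)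
      rw [← this]
    · refine hf.union_le_of_marginal_le hGU (fun y hy => hl y (hR'l y hy)) fun o ho => ?_
      refine h3 o (hR'l o ho) (hR'I.subset ?_)
      intro y hy
      simp only [Finset.coe_insert, Set.mem_insert_iff, Finset.mem_coe] at hy
      rcases hy with rfl | hy
      · exact Finset.mem_coe.2 (Finset.mem_union_right _ ho)
      · exact Finset.mem_coe.2 (Finset.mem_union_left _ hy)
  linarith

end Greedy

/-! ### Improving processes on items in random order -/

section Improvement

variable {β σ : Type*}

/-- A random process driven by arriving items. When the item `e` arrives, the state `s` moves to
`arrive s e` with probability `1 - 1 / Q`; otherwise `e` is ignored and the state moves to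
`retry s r` for a uniformly random `r < N`. -/
structure Dynamics (β σ : Type*) where
  arrive : σ → β → σ
  retry : σ → ℕ → σ
  Q : ℕ
  N : ℕ

/-- The expectation of `φ` at the state that follows `s` when `e` arrives. -/
noncomputable def Dynamics.next (D : Dynamics β σ) (φ : σ → ℝ) (e : β) (s : σ) : ℝ :=
  (∑ r ∈ Finset.range D.N, φ (D.retry s r)) / D.N / D.Q + (1 - 1 / D.Q) * φ (D.arrive s e)

/-- The expectation of `φ` at the state reached from `s` when the items of a list arrive. -/
noncomputable def Dynamics.expect (D : Dynamics β σ) (φ : σ → ℝ) : List β → σ → ℝ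
  | [], s => φ s
  | e :: l, s => D.next (D.expect φ l) e s

namespace Dynamics

variable {D : Dynamics β σ}

lemma expect_append (φ : σ → ℝ) (l₁ l₂ : List β) (s : σ) :
    D.expect φ (l₁ ++ l₂) s = D.expect (D.expect φ l₂) l₁ s := by
  induction l₁ generalizing s with
  | nil => rfl
  | cons e l ih =>
    have : D.expect φ (l ++ l₂) = D.expect (D.expect φ l₂) l := funext ih
    simp only [List.cons_append, expect, this]

lemma next_add (φ φ' : σ → ℝ) (e : β) (s : σ) :
    D.next (fun s => φ s + φ' s) e s = D.next φ e s + D.next φ' e s := by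
  simp only [next, Finset.sum_add_distrib]; ring

lemma expect_add (φ φ' : σ → ℝ) (l : List β) (s : σ) :
    D.expect (fun s => φ s + φ' s) l s = D.expect φ l s + D.expect φ' l s := by
  induction l generalizing s with
  | nil => rfl
  | cons e l ih => simp only [expect]; rw [funext ih, next_add]

lemma expect_const_mul (a : ℝ) (φ : σ → ℝ) (l : List β) (s : σ) :
    D.expect (fun s => a * φ s) l s = a * D.expect φ l s := by
  induction l generalizing s with
  | nil => rfl
  | cons e l ih => simp only [expect]; rw [funext ih]; simp only [next, ← Finset.mul_sum]; ring

lemma expect_sub (φ φ' : σ → ℝ) (l : List β) (s : σ) :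
    D.expect (fun s => φ s - φ' s) l s = D.expect φ l s - D.expect φ' l s := by
  have h := expect_add (D := D) φ (fun s => (-1) * φ' s) l s
  rw [expect_const_mul] at h
  rw [sub_eq_add_neg, ← neg_one_mul (D.expect φ' l s), ← h]
  congr; funext s; ring

lemma expect_sum {ι : Type*} (t : Finset ι) (φ : ι → σ → ℝ) (l : List β) (s : σ) :
    D.expect (fun s => ∑ i ∈ t, φ i s) l s = ∑ i ∈ t, D.expect (φ i) l s := by
  classical
  induction t using Finset.induction_on with
  | empty =>
    have := expect_const_mul (D := D) 0 (fun _ => 0) l s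
    simpa using this
  | insert a t ha ih =>
    rw [Finset.sum_insert ha, ← ih, ← expect_add]
    congr; funext s; rw [Finset.sum_insert ha]

lemma expect_const (hQ : 0 < D.Q) (hN : 0 < D.N) (a : ℝ) (l : List β) (s : σ) :
    D.expect (fun _ => a) l s = a := by
  have hQ' : (D.Q : ℝ) ≠ 0 := by positivity
  have hN' : (D.N : ℝ) ≠ 0 := by positivity
  induction l generalizing s with
  | nil => rfl
  | cons e l ih =>
    simp only [expect]; rw [funext ih]
    simp only [next, Finset.sum_const, Finset.card_range, nsmul_eq_mul]
    field_simp; ring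

/-- The properties that make a process with set `V` of items improve towards the value of a fixed
set `O ⊆ V`. The potential gain of `o ∈ O` in the state `s` is `ψ o s`; it is realized by an arrival
of `o` unless `o` has been accepted before. The gains of the accepted elements of `O` are realized
by a random retry, up to the factor `N`. -/
structure Improves (D : Dynamics β σ) [DecidableEq β] (V O : Finset β) (Inv : σ → Prop)
    (val : σ → ℝ) (acc : σ → Finset β) (ψ : β → σ → ℝ) (w : β → ℝ) (c B : ℝ) : Prop where
  Q_pos : 0 < D.Q
  N_pos : 0 < D.N
  subset : O ⊆ V
  inv_arrive : ∀ s, Inv s → ∀ e ∈ V, Inv (D.arrive s e)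
  inv_retry : ∀ s, Inv s → ∀ r, Inv (D.retry s r)
  gain_nonneg : ∀ s, Inv s → ∀ o ∈ O, 0 ≤ ψ o s
  gain_le : ∀ s, Inv s → ∀ o ∈ O, ψ o s ≤ w o
  le_sum_gain : ∀ s, Inv s → c - 2 * val s ≤ ∑ o ∈ O, ψ o s
  val_arrive : ∀ s, Inv s → ∀ e ∈ V, val s ≤ val (D.arrive s e)
  gain_arrive : ∀ s, Inv s → ∀ o ∈ O, o ∉ acc s → ψ o s ≤ val (D.arrive s o) - val s
  val_retry : ∀ s, Inv s → ∀ r, val s ≤ val (D.retry s r)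
  gain_retry : ∀ s, Inv s → ∑ o ∈ O.filter (· ∈ acc s), ψ o s ≤
    ∑ r ∈ Finset.range D.N, (val (D.retry s r) - val s)
  acc_arrive : ∀ s, Inv s → ∀ e ∈ V, acc s ⊆ acc (D.arrive s e)
  acc_retry : ∀ s, Inv s → ∀ r, acc s ⊆ acc (D.retry s r)
  reject : ∀ s, Inv s → ∀ e ∈ V, e ∈ acc (D.arrive s e) ∨ D.arrive s e = s
  val_nonneg : ∀ s, Inv s → 0 ≤ val s
  val_le : ∀ s, Inv s → val s ≤ B

namespace Improves

variable [DecidableEq β] {V O : Finset β} {Inv : σ → Prop} {val : σ → ℝ} {acc : σ → Finset β}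
  {ψ : β → σ → ℝ} {w : β → ℝ} {c B : ℝ}

lemma inv_Q (h : D.Improves V O Inv val acc ψ w c B) : (0 : ℝ) ≤ 1 - 1 / D.Q := by
  have : (1 : ℝ) ≤ D.Q := by exact_mod_cast h.Q_pos
  rw [sub_nonneg, div_le_one (by linarith)]
  exact this

lemma expect_mono (h : D.Improves V O Inv val acc ψ w c B) {φ φ' : σ → ℝ}
    (hφ : ∀ s, Inv s → φ s ≤ φ' s) {l : List β} (hl : ∀ e ∈ l, e ∈ V) {s : σ} (hs : Inv s) :
    D.expect φ l s ≤ D.expect φ' l s := by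
  induction l generalizing s with
  | nil => exact hφ s hs
  | cons e l ih =>
    have ih' := fun {s} => ih (s := s) fun x hx => hl x (by simp [hx])
    simp only [expect, next]
    refine add_le_add ?_ (mul_le_mul_of_nonneg_left
      (ih' (h.inv_arrive s hs e (hl e (by simp)))) h.inv_Q)
    gcongr with r _
    exact ih' (h.inv_retry s hs r)

/-- The potential gain of `o`, as long as `o` has not been accepted. -/
noncomputable def freshGain (acc : σ → Finset β) (ψ : β → σ → ℝ) (o : β) (s : σ) : ℝ :=
  if o ∈ acc s then 0 else ψ o s

lemma freshGain_nonneg (h : D.Improves V O Inv val acc ψ w c B) {s : σ} (hs : Inv s) {o : β}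
    (ho : o ∈ O) : 0 ≤ freshGain acc ψ o s := by
  unfold freshGain; split_ifs
  · exact le_rfl
  · exact h.gain_nonneg s hs o ho

lemma freshGain_le (h : D.Improves V O Inv val acc ψ w c B) {s : σ} (hs : Inv s) {o : β}
    (ho : o ∈ O) : freshGain acc ψ o s ≤ w o := by
  unfold freshGain; split_ifs
  · exact (h.gain_nonneg s hs o ho).trans (h.gain_le s hs o ho)
  · exact h.gain_le s hs o ho

lemma expect_freshGain_le (h : D.Improves V O Inv val acc ψ w c B) {s : σ} (hs : Inv s) {o : β}
    (ho : o ∈ O) {l : List β} (hl : ∀ e ∈ l, e ∈ V) :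
    D.expect (freshGain acc ψ o) l s ≤ w o :=
  (h.expect_mono (fun _ hs => h.freshGain_le hs ho) hl hs).trans_eq
    (expect_const h.Q_pos h.N_pos _ _ _)

lemma expect_freshGain_of_mem (h : D.Improves V O Inv val acc ψ w c B) {o : β} {l : List β}
    (hl : ∀ e ∈ l, e ∈ V) {s : σ} (hs : Inv s) (hos : o ∈ acc s) :
    D.expect (freshGain acc ψ o) l s = 0 := by
  induction l generalizing s with
  | nil => simp [expect, freshGain, hos]
  | cons e l ih =>
    have ih' := fun {s} => ih (s := s) fun x hx => hl x (by simp [hx])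
    have he := hl e (by simp)
    simp only [expect, next]
    rw [ih' (h.inv_arrive s hs e he) (h.acc_arrive s hs e he hos),
      Finset.sum_eq_zero fun r _ => ih' (h.inv_retry s hs r) (h.acc_retry s hs r hos)]
    simp

/-- An item that arrived earlier and has not been accepted has left no trace, unless its arrival was
ignored. -/
lemma expect_freshGain_remove (h : D.Improves V O Inv val acc ψ w c B) {o : β} (ho : o ∈ O)
    {l₁ l₂ : List β} (h₁ : ∀ e ∈ l₁, e ∈ V) (h₂ : ∀ e ∈ l₂, e ∈ V) {s : σ} (hs : Inv s) :
    D.expect (freshGain acc ψ o) (l₁ ++ o :: l₂) s ≤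
      (1 - 1 / D.Q) * D.expect (freshGain acc ψ o) (l₁ ++ l₂) s + w o / D.Q := by
  rw [expect_append, expect_append, ← expect_const_mul,
    ← expect_const (D := D) h.Q_pos h.N_pos (w o / D.Q) l₁ s, ← expect_add]
  refine h.expect_mono (fun s hs => ?_) h₁ hs
  simp only [expect, next]
  rw [add_comm]
  refine add_le_add (mul_le_mul_of_nonneg_left ?_ h.inv_Q) ?_
  · rcases h.reject s hs o (h.subset ho) with hr | hr
    · rw [h.expect_freshGain_of_mem h₂ (h.inv_arrive s hs o (h.subset ho)) hr]
      exact (expect_const h.Q_pos h.N_pos 0 l₂ s).symm.le.trans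
        (h.expect_mono (fun _ hs => h.freshGain_nonneg hs ho) h₂ hs)
    · rw [hr]
  · have hN : (0 : ℝ) < D.N := by exact_mod_cast h.N_pos
    refine div_le_div_of_nonneg_right ?_ (Nat.cast_nonneg _)
    rw [div_le_iff₀ hN]
    refine (Finset.sum_le_sum fun r _ =>
      h.expect_freshGain_le (h.inv_retry s hs r) ho h₂).trans_eq ?_
    simp [mul_comm]

/-- The increase of the value that is due to the arrival of `e`. -/
lemma next_sub_ge_arrive (h : D.Improves V O Inv val acc ψ w c B) {s : σ} (hs : Inv s) {e : β}
    (he : e ∈ V) : (1 - 1 / D.Q) * (if e ∈ O then freshGain acc ψ e s else 0) ≤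
      D.next val e s - val s := by
  have hN : (0 : ℝ) < D.N := by exact_mod_cast h.N_pos
  have hQ : (0 : ℝ) < D.Q := by exact_mod_cast h.Q_pos
  have h1 : val s / D.Q ≤ (∑ r ∈ Finset.range D.N, val (D.retry s r)) / D.N / D.Q := by
    refine div_le_div_of_nonneg_right ?_ hQ.le
    rw [le_div_iff₀ hN]
    refine le_trans (le_of_eq ?_) (Finset.sum_le_sum fun r _ => h.val_retry s hs r)
    simp [mul_comm]
  have h2 : (if e ∈ O then freshGain acc ψ e s else 0) ≤ val (D.arrive s e) - val s := by
    have := sub_nonneg.2 (h.val_arrive s hs e he)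
    split_ifs with heO
    · unfold freshGain; split_ifs with hea
      · exact this
      · exact h.gain_arrive s hs e heO hea
    · exact this
  have h3 := mul_le_mul_of_nonneg_left h2 h.inv_Q
  have h4 : val s / D.Q = 1 / D.Q * val s := by ring
  simp only [next]
  rw [h4] at h1
  linarith

/-- The increase of the value that is due to a retry. -/
lemma next_sub_ge_retry (h : D.Improves V O Inv val acc ψ w c B) {s : σ} (hs : Inv s) {e : β}
    (he : e ∈ V) : ∑ o ∈ O.filter (· ∈ acc s), ψ o s ≤
      (D.Q * D.N : ℝ) * (D.next val e s - val s) := by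
  have hN : (0 : ℝ) < D.N := by exact_mod_cast h.N_pos
  have hQ : (0 : ℝ) < D.Q := by exact_mod_cast h.Q_pos
  refine (h.gain_retry s hs).trans ?_
  have h2 := mul_nonneg h.inv_Q (sub_nonneg.2 (h.val_arrive s hs e he))
  have h3 : D.next val e s - val s =
      (∑ r ∈ Finset.range D.N, (val (D.retry s r) - val s)) / (D.Q * D.N) +
        (1 - 1 / D.Q) * (val (D.arrive s e) - val s) := by
    simp only [next, Finset.sum_sub_distrib, Finset.sum_const, Finset.card_range, nsmul_eq_mul]
    field_simp; ring
  rw [h3, mul_add, mul_div_cancel₀ _ (by positivity)]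
  have : 0 ≤ (D.Q * D.N : ℝ) * ((1 - 1 / D.Q) * (val (D.arrive s e) - val s)) := by positivity
  linarith

end Improves

end Dynamics

end Improvement

section RandomArrangement

variable {β : Type*} {m : ℕ}

/-- The items `y` in the order given by the permutation `π` of the positions. -/
def arrange (y : Fin m → β) (π : Equiv.Perm (Fin m)) : List β := List.ofFn fun i => y (π i)

lemma length_arrange (y : Fin m → β) (π : Equiv.Perm (Fin m)) : (arrange y π).length = m := by
  simp [arrange]

lemma getElem_arrange (y : Fin m → β) (π : Equiv.Perm (Fin m)) (i : ℕ)
    (hi : i < (arrange y π).length) :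
    (arrange y π)[i] = y (π ⟨i, by simpa [arrange] using hi⟩) := by
  simp [arrange]

lemma getElem?_arrange (y : Fin m → β) (π : Equiv.Perm (Fin m)) (i : Fin m) :
    (arrange y π)[i.val]? = some (y (π i)) := by
  simp [arrange]

lemma take_arrange_swap (y : Fin m → β) (π : Equiv.Perm (Fin m)) {t p : Fin m} (h : t ≤ p) :
    (arrange y (π * Equiv.swap t p)).take t = (arrange y π).take t := by
  refine List.ext_getElem (by simp [length_arrange]) fun i h1 h2 => ?_
  have hi : i < t.val := by simpa [length_arrange] using h1
  simp only [List.getElem_take, getElem_arrange, Equiv.Perm.mul_apply]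
  rw [Equiv.swap_apply_of_ne_of_ne]
  · exact fun h => by simp [Fin.ext_iff] at h; omega
  · exact fun h' => by simp [Fin.ext_iff] at h'; have : t.val ≤ p.val := h; omega

lemma take_arrange_cycle (y : Fin m → β) (π : Equiv.Perm (Fin m)) {t p : Fin m} (h : p ≤ t) :
    (arrange y (π * Fin.cycleIcc p t)).take t =
      (arrange y π).take p ++ ((arrange y π).take (t + 1)).drop (p + 1) := by
  have : NeZero m := ⟨by have := t.2; omega⟩
  have hpt : p.val ≤ t.val := h
  have ht := t.2
  refine List.ext_getElem (by simp [length_arrange]; omega) fun i h1 h2 => ?_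
  have hi : i < t.val := by simpa [length_arrange] using h1
  rw [List.getElem_append]
  simp only [List.getElem_take, getElem_arrange, Equiv.Perm.mul_apply, List.length_take,
    length_arrange, List.getElem_drop]
  split_ifs with hip
  · rw [Fin.cycleIcc_of_lt]
    rw [Fin.lt_def]; simp; omega
  · congr 2
    rw [Fin.cycleIcc_of_ge_of_lt]
    · ext
      rw [Fin.val_add_one_of_lt']
      · simp; omega
      · simp; omega
    · rw [Fin.le_def]; simp; omega
    · rw [Fin.lt_def]; exact hi

lemma mem_of_mem_arrange {y : Fin m → β} {V : Finset β} (hy : ∀ i, y i ∈ V)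
    (π : Equiv.Perm (Fin m)) : ∀ e ∈ arrange y π, e ∈ V := by
  intro e he
  simp only [arrange, List.mem_ofFn] at he
  obtain ⟨i, rfl⟩ := he
  exact hy _

namespace Dynamics.Improves

variable {σ : Type*} [DecidableEq β] {D : Dynamics β σ} {V O : Finset β} {Inv : σ → Prop}
  {val : σ → ℝ} {acc : σ → Finset β} {ψ : β → σ → ℝ} {w : β → ℝ} {c B : ℝ}

/-- The total over all arrangements with the item `o` at position `t` of its expected gain at that
time. -/
noncomputable def totalGain (D : Dynamics β σ) (acc : σ → Finset β) (ψ : β → σ → ℝ) (s₀ : σ)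
    (y : Fin m → β) (o : β) (t : ℕ) : ℝ :=
  ∑ π : Equiv.Perm (Fin m), if (arrange y π)[t]? = some o then
    D.expect (freshGain acc ψ o) ((arrange y π).take t) s₀ else 0

variable {y : Fin m → β} {s₀ : σ}

/-- If `o` arrives at a position `p ≥ t`, then its position may be changed to `t`: the items before
position `t` remain the same. -/
lemma sum_later {o : β} {t p : Fin m} (h : t ≤ p) :
    ∑ π : Equiv.Perm (Fin m), (if (arrange y π)[p.val]? = some o then
      D.expect (freshGain acc ψ o) ((arrange y π).take t) s₀ else 0) =
      totalGain D acc ψ s₀ y o t := by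
  unfold totalGain
  refine Fintype.sum_equiv (Equiv.mulRight (Equiv.swap t p)) _ _ fun π => ?_
  simp only [Equiv.coe_mulRight, take_arrange_swap y π h, getElem?_arrange, Equiv.Perm.mul_apply,
    Equiv.swap_apply_left]

/-- If `o` arrives at a position `p ≤ t`, then its position may be changed to `t`: a gain that is
still fresh after `t + 1` items is not affected by the removal of `o` from them, unless `o` has been
ignored. -/
lemma sum_earlier (h : D.Improves V O Inv val acc ψ w c B) (hs : Inv s₀) (hy : ∀ i, y i ∈ V)
    {o : β} (ho : o ∈ O) {t p : Fin m} (hpt : p ≤ t) :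
    ∑ π : Equiv.Perm (Fin m), (if (arrange y π)[p.val]? = some o then
      D.expect (freshGain acc ψ o) ((arrange y π).take (t + 1)) s₀ else 0) ≤
      (1 - 1 / D.Q) * totalGain D acc ψ s₀ y o t +
        ∑ π : Equiv.Perm (Fin m), if (arrange y π)[p.val]? = some o then w o / D.Q else 0 := by
  have : NeZero m := ⟨by have := t.2; omega⟩
  have hpt' : p.val ≤ t.val := hpt
  have key : totalGain D acc ψ s₀ y o t = ∑ π : Equiv.Perm (Fin m),
      if (arrange y π)[p.val]? = some o then D.expect (freshGain acc ψ o)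
        ((arrange y π).take p ++ ((arrange y π).take (t + 1)).drop (p + 1)) s₀ else 0 := by
    unfold totalGain
    refine (Fintype.sum_equiv (Equiv.mulRight (Fin.cycleIcc p t)) _ _ fun π => ?_).symm
    simp only [Equiv.coe_mulRight, take_arrange_cycle y π hpt, getElem?_arrange,
      Equiv.Perm.mul_apply, Fin.cycleIcc_of_last hpt]
  rw [key, Finset.mul_sum, ← Finset.sum_add_distrib]
  refine Finset.sum_le_sum fun π _ => ?_
  split_ifs with hp
  · have hlen : p.val < ((arrange y π).take (t + 1)).length := by
      simp [length_arrange]; omega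
    have hsplit : (arrange y π).take (t + 1) =
        (arrange y π).take p ++ o :: ((arrange y π).take (t + 1)).drop (p + 1) := by
      conv_lhs => rw [← List.take_append_drop p ((arrange y π).take (t + 1)),
        List.drop_eq_getElem_cons hlen]
      congr 1
      · rw [List.take_take]; congr 1; omega
      · congr 1
        rw [List.getElem_take]
        rw [List.getElem?_eq_some_iff] at hp
        exact hp.2
    conv_lhs => rw [hsplit]
    refine h.expect_freshGain_remove ho ?_ ?_ hs
    · exact fun e he => mem_of_mem_arrange hy π e (List.mem_of_mem_take he)
    · exact fun e he => mem_of_mem_arrange hy π e (List.mem_of_mem_take (List.mem_of_mem_drop he))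
  · simp

/-- The expected gain of `o` at time `t`, in terms of the gains that are realized when `o` arrives
just after `t` or `t - 1` items. -/
lemma sum_expect_freshGain_le (h : D.Improves V O Inv val acc ψ w c B) (hs : Inv s₀)
    (hinj : Function.Injective y) (hy : ∀ e, e ∈ V ↔ ∃ i, y i = e)
    {o : β} (ho : o ∈ O) {t : ℕ} (ht : t < m) :
    ∑ π : Equiv.Perm (Fin m), D.expect (freshGain acc ψ o) ((arrange y π).take t) s₀ ≤
      (1 - 1 / D.Q) * ((m - t : ℝ) * totalGain D acc ψ s₀ y o t +
        t * totalGain D acc ψ s₀ y o (t - 1)) + m.factorial * (w o / D.Q) := by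
  have hyV : ∀ i, y i ∈ V := fun i => (hy _).2 ⟨i, rfl⟩
  obtain ⟨j, hj⟩ := (hy o).1 (h.subset ho)
  have honce : ∀ (π : Equiv.Perm (Fin m)) (x : ℝ),
      x = ∑ p : Fin m, if (arrange y π)[p.val]? = some o then x else 0 := by
    intro π x
    rw [Finset.sum_eq_single (π.symm j)]
    · rw [getElem?_arrange]; simp [hj]
    · intro p _ hp
      rw [getElem?_arrange, if_neg]
      intro hpo
      simp only [Option.some.injEq] at hpo
      exact hp (by rw [← hinj (hpo.trans hj.symm)]; simp)
    · simp
  have hpos : ∀ p : Fin m, ∑ π : Equiv.Perm (Fin m), (if (arrange y π)[p.val]? = some o then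
      D.expect (freshGain acc ψ o) ((arrange y π).take t) s₀ else 0) ≤
      (1 - 1 / D.Q) * (if p.val < t then totalGain D acc ψ s₀ y o (t - 1)
        else totalGain D acc ψ s₀ y o t) +
        ∑ π : Equiv.Perm (Fin m), if (arrange y π)[p.val]? = some o then w o / D.Q else 0 := by
    intro p
    split_ifs with hpt
    · have h1 : t = t - 1 + 1 := by omega
      have := h.sum_earlier hs hyV ho (t := ⟨t - 1, by omega⟩) (p := p)
        (by rw [Fin.le_def]; simp; omega)
      simp only at this
      rw [← h1] at this
      exact this
    · have h2 := sum_later (D := D) (acc := acc) (ψ := ψ) (s₀ := s₀) (y := y) (o := o)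
        (t := ⟨t, ht⟩) (p := p) (by rw [Fin.le_def]; simp; omega)
      simp only at h2
      have h3 : totalGain D acc ψ s₀ y o t = (1 - 1 / D.Q) * totalGain D acc ψ s₀ y o t +
          1 / D.Q * totalGain D acc ψ s₀ y o t := by ring
      rw [h2]
      conv_lhs => rw [h3]
      have h4 : 1 / D.Q * totalGain D acc ψ s₀ y o t ≤
          ∑ π : Equiv.Perm (Fin m), if (arrange y π)[p.val]? = some o then w o / D.Q else 0 := by
        rw [← h2, Finset.mul_sum]
        refine Finset.sum_le_sum fun π _ => ?_
        split_ifs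
        · rw [div_mul_eq_mul_div, one_mul]
          refine div_le_div_of_nonneg_right ?_ (Nat.cast_nonneg _)
          exact h.expect_freshGain_le hs ho
            fun e he => mem_of_mem_arrange hyV π e (List.mem_of_mem_take he)
        · simp
      linarith
  calc _ = ∑ p : Fin m, ∑ π : Equiv.Perm (Fin m), (if (arrange y π)[p.val]? = some o then
        D.expect (freshGain acc ψ o) ((arrange y π).take t) s₀ else 0) := by
        rw [Finset.sum_comm]
        exact Finset.sum_congr rfl fun π _ => honce π _
    _ ≤ _ := Finset.sum_le_sum fun p _ => hpos p
    _ = _ := by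
        rw [Finset.sum_add_distrib, ← Finset.mul_sum, Finset.sum_comm]
        congr 1
        · congr 1
          rw [Fin.sum_univ_eq_sum_range (fun i => if i < t then totalGain D acc ψ s₀ y o (t - 1)
            else totalGain D acc ψ s₀ y o t) m, Finset.sum_ite, Finset.sum_const, Finset.sum_const]
          have e1 : ((Finset.range m).filter fun i => i < t) = Finset.range t := by
            ext i; simp; omega
          have e2 : ((Finset.range m).filter fun i => ¬ i < t) = Finset.Ico t m := by
            ext i; simp; omega
          rw [e1, e2, Finset.card_range, Nat.card_Ico, nsmul_eq_mul, nsmul_eq_mul,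
            Nat.cast_sub ht.le]
          ring
        · rw [Finset.sum_congr rfl fun π _ => (honce π (w o / D.Q)).symm]
          simp [Fintype.card_perm]

end Dynamics.Improves

end RandomArrangement

/-- A discrete form of the differential inequality `u' ≥ c - 2 u` on `[0, 1]` with time step
`1 / m`, in which a fraction `t / m` of the increment at time `t` is delayed by one step. -/
lemma le_of_delayed_recurrence {m : ℕ} (hm : 2 ≤ m) {u : ℕ → ℝ} {c K B : ℝ} (hK : 0 ≤ K)
    (hu0 : ∀ t ≤ m, 0 ≤ u t) (huB : ∀ t ≤ m, u t ≤ B) (hmono : ∀ t < m, u t ≤ u (t + 1))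
    (h : ∀ t < m, c - 2 * u t ≤
      (m - t) * (u (t + 1) - u t) + t * (u t - u (t - 1)) + K * (u (t + 1) - u t)) :
    1 / 2 * (1 - Real.exp (-2)) * c - (K + 3) * B / m ≤ u m := by
  have hm' : (2 : ℝ) ≤ m := by exact_mod_cast hm
  have hm0 : (0 : ℝ) < m := by linarith
  have hB : 0 ≤ B := (hu0 0 (by omega)).trans (huB 0 (by omega))
  set q : ℝ := 1 - 2 / m with hq
  have hq0 : 0 ≤ q := by
    rw [hq, sub_nonneg, div_le_one hm0]; exact hm'
  have hq1 : q ≤ 1 := by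
    have : (0 : ℝ) ≤ 2 / m := by positivity
    linarith
  -- The average `v` of two consecutive values satisfies a recurrence without delay, up to the
  -- accumulated error `E`.
  let v : ℕ → ℝ := fun t => (1 - t / m) * u t + t / m * u (t - 1)
  let E : ℕ → ℝ := fun t => ((K + 1) * u t + 2 * u (t - 1)) / m
  have main : ∀ t ≤ m, c / 2 * (1 - q ^ t) - E t ≤ v t := by
    intro t
    induction t with
    | zero =>
      intro _
      have := hu0 0 (by omega)
      have hE : 0 ≤ E 0 := by simp only [E]; positivity
      simp only [v, pow_zero, sub_self, mul_zero, Nat.cast_zero, zero_div, sub_zero, one_mul,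
        zero_mul, add_zero]
      linarith
    | succ t ih =>
      intro ht
      have ih := ih (by omega)
      have h1 := h t (by omega)
      have hut := hu0 t (by omega)
      have hut' := hu0 (t - 1) (by omega)
      have hmono' : u (t - 1) ≤ u t := by
        rcases Nat.eq_zero_or_pos t with rfl | hp
        · exact le_rfl
        · have := hmono (t - 1) (by omega)
          rwa [Nat.sub_add_cancel hp] at this
      have hE : 0 ≤ E t := by simp only [E]; positivity
      have htm : (t : ℝ) / m ≤ 1 := by
        rw [div_le_one hm0]; exact_mod_cast (by omega : t ≤ m)
      have hv : u t ≤ v t + (u t - u (t - 1)) := by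
        have : v t = u t - t / m * (u t - u (t - 1)) := by simp only [v]; ring
        rw [this]
        have := mul_le_mul_of_nonneg_right htm (sub_nonneg.2 hmono')
        linarith
      have hstep : v (t + 1) = v t + ((m - t) * (u (t + 1) - u t) + t * (u t - u (t - 1))
          - (u (t + 1) - u t)) / m := by
        simp only [v, Nat.add_sub_cancel]; push_cast; field_simp; ring
      have hE' : E (t + 1) = E t + ((K + 1) * (u (t + 1) - u t) + 2 * (u t - u (t - 1))) / m := by
        simp only [E, Nat.add_sub_cancel]; field_simp; ring
      have h2 : (c - 2 * v t - 2 * (u t - u (t - 1)) - (K + 1) * (u (t + 1) - u t)) / m ≤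
          ((m - t) * (u (t + 1) - u t) + t * (u t - u (t - 1)) - (u (t + 1) - u t)) / m := by
        refine div_le_div_of_nonneg_right ?_ hm0.le
        linarith
      have h3 : (c - 2 * v t - 2 * (u t - u (t - 1)) - (K + 1) * (u (t + 1) - u t)) / m =
          c / m - 2 / m * v t
            - ((K + 1) * (u (t + 1) - u t) + 2 * (u t - u (t - 1))) / m := by
        field_simp; ring
      have h4 := mul_le_mul_of_nonneg_left ih hq0
      have h5 : q * E t ≤ E t := mul_le_of_le_one_left hE hq1
      have h6 : c / 2 * (1 - q ^ (t + 1)) = q * (c / 2 * (1 - q ^ t)) + c / m := by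
        rw [pow_succ, hq]; field_simp; ring
      have h7 : q * v t = v t - 2 / m * v t := by rw [hq]; ring
      rw [hstep, hE', h6]
      rw [h3] at h2
      rw [mul_sub] at h4
      linarith
  have hfin := main m le_rfl
  have hv : v m ≤ u m := by
    simp only [v]
    rw [div_self hm0.ne', sub_self, zero_mul, zero_add, one_mul]
    have := hmono (m - 1) (by omega)
    rwa [Nat.sub_add_cancel (by omega)] at this
  have hE : E m ≤ (K + 3) * B / m := by
    simp only [E]
    refine div_le_div_of_nonneg_right ?_ hm0.le
    have h1 := mul_le_mul_of_nonneg_left (huB m le_rfl) (by linarith : 0 ≤ K + 1)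
    have h2 := huB (m - 1) (by omega)
    linarith
  have hexp : q ^ m ≤ Real.exp (-2) := Real.one_sub_div_pow_le_exp_neg hm'
  have he1 : Real.exp (-2) ≤ 1 := Real.exp_le_one_iff.2 (by norm_num)
  rcases le_total c 0 with hc | hc
  · have h1 : 1 / 2 * (1 - Real.exp (-2)) * c ≤ 0 :=
      mul_nonpos_of_nonneg_of_nonpos (by linarith) hc
    have h2 : 0 ≤ (K + 3) * B / m := by positivity
    have h3 := hu0 m le_rfl
    linarith
  · have := mul_le_mul_of_nonneg_left (sub_le_sub_left hexp 1) (by linarith : 0 ≤ c / 2)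
    linarith

namespace Dynamics.Improves

variable {β σ : Type*} {m : ℕ} [DecidableEq β] {D : Dynamics β σ} {V O : Finset β} {Inv : σ → Prop}
  {val : σ → ℝ} {acc : σ → Finset β} {ψ : β → σ → ℝ} {w : β → ℝ} {c B : ℝ}
  {y : Fin m → β} {s₀ : σ}

/-- An improving process that meets its items in uniformly random order ends with almost
`(1 - exp (-2)) / 2` times the value it improves towards. -/
theorem le_average (h : D.Improves V O Inv val acc ψ w c B) (hs : Inv s₀) (hm : 2 ≤ m)
    (hinj : Function.Injective y) (hy : ∀ e, e ∈ V ↔ ∃ i, y i = e) :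
    1 / 2 * (1 - Real.exp (-2)) * (c - (∑ o ∈ O, w o) / D.Q) - (D.Q * D.N + 3) * B / m ≤
      (∑ π : Equiv.Perm (Fin m), D.expect val (arrange y π) s₀) / m.factorial := by
  have hyV : ∀ i, y i ∈ V := fun i => (hy _).2 ⟨i, rfl⟩
  have hLV : ∀ π t, ∀ e ∈ (arrange y π).take t, e ∈ V := fun π t e he =>
    mem_of_mem_arrange hyV π e (List.mem_of_mem_take he)
  have hfac : (0 : ℝ) < m.factorial := by exact_mod_cast m.factorial_pos
  have hcard : ∑ _π : Equiv.Perm (Fin m), (1 : ℝ) = m.factorial := by simp [Fintype.card_perm]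
  let S : ℕ → ℝ := fun t => ∑ π : Equiv.Perm (Fin m), D.expect val ((arrange y π).take t) s₀
  have hlast : ∑ π : Equiv.Perm (Fin m), D.expect val (arrange y π) s₀ = S m := by
    refine Finset.sum_congr rfl fun π _ => ?_
    rw [List.take_of_length_le (by rw [length_arrange])]
  have hdiff : ∀ t < m, ∀ π : Equiv.Perm (Fin m), ∃ e ∈ V, (arrange y π)[t]? = some e ∧
      D.expect val ((arrange y π).take (t + 1)) s₀ - D.expect val ((arrange y π).take t) s₀ =
        D.expect (fun s => D.next val e s - val s) ((arrange y π).take t) s₀ := by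
    intro t ht π
    refine ⟨y (π ⟨t, ht⟩), hyV _, getElem?_arrange y π ⟨t, ht⟩, ?_⟩
    rw [expect_sub, List.take_add_one, getElem?_arrange y π ⟨t, ht⟩, expect_append]
    rfl
  have harr : ∀ t < m, (1 - 1 / D.Q) * ∑ o ∈ O, totalGain D acc ψ s₀ y o t ≤ S (t + 1) - S t := by
    intro t ht
    simp only [S, totalGain]
    rw [← Finset.sum_sub_distrib, Finset.sum_comm, Finset.mul_sum]
    refine Finset.sum_le_sum fun π _ => ?_
    obtain ⟨e, heV, het, hd⟩ := hdiff t ht π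
    rw [hd]
    refine le_trans ?_ (h.expect_mono (fun s hs => h.next_sub_ge_arrive hs heV) (hLV π t) hs)
    rw [expect_const_mul]
    refine mul_le_mul_of_nonneg_left (le_of_eq ?_) h.inv_Q
    rw [het]
    by_cases heO : e ∈ O
    · rw [Finset.sum_eq_single e]
      · simp only [if_true, heO]
      · intro o _ hoe
        rw [if_neg]
        simpa using hoe.symm
      · exact fun h => absurd heO h
    · rw [Finset.sum_eq_zero]
      · simp only [heO, if_false]
        exact (expect_const h.Q_pos h.N_pos 0 _ _).symm
      · intro o ho
        rw [if_neg]
        simp only [Option.some.injEq]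
        exact fun h => heO (h ▸ ho)
  have hret : ∀ t < m, ∑ π : Equiv.Perm (Fin m),
      D.expect (fun s => ∑ o ∈ O.filter (· ∈ acc s), ψ o s) ((arrange y π).take t) s₀ ≤
      (D.Q * D.N : ℝ) * (S (t + 1) - S t) := by
    intro t ht
    simp only [S]
    rw [← Finset.sum_sub_distrib, Finset.mul_sum]
    refine Finset.sum_le_sum fun π _ => ?_
    obtain ⟨e, heV, het, hd⟩ := hdiff t ht π
    rw [hd, ← expect_const_mul]
    exact h.expect_mono (fun s hs => h.next_sub_ge_retry hs heV) (hLV π t) hs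
  have htot : ∀ t, m.factorial * c - 2 * S t ≤
      (∑ o ∈ O, ∑ π : Equiv.Perm (Fin m),
        D.expect (freshGain acc ψ o) ((arrange y π).take t) s₀) +
      ∑ π : Equiv.Perm (Fin m),
        D.expect (fun s => ∑ o ∈ O.filter (· ∈ acc s), ψ o s) ((arrange y π).take t) s₀ := by
    intro t
    simp only [S]
    rw [← hcard, Finset.sum_mul, Finset.mul_sum, ← Finset.sum_sub_distrib, Finset.sum_comm,
      ← Finset.sum_add_distrib]
    refine Finset.sum_le_sum fun π _ => ?_
    rw [← expect_sum, ← expect_add, one_mul, ← expect_const (D := D) h.Q_pos h.N_pos c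
      ((arrange y π).take t) s₀, ← expect_const_mul, ← expect_sub]
    refine h.expect_mono (fun s hs => ?_) (hLV π t) hs
    refine (h.le_sum_gain s hs).trans (le_of_eq ?_)
    rw [Finset.sum_filter, ← Finset.sum_add_distrib]
    refine Finset.sum_congr rfl fun o _ => ?_
    unfold freshGain
    split_ifs <;> simp
  rw [hlast]
  refine le_of_delayed_recurrence (u := fun t => S t / m.factorial) hm (by positivity) ?_ ?_ ?_ ?_
  · intro t _
    refine div_nonneg (Finset.sum_nonneg fun π _ => ?_) hfac.le
    rw [← expect_const (D := D) h.Q_pos h.N_pos 0 ((arrange y π).take t) s₀]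
    exact h.expect_mono h.val_nonneg (hLV π t) hs
  · intro t _
    rw [div_le_iff₀ hfac, ← hcard, Finset.mul_sum]
    refine Finset.sum_le_sum fun π _ => ?_
    rw [mul_one, ← expect_const (D := D) h.Q_pos h.N_pos B ((arrange y π).take t) s₀]
    exact h.expect_mono h.val_le (hLV π t) hs
  · intro t ht
    refine div_le_div_of_nonneg_right ?_ hfac.le
    have := harr t ht
    refine sub_nonneg.1 (le_trans (mul_nonneg h.inv_Q (Finset.sum_nonneg fun o ho => ?_)) this)
    refine Finset.sum_nonneg fun π _ => ?_
    split_ifs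
    · rw [← expect_const (D := D) h.Q_pos h.N_pos 0 ((arrange y π).take t) s₀]
      exact h.expect_mono (fun s hs => h.freshGain_nonneg hs ho) (hLV π t) hs
    · exact le_rfl
  · intro t ht
    have hfresh : ∑ o ∈ O, ∑ π : Equiv.Perm (Fin m),
        D.expect (freshGain acc ψ o) ((arrange y π).take t) s₀ ≤
        (m - t) * (S (t + 1) - S t) + t * (S t - S (t - 1)) +
          m.factorial * ((∑ o ∈ O, w o) / D.Q) := by
      refine (Finset.sum_le_sum fun o ho =>
        h.sum_expect_freshGain_le hs hinj hy ho ht).trans ?_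
      rw [Finset.sum_add_distrib, ← Finset.mul_sum, ← Finset.mul_sum, Finset.sum_add_distrib,
        ← Finset.mul_sum, ← Finset.mul_sum, ← Finset.sum_div]
      refine add_le_add_left ?_ _
      have h1 := mul_le_mul_of_nonneg_left (harr t ht)
        (sub_nonneg.2 (by exact_mod_cast ht.le : (t : ℝ) ≤ m))
      have h2 : (t : ℝ) * ((1 - 1 / D.Q) * ∑ o ∈ O, totalGain D acc ψ s₀ y o (t - 1)) ≤
          t * (S t - S (t - 1)) := by
        rcases Nat.eq_zero_or_pos t with rfl | hp
        · simp
        · have := harr (t - 1) (by omega)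
          rw [Nat.sub_add_cancel hp] at this
          exact mul_le_mul_of_nonneg_left this (Nat.cast_nonneg _)
      linarith
    have h1 := htot t
    have h2 := hret t ht
    rw [← mul_le_mul_iff_right₀ hfac]
    have e : ∀ x : ℝ, (m.factorial : ℝ) * (x / m.factorial) = x := fun x => by field_simp
    simp only [mul_add, mul_sub]
    simp only [mul_left_comm (m.factorial : ℝ), e]
    linarith

end Dynamics.Improves

/-! ### Local search by swaps -/

section Swaps

/-- The parameters of the local search: the oracles, the value `level` to which gains are compared,
the denominator `Q` of all small fractions, the rank `k`, and the largest number `N` of items that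
may be accepted. -/
structure Params (β : Type*) where
  value : Finset β → ℝ
  indep : Finset β → Prop
  level : ℝ
  Q : ℕ
  k : ℕ
  N : ℕ

/-- The items accepted so far, in the order of their acceptance, and the current solution. -/
structure State (β : Type*) where
  acc : List β
  sol : Finset β

variable {β : Type*} [DecidableEq β] (P : Params β)

/-- The best way to add the item `e` to the solution and erase at most one element, with the value
that it leads to; erasing `e` itself means that the solution stays as it is. -/
noncomputable def swapBest (s : State β) (e : β) : ℝ × Option β :=
  bestOf (fun c => (∀ x ∈ c, x ∈ insert e s.sol) ∧ P.indep (eraseOpt c (insert e s.sol)))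
    (fun c => P.value (eraseOpt c (insert e s.sol))) (P.value s.sol, some e)
    (none :: s.acc.map some)

/-- The threshold test for a gain `x` of the solution: it has to exceed a fraction `1 / (Q * k)` of
the level and of the value of the solution. -/
def Worthwhile (s : State β) (x : ℝ) : Prop :=
  P.level < P.Q * (P.k * x) ∧ P.value s.sol < P.Q * (P.k * x)

open Classical in
/-- The element to be erased after the insertion of `e`: `e` itself unless the best swap is
worthwhile. -/
noncomputable def swapChoice (s : State β) (e : β) : Option β :=
  if Worthwhile P s ((swapBest P s e).1 - P.value s.sol) then (swapBest P s e).2 else some e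

/-- The solution after the item `e` has been tried. -/
noncomputable def swapped (s : State β) (e : β) : Finset β :=
  eraseOpt (swapChoice P s e) (insert e s.sol)

/-- The effect of the arrival of `e`; an item that has been accepted is not accepted again. -/
noncomputable def arriveStep (s : State β) (e : β) : State β :=
  if P.N ≤ s.acc.length ∨ e ∈ s.acc then s
  else if swapChoice P s e = some e then s else ⟨s.acc ++ [e], swapped P s e⟩

/-- The effect of trying the accepted item with index `r` again. -/
noncomputable def retryStep (s : State β) (r : ℕ) : State β :=
  match s.acc[r]? with
  | none => s
  | some e => if e ∈ s.sol then s else ⟨s.acc, swapped P s e⟩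

/-- The dynamics of the local search. -/
noncomputable def dynamics : Dynamics β (State β) where
  arrive := arriveStep P
  retry := retryStep P
  Q := P.Q
  N := P.N

end Swaps

section Analysis

variable {α : Type*} [DecidableEq α] {M : Matroid α} {U : Finset α} {f : Finset α → ℝ}
  {v : ℝ} {Q k N : ℕ}

/-- The result of a swap is, up to the threshold, at least as good as that of any other swap. Either
nothing has changed, or the gain exceeds the threshold and the new item lies in the solution. -/
lemma swapped_spec (hf : IsMonotoneSubmodularOn U f) (h0 : 0 ≤ f ∅) (hQk : 0 < Q * k)
    {s : State α} {e : α}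
    (hsU : s.sol ⊆ U) (heU : e ∈ U) (he : e ∉ s.sol)
    (hacc : ∀ x ∈ s.sol, x ∈ s.acc) {P : Params α}
    (hP : P = ⟨f, fun S => M.Indep (S : Set α), v, Q, k, N⟩) :
    (∀ T, IsSwap (fun T => M.Indep (T : Set α)) s.sol e T →
      f T - max v (f s.sol) / (Q * k) ≤ f (swapped P s e)) ∧
    ((swapChoice P s e = some e ∧ swapped P s e = s.sol) ∨
      (swapChoice P s e ≠ some e ∧ swapped P s e ⊆ insert e s.sol ∧
        M.Indep (swapped P s e : Set α) ∧ M.Indep ({e} : Set α) ∧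
        f {e} ≤ f (swapped P s e) ∧
        f s.sol < f (swapped P s e) ∧
        max v (f s.sol) < Q * k * (f (swapped P s e) - f s.sol))) := by
  have hQk' : (0 : ℝ) < Q * k := by exact_mod_cast hQk
  have hfS : 0 ≤ f s.sol := h0.trans (hf.monotone _ _ (Finset.empty_subset _) hsU)
  obtain ⟨h1, h2, h3⟩ := bestOf_spec
    (fun c => (∀ x ∈ c, x ∈ insert e s.sol) ∧ P.indep (eraseOpt c (insert e s.sol)))
    (fun c => P.value (eraseOpt c (insert e s.sol))) (P.value s.sol, some e)
    (none :: s.acc.map some)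
  change _ ≤ (swapBest P s e).1 at h1
  change ∀ x ∈ _, _ → _ ≤ (swapBest P s e).1 at h2
  change swapBest P s e = _ ∨ ∃ x ∈ _, _ ∧ _ ∧ swapBest P s e = _ at h3
  have hval : P.value = f := by rw [hP]
  have hind : P.indep = fun S : Finset α => M.Indep (S : Set α) := by rw [hP]
  rw [hval, hind] at h2 h3
  rw [hval] at h1
  have hbest : ∀ T, IsSwap (fun T => M.Indep (T : Set α)) s.sol e T → f T ≤ (swapBest P s e).1 := by
    rintro T ⟨hTI, rfl | ⟨g, hg, rfl⟩⟩
    · exact h2 none (by simp) ⟨by simp, hTI⟩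
    · exact h2 (some g) (by simp [hacc g hg]) ⟨by simp [hg], hTI⟩
  have hw : Worthwhile P s ((swapBest P s e).1 - P.value s.sol) ↔
      max v (f s.sol) < Q * k * ((swapBest P s e).1 - f s.sol) := by
    rw [max_lt_iff, Worthwhile, hP, mul_assoc]
  by_cases hacc : Worthwhile P s ((swapBest P s e).1 - P.value s.sol)
  · have hc : swapChoice P s e = (swapBest P s e).2 := by rw [swapChoice, if_pos hacc]
    rw [hw] at hacc
    have hpos : f s.sol < (swapBest P s e).1 := by
      have : 0 < Q * k * ((swapBest P s e).1 - f s.sol) :=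
        (hfS.trans (le_max_right _ _)).trans_lt hacc
      exact sub_pos.1 (pos_of_mul_pos_right this hQk'.le)
    rcases h3 with h3 | ⟨c, -, ⟨hcm, hcI⟩, hlt, hceq⟩
    · rw [h3] at hpos; exact absurd hpos (lt_irrefl _)
    · rw [hceq] at hbest hacc hc
      have hsw : swapped P s e = eraseOpt c (insert e s.sol) := by rw [swapped, hc]
      have hne : c ≠ some e := by
        rintro rfl
        simp only [eraseOpt, Option.elim] at hlt
        rw [Finset.erase_insert he] at hlt
        exact lt_irrefl _ hlt
      have hsub : eraseOpt c (insert e s.sol) ⊆ insert e s.sol := by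
        cases c with
        | none => exact subset_rfl
        | some g => exact Finset.erase_subset _ _
      have heS : e ∈ eraseOpt c (insert e s.sol) := by
        cases c with
        | none => exact Finset.mem_insert_self _ _
        | some g =>
          refine Finset.mem_erase.2 ⟨fun h => hne (by rw [h]), Finset.mem_insert_self _ _⟩
      rw [hsw]
      refine ⟨fun T hT => ?_, Or.inr ⟨by rwa [hc], hsub, hcI, ?_, ?_, hlt, hacc⟩⟩
      · have := hbest T hT
        have : 0 ≤ max v (f s.sol) / (Q * k) :=
          div_nonneg (hfS.trans (le_max_right _ _)) hQk'.le
        linarith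
      · exact hcI.subset (by simpa using heS)
      · exact hf.monotone _ _ (by simpa using heS)
          (hsub.trans (Finset.insert_subset heU hsU))
  · have hc : swapChoice P s e = some e := by rw [swapChoice, if_neg hacc]
    have hsw : swapped P s e = s.sol := by
      rw [swapped, hc, eraseOpt, Option.elim, Finset.erase_insert he]
    rw [hw, not_lt, ← le_div_iff₀' hQk'] at hacc
    refine ⟨fun T hT => ?_, Or.inl ⟨hc, hsw⟩⟩
    have := hbest T hT
    rw [hsw]
    linarith

/-- The condition on the sample that keeps the number of accepted items small. The set `T` is
meant to consist of the items of largest value. Whenever an item outside `T` may be accepted, some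
`x ∈ T` satisfies two bounds: the number `W x` bounds the value of the solutions that are available
at that time, and it is at most a constant times the number with which gains are compared. -/
def Calibrated (M : Matroid α) (f : Finset α → ℝ) (V T : Finset α) (W : α → ℝ) (γ v : ℝ) : Prop :=
  ∀ A ⊆ V, ∀ e ∈ V, e ∉ T → M.Indep {e} → ∀ y, v ≤ y → (∀ a ∈ A, f {a} ≤ y) →
    ∃ x ∈ T, (∀ S ⊆ insert e A, M.Indep (S : Set α) → f S ≤ W x) ∧ γ * W x ≤ y

/-- The invariant of the local search. Its last part bounds the number of accepted items by a
potential: an accepted item outside `T` increases one of the truncated quotients substantially. -/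
structure Invariant (M : Matroid α) (f : Finset α → ℝ) (V T : Finset α) (W : α → ℝ) (ρ : ℝ)
    (s : State α) : Prop where
  nodup : s.acc.Nodup
  mem : ∀ a ∈ s.acc, a ∈ V
  sol_acc : ∀ a ∈ s.sol, a ∈ s.acc
  indep : M.Indep (s.sol : Set α)
  value_le : ∀ a ∈ s.acc, f {a} ≤ f s.sol
  length_le : (s.acc.length : ℝ) ≤
    (s.acc.toFinset ∩ T).card + ∑ x ∈ T, min (f s.sol / W x) 1 * ρ

variable {V T : Finset α} {W : α → ℝ} {γ ρ : ℝ}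

lemma Invariant.sol_subset {s : State α} (h : Invariant M f V T W ρ s) : s.sol ⊆ V :=
  fun a ha => h.mem a (h.sol_acc a ha)

lemma Invariant.length_lt {s : State α} (h : Invariant M f V T W ρ s) (hρ : 0 ≤ ρ)
    (hN : (T.card : ℝ) * (1 + ρ) < N) : s.acc.length < N := by
  have h1 : ((s.acc.toFinset ∩ T).card : ℝ) ≤ T.card := by
    exact_mod_cast Finset.card_le_card Finset.inter_subset_right
  have h2 : ∑ x ∈ T, min (f s.sol / W x) 1 * ρ ≤ ∑ _x ∈ T, ρ :=
    Finset.sum_le_sum fun x _ => mul_le_of_le_one_left hρ (min_le_right _ _)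
  rw [Finset.sum_const, nsmul_eq_mul] at h2
  have := h.length_le
  have : (s.acc.length : ℝ) < N := by linarith
  exact_mod_cast this

omit [DecidableEq α] in
lemma sum_potential_mono (hW : ∀ x ∈ T, 0 ≤ W x) (hρ : 0 ≤ ρ) {S S' : Finset α} (h : f S ≤ f S') :
    ∑ x ∈ T, min (f S / W x) 1 * ρ ≤ ∑ x ∈ T, min (f S' / W x) 1 * ρ :=
  Finset.sum_le_sum fun x hx => mul_le_mul_of_nonneg_right
    (min_le_min_right _ (div_le_div_of_nonneg_right h (hW x hx))) hρ

lemma Invariant.initial (h0 : 0 ≤ f ∅) (hW : ∀ x ∈ T, 0 ≤ W x) (hρ : 0 ≤ ρ) :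
    Invariant M f V T W ρ ⟨[], ∅⟩ where
  nodup := List.nodup_nil
  mem := by simp
  sol_acc := by simp
  indep := by simp
  value_le := by simp
  length_le := by
    simp only [List.length_nil, Nat.cast_zero, List.toFinset_nil, Finset.empty_inter,
      Finset.card_empty, zero_add]
    exact Finset.sum_nonneg fun x hx =>
      mul_nonneg (le_min (div_nonneg h0 (hW x hx)) zero_le_one) hρ

variable {P : Params α}

lemma Invariant.retry (hf : IsMonotoneSubmodularOn U f) (h0 : 0 ≤ f ∅) (hQk : 0 < Q * k)
    (hVU : V ⊆ U) (hW : ∀ x ∈ T, 0 ≤ W x) (hρ : 0 ≤ ρ)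
    (hP : P = ⟨f, fun S => M.Indep (S : Set α), v, Q, k, N⟩)
    {s : State α} (h : Invariant M f V T W ρ s) (r : ℕ) :
    Invariant M f V T W ρ (retryStep P s r) ∧ f s.sol ≤ f (retryStep P s r).sol ∧
      (retryStep P s r).acc = s.acc := by
  unfold retryStep
  cases hr : s.acc[r]? with
  | none => exact ⟨h, le_rfl, rfl⟩
  | some e =>
    simp only
    have hea : e ∈ s.acc := List.mem_of_getElem? hr
    split_ifs with hes
    · exact ⟨h, le_rfl, rfl⟩
    · obtain ⟨-, ⟨-, hsw⟩ | ⟨-, hsub, hI, heI, hle, hlt, -⟩⟩ := swapped_spec (v := v) (N := N) hf h0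
        hQk (h.sol_subset.trans hVU) (hVU (h.mem e hea)) hes h.sol_acc hP
      · rw [hsw]; exact ⟨h, le_rfl, rfl⟩
      · refine ⟨⟨h.nodup, h.mem, ?_, hI, fun a ha => (h.value_le a ha).trans hlt.le, ?_⟩,
          hlt.le, rfl⟩
        · intro a ha
          rcases Finset.mem_insert.1 (hsub ha) with rfl | ha
          · exact hea
          · exact h.sol_acc a ha
        · exact h.length_le.trans (add_le_add le_rfl (sum_potential_mono hW hρ hlt.le))

lemma Invariant.arrive (hf : IsMonotoneSubmodularOn U f) (h0 : 0 ≤ f ∅) (hQk : 0 < Q * k)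
    (hVU : V ⊆ U) (hW : ∀ x ∈ T, 0 ≤ W x) (hγ : 0 < γ) (hρ : ρ = Q * k / γ)
    (hcal : Calibrated M f V T W γ v)
    (hP : P = ⟨f, fun S => M.Indep (S : Set α), v, Q, k, N⟩)
    {s : State α} (h : Invariant M f V T W ρ s) {e : α} (he : e ∈ V) :
    Invariant M f V T W ρ (arriveStep P s e) ∧ f s.sol ≤ f (arriveStep P s e).sol ∧
      (∀ a ∈ s.acc, a ∈ (arriveStep P s e).acc) ∧
      (e ∈ (arriveStep P s e).acc ∨ arriveStep P s e = s) := by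
  have hQk' : (0 : ℝ) < Q * k := by exact_mod_cast hQk
  have hρ0 : 0 < ρ := by rw [hρ]; positivity
  unfold arriveStep
  split_ifs with hcap hch
  · exact ⟨h, le_rfl, fun _ ha => ha, Or.inr rfl⟩
  · exact ⟨h, le_rfl, fun _ ha => ha, Or.inr rfl⟩
  rw [not_or] at hcap
  have hea : e ∉ s.acc := hcap.2
  have hes : e ∉ s.sol := fun h' => hea (h.sol_acc e h')
  obtain ⟨-, ⟨hch', -⟩ | ⟨-, hsub, hI, heI, hle, hlt, hgain⟩⟩ := swapped_spec (v := v) (N := N)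
    hf h0 hQk (h.sol_subset.trans hVU) (hVU he) hes h.sol_acc hP
  · exact absurd hch' hch
  have hsub' : ∀ a ∈ swapped P s e, a = e ∨ a ∈ s.acc := fun a ha => by
    rcases Finset.mem_insert.1 (hsub ha) with rfl | ha
    · exact Or.inl rfl
    · exact Or.inr (h.sol_acc a ha)
  refine ⟨⟨?_, ?_, ?_, hI, ?_, ?_⟩, hlt.le, fun a ha => by simp [ha], Or.inl (by simp)⟩
  · simp only
    exact List.nodup_append.2 ⟨h.nodup, by simp, by
      intro a ha b hb
      rw [List.mem_singleton] at hb
      subst hb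
      exact fun hab => hea (hab ▸ ha)⟩
  · intro a ha
    rcases List.mem_append.1 ha with ha | ha
    · exact h.mem a ha
    · rw [List.mem_singleton] at ha; exact ha ▸ he
  · intro a ha
    rcases hsub' a ha with rfl | ha
    · simp
    · simp [ha]
  · intro a ha
    rcases List.mem_append.1 ha with ha | ha
    · exact (h.value_le a ha).trans hlt.le
    · rw [List.mem_singleton] at ha; exact ha ▸ hle
  · have hmono := sum_potential_mono hW hρ0.le hlt.le
    have hlen := h.length_le
    simp only [List.length_append, List.length_singleton, List.toFinset_append, Nat.cast_add,
      Nat.cast_one]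
    by_cases heT : e ∈ T
    · have hcard : ((s.acc.toFinset ∪ [e].toFinset) ∩ T).card = (s.acc.toFinset ∩ T).card + 1 := by
        rw [Finset.union_inter_distrib_right, Finset.card_union_of_disjoint]
        · congr 1
          have : ([e].toFinset ∩ T) = {e} := by
            ext x; simp only [List.mem_toFinset, List.mem_singleton, Finset.mem_inter,
              Finset.mem_singleton]
            exact ⟨fun h => h.1, fun h => ⟨h, h ▸ heT⟩⟩
          rw [this, Finset.card_singleton]
        · rw [Finset.disjoint_left]
          intro x hx hx'
          simp only [List.mem_toFinset, List.mem_singleton, Finset.mem_inter] at hx hx'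
          exact hea (hx'.1 ▸ hx.1)
      rw [hcard]; push_cast
      linarith
    · have hcard : ((s.acc.toFinset ∩ T).card : ℝ) ≤
          ((s.acc.toFinset ∪ [e].toFinset) ∩ T).card := by
        exact_mod_cast Finset.card_le_card (Finset.inter_subset_inter_right
          Finset.subset_union_left)
      obtain ⟨x, hx, hWx, hγx⟩ := hcal s.acc.toFinset (fun a ha => h.mem a (by simpa using ha)) e he
        heT heI (max v (f s.sol)) (le_max_left _ _)
        (fun a ha => (h.value_le a (by simpa using ha)).trans (le_max_right _ _))
      have hfW : f (swapped P s e) ≤ W x := hWx _ (fun a ha => by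
        rcases hsub' a ha with rfl | ha
        · exact Finset.mem_insert_self _ _
        · exact Finset.mem_insert_of_mem (by simpa using ha)) hI
      have hfs : 0 ≤ f s.sol :=
        h0.trans (hf.monotone _ _ (Finset.empty_subset _) (h.sol_subset.trans hVU))
      have hWpos : 0 < W x := (hfs.trans_lt hlt).trans_le hfW
      have hgain' : 1 ≤ (f (swapped P s e) - f s.sol) / W x * ρ := by
        rw [hρ, div_mul_div_comm, le_div_iff₀ (by positivity), one_mul, mul_comm (W x)]
        linarith
      -- The term of `x` is not truncated yet and increases by at least `1`.
      have hstep : ∑ z ∈ T, min (f s.sol / W z) 1 * ρ + 1 ≤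
          ∑ z ∈ T, min (f (swapped P s e) / W z) 1 * ρ := by
        rw [← Finset.add_sum_erase T _ hx, ← Finset.add_sum_erase T _ hx]
        have h1 := sum_potential_mono (f := f) (S := s.sol) (S' := swapped P s e) (T := T.erase x)
          (W := W) (ρ := ρ) (fun z hz => hW z (Finset.mem_of_mem_erase hz)) hρ0.le hlt.le
        rw [min_eq_left ((div_le_one hWpos).2 hfW),
          min_eq_left ((div_le_one hWpos).2 (hlt.le.trans hfW))]
        rw [sub_div, sub_mul] at hgain'
        linarith
      linarith

/-- On a calibrated sample the local search is an improving process. -/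
lemma dynamics_improves (hf : IsMonotoneSubmodularOn U f) (h0 : 0 ≤ f ∅) (hQ : 0 < Q) (hk : 0 < k)
    (hrank : M.eRank = k) (hVU : V ⊆ U) (hW : ∀ x ∈ T, 0 ≤ W x) (hγ : 0 < γ)
    (hρ : ρ = Q * k / γ) (hN : (T.card : ℝ) * (1 + ρ) < N) (hcal : Calibrated M f V T W γ v)
    {B : ℝ} (hvB : v ≤ B) (hfB : ∀ S ⊆ U, M.Indep (S : Set α) → f S ≤ B)
    (hP : P = ⟨f, fun S => M.Indep (S : Set α), v, Q, k, N⟩)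
    {O : Finset α} (hO : O ⊆ V) (hOI : M.Indep (O : Set α)) :
    ∃ (ψ : α → State α → ℝ) (w : α → ℝ), ∑ o ∈ O, w o ≤ B ∧
      (dynamics P).Improves V O (Invariant M f V T W ρ) (fun s => f s.sol)
        (fun s => s.acc.toFinset) ψ w (f O - B / Q) B := by
  have hQk : 0 < Q * k := Nat.mul_pos hQ hk
  have hQk' : (0 : ℝ) < Q * k := by exact_mod_cast hQk
  have hQ' : (0 : ℝ) < Q := by exact_mod_cast hQ
  have hk' : (0 : ℝ) < k := by exact_mod_cast hk
  have hρ0 : 0 ≤ ρ := by rw [hρ]; positivity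
  have hB0 : 0 ≤ B := h0.trans (hfB ∅ (Finset.empty_subset _) (by simp))
  obtain ⟨w, hw, hwsum, -, hψ⟩ := hf.exists_weights h0 (hO.trans hVU) hOI
  choose! ψ hψ1 hψ2 using hψ
  have harr := fun s (h : Invariant M f V T W ρ s) e (he : e ∈ V) =>
    Invariant.arrive (N := N) hf h0 hQk hVU hW hγ hρ hcal hP h he
  have hret := fun s (h : Invariant M f V T W ρ s) r =>
    Invariant.retry (N := N) hf h0 hQk hVU hW hρ0 hP h r
  have hmax : ∀ s, Invariant M f V T W ρ s → max v (f s.sol) / (Q * k) ≤ B / (Q * k) := fun s h =>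
    div_le_div_of_nonneg_right (max_le hvB (hfB _ (h.sol_subset.trans hVU) h.indep)) hQk'.le
  have hgain : ∀ s, Invariant M f V T W ρ s → ∀ o ∈ O, o ∉ s.sol →
      max 0 (ψ s.sol o - B / (Q * k)) ≤ f (swapped P s o) - f s.sol := by
    intro s h o ho hos
    obtain ⟨h1, h2⟩ := swapped_spec (v := v) (N := N) hf h0 hQk (h.sol_subset.trans hVU)
      (hVU (hO ho)) hos h.sol_acc hP
    refine max_le ?_ ?_
    · rcases h2 with ⟨-, h2⟩ | ⟨-, -, -, -, -, h2, -⟩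
      · rw [h2, sub_self]
      · exact sub_nonneg.2 h2.le
    · obtain ⟨-, Z, hZ, hZle⟩ := hψ1 s.sol (h.sol_subset.trans hVU) h.indep o
        (Finset.mem_sdiff.2 ⟨ho, hos⟩)
      have := h1 Z hZ
      have := hmax s h
      linarith
  -- The threshold of a swap lowers each of the at most `k` gains by at most `B / (Q * k)`.
  refine ⟨fun o s => if o ∈ s.sol then 0 else max 0 (ψ s.sol o - B / (Q * k)), w, ?_, ?_⟩
  · rw [hwsum]
    have := hfB O (hO.trans hVU) hOI
    linarith
  · refine
      { Q_pos := by simp only [dynamics, hP]; exact hQ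
        N_pos := ?_
        subset := hO
        inv_arrive := fun s h e he => (harr s h e he).1
        inv_retry := fun s h r => (hret s h r).1
        gain_nonneg := ?_
        gain_le := ?_
        le_sum_gain := ?_
        val_arrive := fun s h e he => (harr s h e he).2.1
        gain_arrive := ?_
        val_retry := fun s h r => (hret s h r).2.1
        gain_retry := ?_
        acc_arrive := ?_
        acc_retry := ?_
        reject := ?_
        val_nonneg := fun s h =>
          h0.trans (hf.monotone _ _ (Finset.empty_subset _) (h.sol_subset.trans hVU))
        val_le := fun s h => hfB _ (h.sol_subset.trans hVU) h.indep }
    · simp only [dynamics, hP]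
      have : (0 : ℝ) < N := lt_of_le_of_lt (by positivity) hN
      exact_mod_cast this
    · intro s _ o _
      split_ifs
      · exact le_rfl
      · exact le_max_left _ _
    · intro s h o ho
      split_ifs with hos
      · exact (hw o ho).1
      · refine max_le (hw o ho).1 ?_
        have := (hψ1 s.sol (h.sol_subset.trans hVU) h.indep o (Finset.mem_sdiff.2 ⟨ho, hos⟩)).1
        have : 0 ≤ B / (Q * k) := by positivity
        linarith
    · intro s h
      have h1 := hψ2 s.sol (h.sol_subset.trans hVU) h.indep
      have hcard : ((O \ s.sol).card : ℝ) ≤ k := by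
        have h2 := hOI.encard_le_eRank
        rw [hrank, Set.encard_coe_eq_coe_finsetCard] at h2
        have h3 := Finset.card_le_card (Finset.sdiff_subset (s := O) (t := s.sol))
        have h4 : O.card ≤ k := by exact_mod_cast h2
        exact_mod_cast h3.trans h4
      have h2 : ∑ o ∈ O \ s.sol, (ψ s.sol o - B / (Q * k)) ≤
          ∑ o ∈ O, if o ∈ s.sol then 0 else max 0 (ψ s.sol o - B / (Q * k)) := by
        rw [← Finset.sum_subset (Finset.sdiff_subset (s := O) (t := s.sol))]
        · refine Finset.sum_le_sum fun o ho => ?_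
          rw [if_neg (Finset.mem_sdiff.1 ho).2]
          exact le_max_right _ _
        · intro o ho hos
          rw [if_pos (by simpa [ho] using hos)]
      rw [Finset.sum_sub_distrib, Finset.sum_const, nsmul_eq_mul] at h2
      have h3 : ((O \ s.sol).card : ℝ) * (B / (Q * k)) ≤ B / Q := by
        calc _ ≤ (k : ℝ) * (B / (Q * k)) := mul_le_mul_of_nonneg_right hcard (by positivity)
          _ = B / Q := by field_simp
      linarith
    · intro s h o ho hoacc
      have hoacc' : o ∉ s.acc := by simpa using hoacc
      have hos : o ∉ s.sol := fun h' => hoacc' (h.sol_acc o h')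
      have hlt : ¬ P.N ≤ s.acc.length := by
        rw [not_le, hP]; exact h.length_lt hρ0 hN
      simp only [if_neg hos]
      refine (hgain s h o ho hos).trans ?_
      simp only [dynamics, arriveStep]
      rw [if_neg (by rw [not_or]; exact ⟨hlt, hoacc'⟩)]
      split_ifs with hch
      · rw [swapped, hch, eraseOpt, Option.elim, Finset.erase_insert hos]
      · exact le_rfl
    · intro s h
      simp only [dynamics]
      have hlt : s.acc.length ≤ P.N := by
        rw [hP]; exact (h.length_lt hρ0 hN).le
      have hterm : ∀ r (hr : r < s.acc.length),
          (if s.acc[r] ∈ O then (if s.acc[r] ∈ s.sol then 0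
            else max 0 (ψ s.sol s.acc[r] - B / (Q * k))) else 0) ≤
          f (retryStep P s r).sol - f s.sol := by
        intro r hr
        split_ifs with h1 h2
        · exact sub_nonneg.2 (hret s h r).2.1
        · refine (hgain s h _ h1 h2).trans (le_of_eq ?_)
          simp [retryStep, List.getElem?_eq_getElem hr, h2]
        · exact sub_nonneg.2 (hret s h r).2.1
      calc _ = ∑ a ∈ s.acc.toFinset, (if a ∈ O then (if a ∈ s.sol then 0
              else max 0 (ψ s.sol a - B / (Q * k))) else 0) := by
            rw [← Finset.sum_filter]
            refine Finset.sum_congr ?_ fun _ _ => rfl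
            ext a; simp [and_comm]
        _ = ∑ r : Fin s.acc.length, (if s.acc[r.val] ∈ O then (if s.acc[r.val] ∈ s.sol then 0
              else max 0 (ψ s.sol s.acc[r.val] - B / (Q * k))) else 0) := by
            rw [List.sum_toFinset _ h.nodup, ← List.sum_ofFn]
            congr 1
            refine List.ext_getElem (by simp) fun i h1 h2 => ?_
            simp
        _ ≤ ∑ r : Fin s.acc.length, (f (retryStep P s r).sol - f s.sol) :=
            Finset.sum_le_sum fun r _ => hterm r r.2
        _ = ∑ r ∈ Finset.range s.acc.length, (f (retryStep P s r).sol - f s.sol) :=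
            Fin.sum_univ_eq_sum_range (fun r => f (retryStep P s r).sol - f s.sol) _
        _ ≤ _ := Finset.sum_le_sum_of_subset_of_nonneg
            (Finset.range_subset_range.2 hlt) fun r _ _ => sub_nonneg.2 (hret s h r).2.1
    · intro s h e he a ha
      exact List.mem_toFinset.2 ((harr s h e he).2.2.1 a (List.mem_toFinset.1 ha))
    · intro s h r
      simp only [dynamics, (hret s h r).2.2]
      exact subset_rfl
    · intro s h e he
      exact (harr s h e he).2.2.2.imp_left List.mem_toFinset.2

end Analysis

/-! ### Sampling without replacement -/

section Sampling

variable {α : Type*} {U : Finset α}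

/-- The positions of the first `s` items. -/
def firstPositions (n s : ℕ) : Finset (Fin n) := Finset.univ.filter fun i => i.val < s

/-- The set of the first `s` items. -/
def sample (σ : Order U) (s : ℕ) : Finset α := items σ (firstPositions U.card s)

lemma sample_subset (σ : Order U) (s : ℕ) : sample σ s ⊆ U := by
  intro a ha
  simp only [sample, items, Finset.mem_map] at ha
  obtain ⟨i, -, rfl⟩ := ha
  exact (σ i).2

lemma card_firstPositions {n s : ℕ} (hs : s ≤ n) : (firstPositions n s).card = s := by
  have : firstPositions n s = Finset.univ.map (Fin.castLEEmb hs) := by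
    ext i
    simp only [firstPositions, Finset.mem_filter, Finset.mem_univ, true_and, Finset.mem_map]
    constructor
    · intro h; exact ⟨⟨i, h⟩, by ext; simp⟩
    · rintro ⟨j, rfl⟩; simp
  rw [this, Finset.card_map, Finset.card_univ, Fintype.card_fin]

lemma sum_sample (σ : Order U) (s : ℕ) (w : α → ℝ) :
    ∑ a ∈ sample σ s, w a = ∑ i ∈ firstPositions U.card s, w (σ i) := by
  simp [sample, items]

lemma sum_order (σ : Order U) (w : α → ℝ) : ∑ i, w (σ i) = ∑ a ∈ U, w a := by
  rw [← Finset.sum_coe_sort U w]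
  exact Equiv.sum_comp σ fun x => w x

variable [DecidableEq α]

lemma sum_order_apply (g : α → ℝ) (i : Fin U.card) :
    U.card * ∑ σ : Order U, g (σ i) = Fintype.card (Order U) * ∑ a ∈ U, g a := by
  have hconst : ∀ j, ∑ σ : Order U, g (σ j) = ∑ σ : Order U, g (σ i) := fun j =>
    Fintype.sum_equiv (Equiv.equivCongr (Equiv.swap i j) (Equiv.refl _)) _ _ fun σ => by
      simp [Equiv.equivCongr]
  have h : ∑ j : Fin U.card, ∑ σ : Order U, g (σ j) = ∑ _j : Fin U.card, ∑ σ : Order U, g (σ i) :=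
    Finset.sum_congr rfl fun j _ => hconst j
  rw [Finset.sum_comm, Finset.sum_congr rfl fun σ _ => sum_order σ g] at h
  simpa using h.symm

lemma sum_order_sample (w : α → ℝ) {s : ℕ} (hs : s ≤ U.card) :
    U.card * ∑ σ : Order U, ∑ a ∈ sample σ s, w a =
      Fintype.card (Order U) * (s * ∑ a ∈ U, w a) := by
  simp_rw [sum_sample]
  rw [Finset.sum_comm, Finset.mul_sum, Finset.sum_congr rfl fun i _ => sum_order_apply w i]
  rw [Finset.sum_const, card_firstPositions hs, nsmul_eq_mul]
  ring

/-- All pairs of different positions are equally distributed. -/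
lemma sum_order_pair (g : α → α → ℝ) {i j i' j' : Fin U.card} (h : i ≠ j) (h' : i' ≠ j') :
    ∑ σ : Order U, g (σ i) (σ j) = ∑ σ : Order U, g (σ i') (σ j') := by
  set p : Equiv.Perm (Fin U.card) := Equiv.swap i' i with hp
  set q : Equiv.Perm (Fin U.card) := Equiv.swap (p j') j with hq
  have hi : q (p i') = i := by
    rw [hp, Equiv.swap_apply_left, hq, Equiv.swap_apply_of_ne_of_ne _ h]
    intro hh
    have : p i' = p j' := by rw [hp, Equiv.swap_apply_left]; exact hh
    exact h' (p.injective this)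
  have hj : q (p j') = j := by rw [hq, Equiv.swap_apply_left]
  refine Fintype.sum_equiv (Equiv.equivCongr (p.trans q).symm (Equiv.refl _)) _ _ fun σ => ?_
  simp [Equiv.equivCongr, hi, hj]

/-- The variance bound for sampling without replacement. -/
lemma sum_sq_sample_sub_le {w : α → ℝ} (hw : ∀ a ∈ U, 0 ≤ w a) {s : ℕ} (hs : s ≤ U.card)
    (hU : 0 < U.card) :
    ∑ σ : Order U, (∑ a ∈ sample σ s, w a - s / U.card * ∑ a ∈ U, w a) ^ 2 ≤
      Fintype.card (Order U) * (s / U.card * ∑ a ∈ U, w a ^ 2) := by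
  set n := U.card with hn
  have hn0 : (0 : ℝ) < n := by exact_mod_cast hU
  set m : ℝ := ((Fintype.card (Order U) : ℕ) : ℝ) with hm
  set W := ∑ a ∈ U, w a with hW
  -- The number `b` is the common value of the mixed moments of two different positions.
  obtain ⟨b, hb0, hb⟩ : ∃ b : ℝ, 0 ≤ b ∧ ∀ i j : Fin n, i ≠ j →
      ∑ σ : Order U, w (σ i) * w (σ j) = b := by
    by_cases hex : ∃ i j : Fin n, i ≠ j
    · obtain ⟨i, j, hij⟩ := hex
      exact ⟨∑ σ : Order U, w (σ i) * w (σ j),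
        Finset.sum_nonneg fun σ _ => mul_nonneg (hw _ (σ i).2) (hw _ (σ j).2),
        fun i' j' h' => sum_order_pair (fun x y => w x * w y) h' hij⟩
    · push Not at hex
      exact ⟨0, le_rfl, fun i j hij => absurd (hex i j) hij⟩
  set a : ℝ := m * (∑ x ∈ U, w x ^ 2) / n with ha
  have haa : ∀ i : Fin n, ∑ σ : Order U, w (σ i) * w (σ i) = a := by
    intro i
    have := sum_order_apply (U := U) (fun x => w x ^ 2) i
    rw [ha, eq_div_iff hn0.ne', ← this, mul_comm]
    simp_rw [pow_two]; rfl
  have hsq : ∀ t ≤ n, ∑ σ : Order U, (∑ i ∈ firstPositions n t, w (σ i)) ^ 2 =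
      t * a + t * (t - 1) * b := by
    intro t ht
    simp_rw [pow_two, Finset.sum_mul_sum]
    rw [Finset.sum_comm]
    have : ∀ i ∈ firstPositions n t, ∑ σ : Order U, ∑ j ∈ firstPositions n t, w (σ i) * w (σ j) =
        a + (t - 1) * b := by
      intro i hi
      rw [Finset.sum_comm, ← Finset.add_sum_erase _ _ hi, haa,
        Finset.sum_congr rfl fun j hj => hb i j (Finset.ne_of_mem_erase hj).symm,
        Finset.sum_const, Finset.card_erase_of_mem hi, card_firstPositions ht, nsmul_eq_mul]
      have : 1 ≤ t := by
        rw [← card_firstPositions ht]; exact Finset.card_pos.2 ⟨i, hi⟩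
      rw [Nat.cast_sub this, Nat.cast_one]
    rw [Finset.sum_congr rfl this, Finset.sum_const, card_firstPositions ht, nsmul_eq_mul]
    ring
  have hall : n * a + n * (n - 1) * b = m * W ^ 2 := by
    rw [← hsq n le_rfl]
    have : firstPositions n n = Finset.univ := by
      ext i; simp [firstPositions]
    rw [this, Finset.sum_congr rfl fun σ _ => by rw [sum_order σ w]]
    simp [hm, hW]
  have hfirst : ∑ σ : Order U, ∑ x ∈ sample σ s, w x = m * (s * W) / n := by
    rw [eq_div_iff hn0.ne', mul_comm]; exact sum_order_sample w hs
  have hsn : (s : ℝ) / n ≤ 1 := by rw [div_le_one hn0]; exact_mod_cast hs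
  have hexp : ∑ σ : Order U, (∑ x ∈ sample σ s, w x - s / n * W) ^ 2 =
      s * (1 - s / n) * (a - b) := by
    have h1 : ∀ σ : Order U, (∑ x ∈ sample σ s, w x - s / n * W) ^ 2 =
        (∑ i ∈ firstPositions n s, w (σ i)) ^ 2 - 2 * (s / n * W) * ∑ x ∈ sample σ s, w x +
          (s / n * W) ^ 2 := by
      intro σ; rw [← sum_sample]; ring
    rw [Finset.sum_congr rfl fun σ _ => h1 σ, Finset.sum_add_distrib, Finset.sum_sub_distrib,
      ← Finset.mul_sum, hsq s hs, hfirst, Finset.sum_const, Finset.card_univ, nsmul_eq_mul, ← hm]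
    have h2 : m * W ^ 2 = n * a + n * (n - 1) * b := hall.symm
    have h3 : s * a + s * (s - 1) * b - 2 * (s / n * W) * (m * (s * W) / n) +
        m * (s / n * W) ^ 2 = s * a + s * (s - 1) * b - s ^ 2 / n ^ 2 * (m * W ^ 2) := by
      field_simp; ring
    rw [h3, h2]
    field_simp; ring
  rw [hexp]
  have hs1 : 0 ≤ (s : ℝ) * (1 - s / n) := mul_nonneg (Nat.cast_nonneg _) (by linarith)
  have ha0 : 0 ≤ a := by
    rw [ha]; exact div_nonneg (mul_nonneg (by rw [hm]; positivity)
      (Finset.sum_nonneg fun _ _ => sq_nonneg _)) hn0.le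
  calc _ ≤ s * (1 - s / n) * a := mul_le_mul_of_nonneg_left (by linarith) hs1
    _ ≤ s * a := by
        refine mul_le_mul_of_nonneg_right (mul_le_of_le_one_right (Nat.cast_nonneg _) ?_) ha0
        have : 0 ≤ (s : ℝ) / n := by positivity
        linarith
    _ = _ := by rw [ha]; ring

/-- By Chebyshev's inequality a sample is unlikely to contain less than half of its share of a
weight that is spread over many items. -/
lemma card_sample_lt_le {w : α → ℝ} (hw : ∀ a ∈ U, 0 ≤ w a) {s : ℕ} (hs : s ≤ U.card)
    (hU : 0 < U.card) {η : ℝ} (hη : 0 ≤ η) (hwη : ∀ a ∈ U, w a ≤ η * ∑ a ∈ U, w a) :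
    ((Finset.univ.filter fun σ : Order U =>
      ∑ a ∈ sample σ s, w a < s / U.card / 2 * ∑ a ∈ U, w a).card : ℝ) * (s / U.card) ≤
      4 * η * Fintype.card (Order U) := by
  have hn0 : (0 : ℝ) < U.card := by exact_mod_cast hU
  set W := ∑ a ∈ U, w a with hW
  set c : ℝ := s / U.card with hc
  have hc0 : 0 ≤ c := by positivity
  have hW0 : 0 ≤ W := Finset.sum_nonneg hw
  set bad := Finset.univ.filter fun σ : Order U => ∑ a ∈ sample σ s, w a < c / 2 * W with hbad
  rcases hc0.eq_or_lt with hc00 | hcpos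
  · rw [← hc00, mul_zero]; positivity
  rcases hW0.eq_or_lt with hW00 | hWpos
  · have : bad = ∅ := by
      rw [hbad, Finset.filter_eq_empty_iff]
      intro σ _
      rw [← hW00, mul_zero, not_lt]
      exact Finset.sum_nonneg fun a ha => hw a (sample_subset σ s ha)
    rw [this]; simp; positivity
  have h1 := sum_sq_sample_sub_le hw hs hU
  rw [← hW, ← hc] at h1
  have h2 : (bad.card : ℝ) * (c / 2 * W) ^ 2 ≤
      ∑ σ : Order U, (∑ a ∈ sample σ s, w a - c * W) ^ 2 := by
    rw [← nsmul_eq_mul, ← Finset.sum_const]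
    refine (Finset.sum_le_sum fun σ hσ => ?_).trans
      (Finset.sum_le_sum_of_subset_of_nonneg (Finset.subset_univ bad) fun _ _ _ => sq_nonneg _)
    rw [hbad, Finset.mem_filter] at hσ
    have h3 : c / 2 * W ≤ c * W - ∑ a ∈ sample σ s, w a := by linarith [hσ.2]
    have h4 : 0 ≤ c / 2 * W := by positivity
    calc (c / 2 * W) ^ 2 ≤ (c * W - ∑ a ∈ sample σ s, w a) ^ 2 := pow_le_pow_left₀ h4 h3 2
      _ = _ := by ring
  have h5 : ∑ a ∈ U, w a ^ 2 ≤ η * W * W := by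
    rw [hW, Finset.mul_sum, ← hW]
    refine Finset.sum_le_sum fun a ha => ?_
    rw [pow_two]
    exact mul_le_mul_of_nonneg_right (hwη a ha) (hw a ha)
  have h6 : (bad.card : ℝ) * c * (c * W ^ 2) ≤ 4 * η * Fintype.card (Order U) * (c * W ^ 2) := by
    have h7 := h2.trans h1
    have h8 : (Fintype.card (Order U) : ℝ) * (c * ∑ a ∈ U, w a ^ 2) ≤
        Fintype.card (Order U) * (c * (η * W * W)) := by gcongr
    nlinarith [h7, h8]
  exact le_of_mul_le_mul_right h6 (by positivity)

lemma exists_top {β : Type*} [DecidableEq β] (S : Finset β) (g : β → ℝ) (L : ℕ) (hL : L ≤ S.card) :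
    ∃ T ⊆ S, T.card = L ∧ ∀ x ∈ T, ∀ e ∈ S, e ∉ T → g e ≤ g x := by
  induction L with
  | zero => exact ⟨∅, by simp, by simp, by simp⟩
  | succ L ih =>
    obtain ⟨T, hTS, hcard, hT⟩ := ih (by omega)
    have hne : (S \ T).Nonempty := by
      rw [← Finset.card_pos, Finset.card_sdiff_of_subset hTS]; omega
    obtain ⟨x, hx, hmax⟩ := Finset.exists_max_image (S \ T) g hne
    rw [Finset.mem_sdiff] at hx
    refine ⟨insert x T, Finset.insert_subset hx.1 hTS,
      by rw [Finset.card_insert_of_notMem hx.2, hcard], ?_⟩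
    intro z hz e heS he
    rw [Finset.mem_insert, not_or] at he
    rcases Finset.mem_insert.1 hz with rfl | hz
    · exact hmax e (Finset.mem_sdiff.2 ⟨heS, he.2⟩)
    · exact hT z hz e heS he.2

variable {M : Matroid α} {f : Finset α → ℝ}

/-- The removal of a sample of `s` out of `n` items costs an independent set `O` on average at most
the fraction `s / n` of its value. -/
lemma sum_sdiff_sample_ge (hf : IsMonotoneSubmodularOn U f) (h0 : 0 ≤ f ∅) {O : Finset α}
    (hO : O ⊆ U) (hOI : M.Indep (O : Set α)) {s : ℕ} (hs : s ≤ U.card) (hU : 0 < U.card) :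
    Fintype.card (Order U) * ((1 - s / U.card) * f O) ≤ ∑ σ : Order U, f (O \ sample σ s) := by
  have hn0 : (0 : ℝ) < U.card := by exact_mod_cast hU
  obtain ⟨w, -, hwsum, hwle, -⟩ := hf.exists_weights h0 hO hOI
  set w' : α → ℝ := fun a => if a ∈ O then w a else 0 with hw'
  have hsumO : ∑ a ∈ U, w' a = f O - f ∅ := by
    rw [← hwsum, hw', ← Finset.sum_filter, Finset.filter_mem_eq_inter,
      Finset.inter_eq_right.2 hO]
  have hle : ∀ σ : Order U, f O - ∑ a ∈ sample σ s, w' a ≤ f (O \ sample σ s) := by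
    intro σ
    have h1 := hwle (O \ sample σ s) Finset.sdiff_subset
    have h2 : ∑ a ∈ sample σ s, w' a = ∑ a ∈ O ∩ sample σ s, w a := by
      rw [hw', ← Finset.sum_filter, Finset.filter_mem_eq_inter, Finset.inter_comm]
    have h3 := Finset.sum_inter_add_sum_sdiff O (sample σ s) w
    rw [h2]
    linarith
  refine le_trans ?_ (Finset.sum_le_sum fun σ _ => hle σ)
  have h4 := sum_order_sample w' hs
  rw [hsumO] at h4
  have h5 : ∑ σ : Order U, ∑ a ∈ sample σ s, w' a =
      Fintype.card (Order U) * (s / U.card * (f O - f ∅)) := by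
    rw [← mul_right_inj' hn0.ne', h4]; field_simp
  rw [Finset.sum_sub_distrib, h5, Finset.sum_const, Finset.card_univ, nsmul_eq_mul, ← mul_sub]
  refine mul_le_mul_of_nonneg_left ?_ (Nat.cast_nonneg _)
  have : 0 ≤ (s : ℝ) / U.card * f ∅ := by positivity
  linarith

/-- Most samples are calibrated. Here `T` consists of the `L` most valuable non-loops, one of which
is likely to be in the sample, and `W x` is the optimum over the items not more valuable than `x`.
Either `x` itself has a good part of this value, or the sample is likely to contain its share of
it. -/
lemma exists_calibrated (hf : IsMonotoneSubmodularOn U f) (h0 : 0 ≤ f ∅) {s L : ℕ}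
    (hs0 : 0 < s) (hs : s ≤ U.card) (hL : 0 < L) {η γ : ℝ} (hη : 0 ≤ η) (hη1 : η ≤ 1)
    (hγη : 3 * γ ≤ η) (hγs : 4 * γ ≤ s / U.card) :
    ∃ (T : Finset α) (W : α → ℝ) (bad : Finset (Order U)), T.card ≤ L ∧ (∀ x ∈ T, 0 ≤ W x) ∧
      (bad.card : ℝ) * (s / U.card) ≤ (4 / L + L * (4 * η)) * Fintype.card (Order U) ∧
      ∀ σ ∉ bad, ∀ v, f ∅ ≤ v → (∀ R ⊆ sample σ s, M.Indep (R : Set α) → f R ≤ 2 * v) →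
        Calibrated M f (U \ sample σ s) T W γ v := by
  classical
  have hU : 0 < U.card := hs0.trans_le hs
  set c : ℝ := s / U.card with hc
  have hcpos : 0 < c := by positivity
  have hc0 : 0 ≤ c := hcpos.le
  set NL := U.filter fun e => M.Indep ({e} : Set α) with hNL
  obtain ⟨T, hTN, hTL, hTtop, hTfull⟩ : ∃ T ⊆ NL, T.card ≤ L ∧
      (∀ x ∈ T, ∀ e ∈ NL, e ∉ T → f {e} ≤ f {x}) ∧ (T.card = L ∨ T = NL) := by
    rcases le_total L NL.card with h | h
    · obtain ⟨T, h1, h2, h3⟩ := exists_top NL (fun e => f {e}) L h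
      exact ⟨T, h1, h2.le, h3, Or.inl h2⟩
    · exact ⟨NL, subset_rfl, h, fun x _ e he hne => absurd he hne, Or.inr rfl⟩
  have hTU : T ⊆ U := hTN.trans (Finset.filter_subset _ _)
  set X : α → Finset α := fun x => U.filter fun e => f {e} ≤ f {x} with hX
  set W : α → ℝ := fun x => bestValue M f (X x) with hWdef
  have hex : ∀ x, ∃ (O : Finset α) (w : α → ℝ), O ⊆ X x ∧ M.Indep (O : Set α) ∧ f O = W x ∧
      (∀ o ∈ O, 0 ≤ w o ∧ w o ≤ f {o}) ∧ ∑ o ∈ O, w o = W x - f ∅ ∧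
      (∀ R ⊆ O, f ∅ + ∑ o ∈ R, w o ≤ f R) ∧ ∀ a, a ∉ O → w a = 0 := by
    intro x
    obtain ⟨O, hO, hOI, hOW⟩ := exists_eq_bestValue M f (X x)
    have hOU : O ⊆ U := hO.trans (Finset.filter_subset _ _)
    obtain ⟨w, h1, h2, h3, -⟩ := hf.exists_weights h0 hOU hOI
    refine ⟨O, fun a => if a ∈ O then w a else 0, hO, hOI, hOW, ?_, ?_, ?_, ?_⟩
    · intro o ho; simpa [ho] using h1 o ho
    · rw [show W x - f ∅ = ∑ o ∈ O, w o by rw [h2, hOW]]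
      exact Finset.sum_congr rfl fun o ho => by simp [ho]
    · intro R hR
      rw [Finset.sum_congr rfl fun o ho => if_pos (hR ho)]
      exact h3 R hR
    · intro a ha; simp [ha]
  choose O w hOX hOI hOW hw hwsum hwle hwz using hex
  have hW0 : ∀ x, f ∅ ≤ W x := fun x => le_bestValue (Finset.empty_subset _) (by simp)
  have hXU : ∀ x, X x ⊆ U := fun x => Finset.filter_subset _ _
  have hsumU : ∀ x, ∑ a ∈ U, w x a = W x - f ∅ := by
    intro x
    rw [← hwsum x]
    exact (Finset.sum_subset ((hOX x).trans (hXU x)) fun a _ ha => hwz x a ha).symm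
  let ind : α → ℝ := fun a => if a ∈ T then 1 else 0
  have hind : ∑ a ∈ U, ind a = T.card := by
    simp only [ind]
    rw [← Finset.sum_filter, Finset.filter_mem_eq_inter, Finset.inter_eq_right.2 hTU]
    simp
  -- The samples that contain less than half of their share of `T` belong to `bad₁`. Those that
  -- contain less than half of their share of the weight of an optimal subset of `X x`, although `x`
  -- has only a small part of its value, belong to `bad₂ x`.
  set bad₁ : Finset (Order U) := Finset.univ.filter fun σ =>
    T.card = L ∧ ∑ a ∈ sample σ s, ind a < c / 2 * ∑ a ∈ U, ind a with hbad₁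
  set bad₂ : α → Finset (Order U) := fun x => Finset.univ.filter fun σ =>
    f {x} < η * (W x - f ∅) ∧ ∑ a ∈ sample σ s, w x a < c / 2 * ∑ a ∈ U, w x a with hbad₂
  have hcard₁ : (bad₁.card : ℝ) * c ≤ 4 / L * Fintype.card (Order U) := by
    by_cases hTL' : T.card = L
    · have h1 := card_sample_lt_le (w := ind) (s := s) (η := 1 / L)
        (fun a _ => by simp only [ind]; split_ifs <;> norm_num) hs hU (by positivity)
        (fun a _ => by
          rw [hind, hTL', one_div_mul_cancel (by positivity)]
          simp only [ind]; split_ifs <;> norm_num)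
      rw [← hc] at h1
      have h2 : bad₁ = Finset.univ.filter fun σ : Order U =>
          ∑ a ∈ sample σ s, ind a < c / 2 * ∑ a ∈ U, ind a := by
        rw [hbad₁]; simp [hTL']
      rw [h2]
      refine h1.trans (le_of_eq ?_)
      ring
    · have : bad₁ = ∅ := by rw [hbad₁]; simp [hTL']
      rw [this, Finset.card_empty, Nat.cast_zero, zero_mul]; positivity
  have hcard₂ : ∀ x, ((bad₂ x).card : ℝ) * c ≤ 4 * η * Fintype.card (Order U) := by
    intro x
    by_cases hx : f {x} < η * (W x - f ∅)
    · have h1 := card_sample_lt_le (w := w x) (s := s) (η := η)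
        (fun a _ => by
          by_cases ha : a ∈ O x
          · exact (hw x a ha).1
          · rw [hwz x a ha]) hs hU hη
        (fun a _ => by
          rw [hsumU]
          by_cases ha : a ∈ O x
          · have h2 : f {a} ≤ f {x} := (Finset.mem_filter.1 (hOX x ha)).2
            exact ((hw x a ha).2.trans h2).trans hx.le
          · rw [hwz x a ha]; exact mul_nonneg hη (sub_nonneg.2 (hW0 x)))
      rw [← hc] at h1
      have h2 : bad₂ x = Finset.univ.filter fun σ : Order U =>
          ∑ a ∈ sample σ s, w x a < c / 2 * ∑ a ∈ U, w x a := by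
        rw [hbad₂]; simp [hx]
      rwa [h2]
    · have : bad₂ x = ∅ := by rw [hbad₂]; simp [hx]
      rw [this, Finset.card_empty, Nat.cast_zero, zero_mul]; positivity
  refine ⟨T, W, bad₁ ∪ T.biUnion bad₂, hTL, fun x _ => h0.trans (hW0 x), ?_, ?_⟩
  · have h1 : ((bad₁ ∪ T.biUnion bad₂).card : ℝ) ≤ bad₁.card + ∑ x ∈ T, ((bad₂ x).card : ℝ) := by
      exact_mod_cast (Finset.card_union_le _ _).trans
        (add_le_add le_rfl Finset.card_biUnion_le)
    have h2 : ∑ x ∈ T, ((bad₂ x).card : ℝ) * c ≤ L * (4 * η * Fintype.card (Order U)) := by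
      refine (Finset.sum_le_sum fun x _ => hcard₂ x).trans ?_
      rw [Finset.sum_const, nsmul_eq_mul]
      exact mul_le_mul_of_nonneg_right (by exact_mod_cast hTL) (by positivity)
    have h3 := mul_le_mul_of_nonneg_right h1 hc0
    rw [add_mul, Finset.sum_mul] at h3
    linarith
  · intro σ hσ v hv hR A hA e he heT heI y hvy hAy
    rw [Finset.mem_union, not_or] at hσ
    have hy0 : 0 ≤ y := h0.trans (hv.trans hvy)
    have heU : e ∈ U := (Finset.mem_sdiff.1 he).1
    have heNL : e ∈ NL := Finset.mem_filter.2 ⟨heU, heI⟩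
    have hTcard : T.card = L := hTfull.resolve_right fun h => heT (h ▸ heNL)
    have hne : (T.filter fun x => x ∈ A ∪ sample σ s).Nonempty := by
      by_contra hcon
      rw [Finset.not_nonempty_iff_eq_empty, Finset.filter_eq_empty_iff] at hcon
      apply hσ.1
      rw [hbad₁, Finset.mem_filter]
      refine ⟨Finset.mem_univ _, hTcard, ?_⟩
      rw [Finset.sum_eq_zero fun a ha => if_neg fun haT =>
        hcon haT (Finset.mem_union_right _ ha), hind, hTcard]
      positivity
    -- The required `x` is the most valuable element of `T` that has been seen.
    obtain ⟨x, hx, hxmax⟩ := Finset.exists_max_image _ (fun x => f {x}) hne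
    rw [Finset.mem_filter] at hx
    have hxI : M.Indep ({x} : Set α) := (Finset.mem_filter.1 (hTN hx.1)).2
    refine ⟨x, hx.1, ?_, ?_⟩
    · intro S hS hSI
      refine le_bestValue (fun z hz => ?_) hSI
      have hzA := hS hz
      have hzU : z ∈ U := by
        rcases Finset.mem_insert.1 hzA with rfl | h
        · exact heU
        · exact (Finset.mem_sdiff.1 (hA h)).1
      refine Finset.mem_filter.2 ⟨hzU, ?_⟩
      by_cases hzT : z ∈ T
      · have hzA' : z ∈ A := (Finset.mem_insert.1 hzA).resolve_left fun h => heT (h ▸ hzT)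
        exact hxmax z (Finset.mem_filter.2 ⟨hzT, Finset.mem_union_left _ hzA'⟩)
      · exact hTtop x hx.1 z (Finset.mem_filter.2 ⟨hzU, hSI.subset (by simpa using hz)⟩) hzT
    · have hx2 : f {x} ≤ 2 * y := by
        rcases Finset.mem_union.1 hx.2 with h | h
        · have := hAy x h; linarith
        · have := hR {x} (by simpa using h) (by simpa using hxI); linarith
      have hWf := hW0 x
      have hf0y : f ∅ ≤ y := hv.trans hvy
      by_cases hfx : f {x} < η * (W x - f ∅)
      · have h1 : c / 2 * (W x - f ∅) ≤ ∑ a ∈ sample σ s, w x a := by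
          rw [← hsumU x, ← not_lt]
          intro hlt
          exact hσ.2 (Finset.mem_biUnion.2 ⟨x, hx.1, Finset.mem_filter.2
            ⟨Finset.mem_univ _, hfx, hlt⟩⟩)
        have h2 : ∑ a ∈ sample σ s, w x a = ∑ a ∈ O x ∩ sample σ s, w x a :=
          (Finset.sum_subset Finset.inter_subset_right fun a ha hna =>
            hwz x a fun haO => hna (Finset.mem_inter.2 ⟨haO, ha⟩)).symm
        have h3 := hwle x (O x ∩ sample σ s) Finset.inter_subset_left
        have h4 := hR (O x ∩ sample σ s) Finset.inter_subset_right
          ((hOI x).subset (by simp))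
        have hc1 : c ≤ 1 := by
          rw [hc, div_le_one (by exact_mod_cast hU)]; exact_mod_cast hs
        have h5 : c / 2 * f ∅ ≤ f ∅ := by nlinarith
        have h6 : γ * W x ≤ c / 4 * W x :=
          mul_le_mul_of_nonneg_right (by linarith) (h0.trans hWf)
        linarith
      · rw [not_lt] at hfx
        have h1 : γ * W x ≤ η / 3 * W x :=
          mul_le_mul_of_nonneg_right (by linarith) (h0.trans hWf)
        have h2 : η * f ∅ ≤ f ∅ := mul_le_of_le_one_left h0 hη1
        linarith

end Sampling

/-! ### The program -/

section Code

/-- The word variable stored in entry `0` of word array `a`. -/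
def wvar (a : ℕ) : WordExp := .read a (.lit 0)

/-- The real variable stored in entry `0` of real array `a`. -/
def rvar (a : ℕ) : RealExp := .read a (.lit 0)

/-- The number of items. -/
def itemCount : WordExp := .read 0 (.lit 0)

/-- The rank. -/
def rankWord : WordExp := .read 0 (.lit 1)

/-- The product with a constant. -/
def WordExp.times (x : WordExp) : ℕ → WordExp
  | 0 => .lit 0
  | m + 1 => .add (x.times m) x

/-- The product with a constant. -/
def RealExp.times (x : RealExp) : ℕ → RealExp
  | 0 => .sub x x
  | m + 1 => .add (x.times m) x

/-- The value of the set in entry `0` of set array `a`. -/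
def valueOf (a : ℕ) : RealExp := .value a (.lit 0)

/-- Increment the word variable of word array `a`. -/
def increment (a : ℕ) : Program := .setWord a (.lit 0) (.add (wvar a) (.lit 1))

/-- Make the set in entry `0` of set array `a` the best one found so far, with `x` as the choice
that leads to it, if it is independent and its value exceeds the real variable `0`. -/
def considerProgram (a : ℕ) (x : WordExp) : Program :=
  .ite (.and (.indep a (.lit 0)) (.realLt (rvar 0) (valueOf a)))
    (.seq (.setReal 0 (.lit 0) (valueOf a)) (.setWord 5 (.lit 0) x)) .skip

/-- The greedy algorithm on the items that have arrived, with its solution in entry `0` of set array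
`a`. The word variables are `1` (number of arrived items), `5` (choice), `6` and `8` (counters). -/
def greedyProgram (a : ℕ) : Program :=
  .seq (.setWord 8 (.lit 0) (.lit 0)) <|
  .while (.wordLt (wvar 8) rankWord) <|
    .seq (.setReal 0 (.lit 0) (valueOf a)) <|
    .seq (.setWord 5 (.lit 0) itemCount) <|
    .seq (.setWord 6 (.lit 0) (.lit 0)) <|
    .seq (.while (.wordLt (wvar 6) (wvar 1)) <|
      .seq (.ite (.mem (wvar 6) a (.lit 0)) .skip <|
        .seq (.insert a (.lit 0) (wvar 6)) <|
        .seq (considerProgram a (wvar 6)) <|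
        .erase a (.lit 0) (wvar 6)) <|
      increment 6) <|
    .seq (.insert a (.lit 0) (wvar 5)) <|
    increment 8

/-- Find the element to be erased from the solution, after the item in the word variable `4` has
been inserted; if the best swap is not worthwhile, then it is this item. The word variables `2` and
`5` and the word array `3` hold the number of accepted items, the choice, and the accepted items.
The real variables `0` to `3` hold the best value, the value of the solution before the insertion,
the level, and the scaled gain. -/
def chooseProgram (Q : ℕ) : Program :=
  .seq (considerProgram 0 itemCount) <|
  .seq (.setWord 6 (.lit 0) (.lit 0)) <|
  .seq (.while (.wordLt (wvar 6) (wvar 2)) <|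
    .seq (.ite (.mem (.read 3 (wvar 6)) 0 (.lit 0))
      (.seq (.erase 0 (.lit 0) (.read 3 (wvar 6))) <|
        .seq (considerProgram 0 (.read 3 (wvar 6))) <|
        .insert 0 (.lit 0) (.read 3 (wvar 6)))
      .skip) <|
    increment 6) <|
  .seq (.setReal 3 (.lit 0) (.sub (rvar 0) (rvar 0))) <|
  .seq (.setWord 6 (.lit 0) (.lit 0)) <|
  .seq (.while (.wordLt (wvar 6) rankWord) <|
    .seq (.setReal 3 (.lit 0) (.add (rvar 3) (.sub (rvar 0) (rvar 1)))) <|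
    increment 6) <|
  .ite (.and (.realLt (rvar 2) ((rvar 3).times Q)) (.realLt (rvar 1) ((rvar 3).times Q)))
    .skip (.setWord 5 (.lit 0) (wvar 4))

/-- Try to swap the item in the word variable `4` into the solution. -/
def swapProgram (Q : ℕ) : Program :=
  .seq (.setReal 1 (.lit 0) (valueOf 0)) <|
  .seq (.setReal 0 (.lit 0) (valueOf 0)) <|
  .seq (.setWord 5 (.lit 0) (wvar 4)) <|
  .seq (.insert 0 (.lit 0) (wvar 4)) <|
  .seq (chooseProgram Q) <|
  .erase 0 (.lit 0) (wvar 5)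

/-- Try the accepted item with a random index below `N₀ * k` again. -/
def retryProgram (Q N₀ : ℕ) : Program :=
  .seq (.random 7 (.lit 0) (.sub (rankWord.times N₀) (.lit 1))) <|
  .ite (.wordLt (wvar 7) (wvar 2))
    (.seq (.setWord 4 (.lit 0) (.read 3 (wvar 7))) <|
      .ite (.mem (wvar 4) 0 (.lit 0)) .skip (swapProgram Q))
    .skip

/-- Try the item that has just arrived, unless `N₀ * k` items have been accepted. -/
def arriveProgram (Q N₀ : ℕ) : Program :=
  .ite (.wordLt (wvar 2) (rankWord.times N₀))
    (.seq (.setWord 4 (.lit 0) (.sub (wvar 1) (.lit 1))) <|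
      .seq (swapProgram Q) <|
      .ite (.and (.not (.wordLt (wvar 4) (wvar 5))) (.not (.wordLt (wvar 5) (wvar 4)))) .skip <|
      .seq (.setWord 3 (wvar 2) (wvar 4)) <|
      .seq (increment 2) .select)
    .skip

/-- The local search on the items that have not yet arrived. -/
def searchProgram (Q N₀ : ℕ) : Program :=
  .while (.wordLt (wvar 1) itemCount) <|
    .seq .next <|
    .seq (increment 1) <|
    .seq (.random 7 (.lit 0) (.lit (Q - 1))) <|
    .ite (.wordLt (wvar 7) (.lit 1)) (retryProgram Q N₀) (arriveProgram Q N₀)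

/-- Short instances: put all items on the shortlist and run the greedy algorithm. -/
def shortProgram : Program :=
  .seq (.while (.wordLt (wvar 1) itemCount) <| .seq .next <| .seq (increment 1) .select) <|
  greedyProgram 0

/-- Long instances: run the greedy algorithm on a sample of a fraction `1 / Q` of the items to find
the level of the local search on the other items. -/
def longProgram (Q N₀ : ℕ) : Program :=
  .seq (.while (.wordLt ((wvar 1).times Q) itemCount) <| .seq .next (increment 1)) <|
  .seq (greedyProgram 1) <|
  .seq (.setReal 2 (.lit 0) (valueOf 1)) <|
  searchProgram Q N₀

/-- The whole algorithm. -/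
def mainProgram (Q N₀ K : ℕ) : Program :=
  .ite (.wordLt (rankWord.times K) itemCount) (longProgram Q N₀) shortProgram

end Code

/-! ### Correctness of the program -/

section Verification

variable {n : ℕ} {O : Oracle n} {p q : Program} {s : Store n} {T : ℕ} {R : Store n → Prop}

/-- The rule for a sequence that starts with a single instruction. -/
lemma Runs.cons {s₁ : Store n} (hp : Runs O p s 1 (s₁ = ·)) (hq : Runs O q s₁ T R) :
    Runs O (.seq p q) s (T + 2) R :=
  (Runs.seq hp fun s' hs' => hs' ▸ hq).mono (by omega) fun _ h => h

@[simp] lemma eval_times (x : WordExp) (m : ℕ) : (x.times m).eval s = m * x.eval s := by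
  induction m with
  | zero => simp [WordExp.times, WordExp.eval]
  | succ m ih => simp only [WordExp.times, WordExp.eval, ih]; ring

@[simp] lemma eval_times_real (x : RealExp) (m : ℕ) :
    (x.times m).eval O s = m * x.eval O s := by
  induction m with
  | zero => simp [RealExp.times, RealExp.eval]
  | succ m ih => simp only [RealExp.times, RealExp.eval, ih]; push_cast; ring

/-- The stores `s` and `s'` agree except in the word arrays in `W`, the real arrays in `R` and the
set arrays in `A`. -/
def SameExcept (W R A : List ℕ) (s s' : Store n) : Prop :=
  (∀ b, b ∉ W → s'.word b = s.word b) ∧ (∀ b, b ∉ R → s'.real b = s.real b) ∧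
    (∀ b, b ∉ A → s'.set b = s.set b) ∧ s'.arrived = s.arrived ∧ s'.shortlist = s.shortlist

lemma SameExcept.refl (W R A : List ℕ) (s : Store n) : SameExcept W R A s s := by
  simp [SameExcept]

lemma SameExcept.trans {W R A W' R' A' : List ℕ} {s s' s'' : Store n} (h : SameExcept W R A s s')
    (h' : SameExcept W' R' A' s' s'') : SameExcept (W ++ W') (R ++ R') (A ++ A') s s'' := by
  obtain ⟨h1, h2, h3, h4, h5⟩ := h
  obtain ⟨h1', h2', h3', h4', h5'⟩ := h'
  refine ⟨fun b hb => ?_, fun b hb => ?_, fun b hb => ?_, h4'.trans h4, h5'.trans h5⟩ <;>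
  rw [List.mem_append, not_or] at hb
  · rw [h1' b hb.2, h1 b hb.1]
  · rw [h2' b hb.2, h2 b hb.1]
  · rw [h3' b hb.2, h3 b hb.1]

lemma SameExcept.mono {W R A W' R' A' : List ℕ} {s s' : Store n} (h : SameExcept W R A s s')
    (hW : W ⊆ W') (hR : R ⊆ R') (hA : A ⊆ A') : SameExcept W' R' A' s s' :=
  ⟨fun b hb => h.1 b fun h => hb (hW h), fun b hb => h.2.1 b fun h => hb (hR h),
    fun b hb => h.2.2.1 b fun h => hb (hA h), h.2.2.2⟩

lemma write_of_ne {β : Type*} (g : ℕ → ℕ → β) {a b : ℕ} (i : ℕ) (v : β) (h : b ≠ a) :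
    write g a i v b = g b := Function.update_of_ne h _ _

/-- Optional items are represented by words, with the number of items for `none`. -/
def code (c : Option (Fin n)) : ℕ := c.elim n Fin.val

lemma code_injective : Function.Injective (code : Option (Fin n) → ℕ) := by
  intro c d h
  cases c with
  | none => cases d with
    | none => rfl
    | some y => exact absurd h (by simp [code]; exact y.2.ne')
  | some x => cases d with
    | none => exact absurd h (by simp [code]; exact x.2.ne)
    | some y => simp only [code, Option.elim] at h; rw [Fin.ext h]

lemma mem_item {s : Store n} {x : ℕ} {j : Fin n} :
    j ∈ s.item x ↔ j.val = x ∧ j.val < s.arrived := by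
  simp [Store.item]

lemma item_code (s : Store n) (c : Option (Fin n)) (hc : ∀ x ∈ c, x.val < s.arrived) :
    s.item (code c) = c.elim ∅ fun x => {x} := by
  cases c with
  | none =>
    ext j
    rw [mem_item]
    simpa [code] using fun h => absurd h j.2.ne
  | some x =>
    ext j
    have := hc x rfl
    rw [mem_item]
    simp only [code, Option.elim, Finset.mem_singleton]
    constructor
    · rintro ⟨h, -⟩; exact Fin.ext h
    · rintro rfl; exact ⟨rfl, this⟩

lemma item_val (s : Store n) (x : Fin n) (hx : x.val < s.arrived) : s.item x.val = {x} :=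
  item_code s (some x) (by simpa using hx)

lemma union_item_code (s : Store n) (c : Option (Fin n)) (hc : ∀ x ∈ c, x.val < s.arrived)
    (S : Finset (Fin n)) : S ∪ s.item (code c) = insertOpt c S := by
  rw [item_code s c hc]
  cases c with
  | none => simp [insertOpt]
  | some x => exact Finset.union_comm _ _

lemma sdiff_item_code (s : Store n) (c : Option (Fin n)) (hc : ∀ x ∈ c, x.val < s.arrived)
    (S : Finset (Fin n)) : S \ s.item (code c) = eraseOpt c S := by
  rw [item_code s c hc]
  cases c with
  | none => simp [eraseOpt]
  | some x => simp [eraseOpt, Finset.sdiff_singleton_eq_erase]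

/-- The membership test is correct for items that have arrived. -/
lemma holds_mem {x i : WordExp} {a : ℕ} {y : Fin n} (hx : x.eval s = y.val)
    (hy : y.val < s.arrived) : (Test.mem x a i).Holds O s ↔ y ∈ s.set a (i.eval s) := by
  rw [Test.Holds, hx, item_val s y hy, Finset.singleton_inter]
  split_ifs with h <;> simp [h]

/-- The value of a word expression depends on the words only. -/
lemma WordExp.eval_congr {s s' : Store n} (h : s'.word = s.word) (x : WordExp) :
    x.eval s' = x.eval s := by
  induction x with
  | lit c => rfl
  | read a i ih => simp only [WordExp.eval, ih, h]
  | add x y hx hy => simp only [WordExp.eval, hx, hy]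
  | sub x y hx hy => simp only [WordExp.eval, hx, hy]

open Classical in
lemma runs_considerProgram (a : ℕ) (x : WordExp) : Runs O (considerProgram a x) s 4 fun s' =>
    SameExcept [5] [0] [] s s' ∧ (s'.real 0 0, s'.word 5 0) =
      if O.indep (s.set a 0) ∧ s.real 0 0 < O.value (s.set a 0) then
        (O.value (s.set a 0), x.eval s) else (s.real 0 0, s.word 5 0) := by
  refine Runs.ite (T := 3) (fun h => ?_) fun h => (Runs.skip ?_).mono (by norm_num) fun _ h => h
  · simp only [Test.Holds, valueOf, rvar, RealExp.eval, WordExp.eval] at h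
    rw [if_pos h]
    refine Runs.cons (Runs.setReal rfl) (Runs.setWord ?_)
    refine ⟨⟨fun b hb => ?_, fun b hb => ?_, fun _ _ => rfl, rfl, rfl⟩, ?_⟩
    · exact write_of_ne _ _ _ (by simpa using hb)
    · exact write_of_ne _ _ _ (by simpa using hb)
    · simp [write_apply, WordExp.eval, RealExp.eval, valueOf]
      exact WordExp.eval_congr (s := s)
        (s' := ⟨s.word, write s.real 0 0 (O.value (s.set a 0)), s.set, s.arrived, s.shortlist⟩)
        rfl x
  · simp only [Test.Holds, valueOf, rvar, RealExp.eval, WordExp.eval] at h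
    rw [if_neg h]
    exact ⟨SameExcept.refl _ _ _ _, rfl⟩

lemma sameExcept_word (s : Store n) (a i v : ℕ) :
    SameExcept [a] [] [] s { s with word := write s.word a i v } :=
  ⟨fun _ hb => write_of_ne _ _ _ (by simpa using hb), fun _ _ => rfl, fun _ _ => rfl, rfl, rfl⟩

lemma sameExcept_real (s : Store n) (a i : ℕ) (v : ℝ) :
    SameExcept [] [a] [] s { s with real := write s.real a i v } :=
  ⟨fun _ _ => rfl, fun _ hb => write_of_ne _ _ _ (by simpa using hb), fun _ _ => rfl, rfl, rfl⟩

lemma sameExcept_set (s : Store n) (a i : ℕ) (v : Finset (Fin n)) :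
    SameExcept [] [] [a] s { s with set := write s.set a i v } :=
  ⟨fun _ _ => rfl, fun _ _ => rfl, fun _ hb => write_of_ne _ _ _ (by simpa using hb), rfl, rfl⟩

lemma SameExcept.word {W R A : List ℕ} {s s' : Store n} (h : SameExcept W R A s s') {b : ℕ}
    (hb : b ∉ W) : s'.word b = s.word b := h.1 b hb

lemma SameExcept.real {W R A : List ℕ} {s s' : Store n} (h : SameExcept W R A s s') {b : ℕ}
    (hb : b ∉ R) : s'.real b = s.real b := h.2.1 b hb

lemma SameExcept.set {W R A : List ℕ} {s s' : Store n} (h : SameExcept W R A s s') {b : ℕ}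
    (hb : b ∉ A) : s'.set b = s.set b := h.2.2.1 b hb

lemma SameExcept.arrived {W R A : List ℕ} {s s' : Store n} (h : SameExcept W R A s s') :
    s'.arrived = s.arrived := h.2.2.2.1

lemma SameExcept.shortlist {W R A : List ℕ} {s s' : Store n} (h : SameExcept W R A s s') :
    s'.shortlist = s.shortlist := h.2.2.2.2

open Classical in
/-- One item of the scan in a round of the greedy algorithm. -/
lemma runs_greedyTest (a : ℕ) {x : Fin n} (hx : s.word 6 0 = x.val) (hxa : x.val < s.arrived) :
    Runs O (.ite (.mem (wvar 6) a (.lit 0)) .skip <|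
        .seq (.insert a (.lit 0) (wvar 6)) <|
        .seq (considerProgram a (wvar 6)) <|
        .erase a (.lit 0) (wvar 6)) s 9 fun s' =>
      SameExcept [5] [0] [a] s s' ∧ s'.set a 0 = s.set a 0 ∧ (s'.real 0 0, s'.word 5 0) =
        if (x ∉ s.set a 0 ∧ O.indep (insert x (s.set a 0))) ∧
          s.real 0 0 < O.value (insert x (s.set a 0)) then
          (O.value (insert x (s.set a 0)), x.val) else (s.real 0 0, s.word 5 0) := by
  have hmem : (Test.mem (wvar 6) a (.lit 0)).Holds O s ↔ x ∈ s.set a 0 := holds_mem hx hxa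
  refine Runs.ite (T := 8) (fun h => ?_) fun h => ?_
  · rw [hmem] at h
    refine (Runs.skip ?_).mono (by norm_num) fun _ h => h
    exact ⟨SameExcept.refl _ _ _ _, rfl, by simp [h]⟩
  · rw [hmem] at h
    have hins : s.set a 0 ∪ s.item (s.word 6 0) = insert x (s.set a 0) := by
      rw [hx]; exact union_item_code s (some x) (by simpa using hxa) _
    refine (Runs.cons (T := 6) (Runs.insert rfl) ?_)
    simp only [WordExp.eval, wvar, hins]
    refine (Runs.seq (T₂ := 1) (runs_considerProgram a _) fun s' hs' => Runs.erase ?_).mono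
      (by norm_num) fun _ h => h
    obtain ⟨h1, h2⟩ := hs'
    have e1 : s'.word 6 0 = x.val := by rw [h1.word (by simp)]; exact hx
    have e2 : s'.set a 0 = insert x (s.set a 0) := by rw [h1.set (by simp)]; simp [write_apply]
    have e3 : x.val < s'.arrived := by rw [h1.arrived]; exact hxa
    refine ⟨((sameExcept_set _ _ _ _).trans (h1.trans (sameExcept_set _ _ _ _))).mono
      (by simp) (by simp) (by simp), ?_, ?_⟩
    · simp only [WordExp.eval, write_apply, and_self, if_true, e1, e2]
      rw [item_val s' x e3, Finset.sdiff_singleton_eq_erase, Finset.erase_insert h]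
    · rw [h2]
      simp [write_apply, h, WordExp.eval, hx]

lemma take_finRange_succ {i : ℕ} (hi : i < n) :
    (List.finRange n).take (i + 1) = (List.finRange n).take i ++ [⟨i, hi⟩] := by
  rw [List.take_succ_eq_append_getElem (by simpa using hi)]
  simp

/-- The scan of the arrived items in a round of the greedy algorithm. -/
lemma runs_greedyScan (a : ℕ) {c : ℕ} (hc : c ≤ n) (h1 : s.word 1 0 = c) (harr : s.arrived = c)
    (h6 : s.word 6 0 = 0) (h5 : s.word 5 0 = n) (h0 : s.real 0 0 = O.value (s.set a 0)) :
    Runs O (.while (.wordLt (wvar 6) (wvar 1)) <|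
      .seq (.ite (.mem (wvar 6) a (.lit 0)) .skip <|
        .seq (.insert a (.lit 0) (wvar 6)) <|
        .seq (considerProgram a (wvar 6)) <|
        .erase a (.lit 0) (wvar 6)) <|
      increment 6) s (c * 12 + 1) fun s' => SameExcept [5, 6] [0] [a] s s' ∧
        s'.set a 0 = s.set a 0 ∧ s'.word 5 0 =
          code (greedyChoice O.value O.indep ((List.finRange n).take c) (s.set a 0)).2 := by
  classical
  set b : ℕ → ℝ × Option (Fin n) := fun i =>
    greedyChoice O.value O.indep ((List.finRange n).take i) (s.set a 0) with hb
  have hsucc : ∀ i (hi : i < n), b (i + 1) =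
      if (⟨i, hi⟩ ∉ s.set a 0 ∧ O.indep (insert ⟨i, hi⟩ (s.set a 0))) ∧
        (b i).1 < O.value (insert ⟨i, hi⟩ (s.set a 0)) then
        (O.value (insert ⟨i, hi⟩ (s.set a 0)), some ⟨i, hi⟩) else b i := by
    intro i hi
    simp only [hb, greedyChoice]
    rw [take_finRange_succ hi, List.map_append, List.map_singleton, bestOf_append_singleton]
    simp [insertOpt]
  refine (Runs.while (I := fun i s' => SameExcept [5, 6] [0] [a] s s' ∧
      s'.set a 0 = s.set a 0 ∧ s'.word 6 0 = i ∧
      (s'.real 0 0, s'.word 5 0) = ((b i).1, code (b i).2))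
      (m := c) (T := 11) ?_ ?_ ?_).mono le_rfl ?_
  · refine ⟨SameExcept.refl _ _ _ _, rfl, h6, ?_⟩
    simp [hb, greedyChoice, bestOf, code, h0, h5]
  · rintro i s' hi ⟨hs1, hs2, hs3, hs4⟩
    have hin : i < n := hi.trans_le hc
    refine ⟨?_, ?_⟩
    · simp only [Test.Holds, WordExp.eval, wvar]
      rw [hs3, hs1.word (by simp), h1]; exact hi
    · refine Runs.seq (runs_greedyTest a (x := ⟨i, hin⟩) hs3 (by rw [hs1.arrived, harr]; exact hi))
        (T₂ := 1) fun s'' hs'' => Runs.setWord ?_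
      obtain ⟨ht1, ht2, ht3⟩ := hs''
      refine ⟨(hs1.trans (ht1.trans (sameExcept_word _ _ _ _))).mono
        (by simp) (by simp) (by simp), ht2.trans hs2, ?_, ?_⟩
      · simp only [WordExp.eval, wvar, write_apply, and_self, if_true]
        rw [ht1.word (by simp), hs3]
      · rw [Prod.mk.injEq] at hs4
        simp only [WordExp.eval, wvar, write_apply]
        rw [if_neg (by simp), ht3, hsucc i hin, hs2, hs4.1, hs4.2]
        split_ifs <;> rfl
  · rintro s' ⟨hs1, hs2, hs3, hs4⟩
    simp only [Test.Holds, WordExp.eval, wvar]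
    rw [hs3, hs1.word (by simp), h1]; exact lt_irrefl _
  · rintro s' ⟨hs1, hs2, hs3, hs4⟩
    exact ⟨hs1, hs2, (Prod.mk.inj hs4).2⟩

lemma greedyChoice_mem {F : Finset (Fin n) → ℝ} {I : Finset (Fin n) → Prop} {l : List (Fin n)}
    {G : Finset (Fin n)} {x : Fin n} (hx : x ∈ (greedyChoice F I l G).2) : x ∈ l := by
  rcases (bestOf_spec (fun c => (∀ x ∈ c, x ∉ G) ∧ I (insertOpt c G)) (fun c => F (insertOpt c G))
    (F G, none) (l.map some)).2.2 with h | ⟨y, hy, -, -, h⟩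
  · rw [greedyChoice, h] at hx; simp at hx
  · rw [greedyChoice, h] at hx
    obtain ⟨z, hz, rfl⟩ := List.mem_map.1 hy
    rw [← Option.mem_some.1 hx]; exact hz

lemma lt_of_mem_take_finRange {c : ℕ} {x : Fin n} (hx : x ∈ (List.finRange n).take c) :
    x.val < c := by
  obtain ⟨i, hi, rfl⟩ := List.mem_take_iff_getElem.1 hx
  simp only [List.getElem_finRange, Fin.val_cast]
  exact (lt_min_iff.1 hi).1

/-- The greedy algorithm takes `O(ck)` steps on `c` items. -/
lemma runs_greedyProgram (a : ℕ) {c k : ℕ} (hc : c ≤ n) (hn : s.word 0 0 = n)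
    (hk : s.word 0 1 = k) (h1 : s.word 1 0 = c) (harr : s.arrived = c) (hs : s.set a 0 = ∅) :
    Runs O (greedyProgram a) s (k * (c * 12 + 12) + 3) fun s' =>
      SameExcept [5, 6, 8] [0] [a] s s' ∧
        s'.set a 0 = greedy O.value O.indep ((List.finRange n).take c) k := by
  refine (Runs.cons (Runs.setWord rfl) (Runs.while
      (I := fun t s' => SameExcept [5, 6, 8] [0] [a] s s' ∧ s'.word 8 0 = t ∧
      s'.set a 0 = (greedyRound O.value O.indep ((List.finRange n).take c))^[t] ∅)
      (m := k) (T := c * 12 + 11) ?_ ?_ ?_)).mono (le_of_eq (by ring)) ?_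
  · exact ⟨(sameExcept_word _ _ _ _).mono (by simp) (by simp) (by simp),
      by simp [WordExp.eval, write_apply], by simpa using hs⟩
  · rintro t s' ht ⟨hs1, hs2, hs3⟩
    have hn' : s'.word 0 0 = n := by rw [hs1.word (by simp), hn]
    refine ⟨?_, ?_⟩
    · simp only [Test.Holds, WordExp.eval, wvar, rankWord]
      rw [hs2, hs1.word (by simp), hk]; exact ht
    · refine (Runs.cons (T := c * 12 + 9) (Runs.setReal rfl) (Runs.cons (T := c * 12 + 7)
        (Runs.setWord rfl) (Runs.cons (T := c * 12 + 5) (Runs.setWord rfl) ?_)))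
      refine (Runs.seq (T₂ := 3) (runs_greedyScan a hc ?_ ?_ ?_ ?_ ?_) ?_).mono (by omega)
        fun _ h => h
      · simp only [write_apply]; rw [if_neg (by simp), if_neg (by simp), hs1.word (by simp), h1]
      · exact hs1.arrived.trans harr
      · simp [write_apply, WordExp.eval]
      · simp [write_apply, WordExp.eval, itemCount, hn']
      · simp [write_apply, WordExp.eval, RealExp.eval, valueOf]
      rintro s'' ⟨ht1, ht2, ht3⟩
      have hfr : SameExcept [5, 6, 8] [0] [a] s s'' :=
        (hs1.trans ((sameExcept_real _ _ _ _).trans ((sameExcept_word _ _ _ _).trans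
          ((sameExcept_word _ _ _ _).trans ht1)))).mono (by simp) (by simp) (by simp)
      have h8 : s''.word 8 0 = t := by
        rw [ht1.word (by simp)]; simp [write_apply, hs2]
      refine Runs.cons (T := 1) (Runs.insert rfl) (Runs.setWord ⟨?_, ?_, ?_⟩)
      · exact (hfr.trans ((sameExcept_set _ _ _ _).trans (sameExcept_word _ _ _ _))).mono
          (by simp) (by simp) (by simp)
      · simp [write_apply, WordExp.eval, wvar, h8]
      · simp only [write_apply, WordExp.eval, wvar, and_self, if_true]
        rw [ht2, ht3, union_item_code, Function.iterate_succ_apply', ← hs3]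
        · rfl
        · intro x hx
          rw [hfr.arrived, harr]
          exact lt_of_mem_take_finRange (greedyChoice_mem hx)
  · rintro s' ⟨hs1, hs2, hs3⟩
    simp only [Test.Holds, WordExp.eval, wvar, rankWord]
    rw [hs2, hs1.word (by simp), hk]; exact lt_irrefl _
  · rintro s' ⟨hs1, hs2, hs3⟩
    exact ⟨hs1, hs3⟩

open Classical in
/-- One accepted item of the scan for the best swap. -/
lemma runs_swapTest {x : Fin n} (hx : s.word 3 (s.word 6 0) = x.val) (hxa : x.val < s.arrived) :
    Runs O (.ite (.mem (.read 3 (wvar 6)) 0 (.lit 0))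
      (.seq (.erase 0 (.lit 0) (.read 3 (wvar 6))) <|
        .seq (considerProgram 0 (.read 3 (wvar 6))) <|
        .insert 0 (.lit 0) (.read 3 (wvar 6)))
      .skip) s 9 fun s' =>
      SameExcept [5] [0] [0] s s' ∧ s'.set 0 0 = s.set 0 0 ∧ (s'.real 0 0, s'.word 5 0) =
        if (x ∈ s.set 0 0 ∧ O.indep ((s.set 0 0).erase x)) ∧
          s.real 0 0 < O.value ((s.set 0 0).erase x) then
          (O.value ((s.set 0 0).erase x), x.val) else (s.real 0 0, s.word 5 0) := by
  have hmem : (Test.mem (.read 3 (wvar 6)) 0 (.lit 0)).Holds O s ↔ x ∈ s.set 0 0 := holds_mem hx hxa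
  refine Runs.ite (T := 8) (fun h => ?_) fun h => ?_
  · rw [hmem] at h
    have hins : s.set 0 0 \ s.item (s.word 3 (s.word 6 0)) = (s.set 0 0).erase x := by
      rw [hx]; exact sdiff_item_code s (some x) (by simpa using hxa) _
    refine (Runs.cons (T := 6) (Runs.erase rfl) ?_)
    simp only [WordExp.eval, wvar, hins]
    refine (Runs.seq (T₂ := 1) (runs_considerProgram 0 _) fun s' hs' => Runs.insert ?_).mono
      (by norm_num) fun _ h => h
    obtain ⟨h1, h2⟩ := hs'
    have e1 : s'.word 3 (s'.word 6 0) = x.val := by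
      rw [h1.word (by simp), h1.word (by simp)]; exact hx
    have e2 : s'.set 0 0 = (s.set 0 0).erase x := by rw [h1.set (by simp)]; simp [write_apply]
    have e3 : x.val < s'.arrived := by rw [h1.arrived]; exact hxa
    refine ⟨((sameExcept_set _ _ _ _).trans (h1.trans (sameExcept_set _ _ _ _))).mono
      (by simp) (by simp) (by simp), ?_, ?_⟩
    · simp only [WordExp.eval, write_apply, and_self, if_true, e1, e2]
      rw [item_val s' x e3, Finset.union_comm, ← Finset.insert_eq, Finset.insert_erase h]
    · rw [h2]
      simp [write_apply, h, WordExp.eval, hx]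
  · rw [hmem] at h
    refine (Runs.skip ?_).mono (by norm_num) fun _ h => h
    exact ⟨SameExcept.refl _ _ _ _, rfl, by simp [h]⟩

/-- The scan of the accepted items for the best swap. -/
lemma runs_swapScan {l : List (Fin n)} {b : ℝ × Option (Fin n)} (h2 : s.word 2 0 = l.length)
    (h3 : ∀ i (hi : i < l.length), s.word 3 i = (l[i]).val) (hl : ∀ x ∈ l, x.val < s.arrived)
    (h6 : s.word 6 0 = 0) (hb : (s.real 0 0, s.word 5 0) = (b.1, code b.2)) :
    Runs O (.while (.wordLt (wvar 6) (wvar 2)) <|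
    .seq (.ite (.mem (.read 3 (wvar 6)) 0 (.lit 0))
      (.seq (.erase 0 (.lit 0) (.read 3 (wvar 6))) <|
        .seq (considerProgram 0 (.read 3 (wvar 6))) <|
        .insert 0 (.lit 0) (.read 3 (wvar 6)))
      .skip) <|
    increment 6) s (l.length * 12 + 1) fun s' => SameExcept [5, 6] [0] [0] s s' ∧
        s'.set 0 0 = s.set 0 0 ∧ ∃ b', b' = bestOf
          (fun c => (∀ x ∈ c, x ∈ s.set 0 0) ∧ O.indep (eraseOpt c (s.set 0 0)))
          (fun c => O.value (eraseOpt c (s.set 0 0))) b (l.map some) ∧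
          (s'.real 0 0, s'.word 5 0) = (b'.1, code b'.2) := by
  classical
  set b' : ℕ → ℝ × Option (Fin n) := fun i => bestOf
    (fun c => (∀ x ∈ c, x ∈ s.set 0 0) ∧ O.indep (eraseOpt c (s.set 0 0)))
    (fun c => O.value (eraseOpt c (s.set 0 0))) b ((l.take i).map some) with hb'
  have hsucc : ∀ i (hi : i < l.length), b' (i + 1) =
      if (l[i] ∈ s.set 0 0 ∧ O.indep ((s.set 0 0).erase l[i])) ∧
        (b' i).1 < O.value ((s.set 0 0).erase l[i]) then
        (O.value ((s.set 0 0).erase l[i]), some l[i]) else b' i := by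
    intro i hi
    simp only [hb']
    rw [List.take_succ_eq_append_getElem hi, List.map_append, List.map_singleton,
      bestOf_append_singleton]
    simp [eraseOpt]
  refine (Runs.while (I := fun i s' => SameExcept [5, 6] [0] [0] s s' ∧
      s'.set 0 0 = s.set 0 0 ∧ s'.word 6 0 = i ∧
      (s'.real 0 0, s'.word 5 0) = ((b' i).1, code (b' i).2))
      (m := l.length) (T := 11) ?_ ?_ ?_).mono le_rfl ?_
  · exact ⟨SameExcept.refl _ _ _ _, rfl, h6, by simpa [hb', bestOf] using hb⟩
  · rintro i s' hi ⟨hs1, hs2, hs3, hs4⟩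
    refine ⟨?_, ?_⟩
    · simp only [Test.Holds, WordExp.eval, wvar]
      rw [hs3, hs1.word (by simp), h2]; exact hi
    · refine Runs.seq (runs_swapTest (x := l[i]) (by rw [hs3, hs1.word (by simp), h3 i hi])
        (by rw [hs1.arrived]; exact hl _ (List.getElem_mem _))) (T₂ := 1)
        fun s'' hs'' => Runs.setWord ?_
      obtain ⟨ht1, ht2, ht3⟩ := hs''
      refine ⟨(hs1.trans (ht1.trans (sameExcept_word _ _ _ _))).mono
        (by simp) (by simp) (by simp), ht2.trans hs2, ?_, ?_⟩
      · simp only [WordExp.eval, wvar, write_apply, and_self, if_true]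
        rw [ht1.word (by simp), hs3]
      · rw [Prod.mk.injEq] at hs4
        simp only [WordExp.eval, wvar, write_apply]
        rw [if_neg (by simp), ht3, hsucc i hi, hs2, hs4.1, hs4.2]
        split_ifs <;> rfl
  · rintro s' ⟨hs1, hs2, hs3, hs4⟩
    simp only [Test.Holds, WordExp.eval, wvar]
    rw [hs3, hs1.word (by simp), h2]; exact lt_irrefl _
  · rintro s' ⟨hs1, hs2, hs3, hs4⟩
    exact ⟨hs1, hs2, _, rfl, by rw [hs4]; simp only [hb', List.take_length]⟩

/-- Scaling the gain by the rank. -/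
lemma runs_scaleGain {k : ℕ} (hk : s.word 0 1 = k) (h6 : s.word 6 0 = 0) (h3 : s.real 3 0 = 0) :
    Runs O (.while (.wordLt (wvar 6) rankWord) <|
      .seq (.setReal 3 (.lit 0) (.add (rvar 3) (.sub (rvar 0) (rvar 1)))) <|
      increment 6) s (k * 4 + 1) fun s' => SameExcept [6] [3] [] s s' ∧
        s'.real 3 0 = k * (s.real 0 0 - s.real 1 0) := by
  refine (Runs.while (I := fun i s' => SameExcept [6] [3] [] s s' ∧ s'.word 6 0 = i ∧
      s'.real 3 0 = i * (s.real 0 0 - s.real 1 0)) (m := k) (T := 3) ?_ ?_ ?_).mono le_rfl ?_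
  · exact ⟨SameExcept.refl _ _ _ _, h6, by simp [h3]⟩
  · rintro i s' hi ⟨hs1, hs2, hs3⟩
    refine ⟨?_, Runs.cons (T := 1) (Runs.setReal rfl) (Runs.setWord ⟨?_, ?_, ?_⟩)⟩
    · simp only [Test.Holds, WordExp.eval, wvar, rankWord]
      rw [hs2, hs1.word (by simp), hk]; exact hi
    · exact (hs1.trans ((sameExcept_real _ _ _ _).trans (sameExcept_word _ _ _ _))).mono
        (by simp) (by simp) (by simp)
    · simp [write_apply, WordExp.eval, wvar, hs2]
    · simp only [write_apply, WordExp.eval, RealExp.eval, rvar, and_self, if_true]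
      rw [hs3, hs1.real (by simp), hs1.real (by simp)]; push_cast; ring
  · rintro s' ⟨hs1, hs2, hs3⟩
    simp only [Test.Holds, WordExp.eval, wvar, rankWord]
    rw [hs2, hs1.word (by simp), hk]; exact lt_irrefl _
  · rintro s' ⟨hs1, hs2, hs3⟩
    exact ⟨hs1, hs3⟩

/-- The store `s` represents the state `st` of the local search with parameters `P`. -/
structure Represents (P : Params (Fin n)) (s : Store n) (st : State (Fin n)) : Prop where
  count : s.word 0 0 = n
  rank : s.word 0 1 = P.k
  acc_length : s.word 2 0 = st.acc.length
  acc_get : ∀ i (hi : i < st.acc.length), s.word 3 i = (st.acc[i]).val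
  acc_lt : ∀ x ∈ st.acc, x.val < s.arrived
  sol : s.set 0 0 = st.sol
  level : s.real 2 0 = P.level

/-- The choice of a swap takes `O(N + k)` steps if `N` items have been accepted. -/
lemma runs_chooseProgram {P : Params (Fin n)} {s₀ : Store n} {st : State (Fin n)}
    (hs₀ : Represents P s₀ st) (hs : SameExcept [5] [0, 1] [0] s₀ s)
    (hv : P.value = O.value) (hI : P.indep = O.indep) {e : Fin n}
    (h4 : s.word 4 0 = e.val) (h5 : s.word 5 0 = e.val)
    (h0 : s.real 0 0 = O.value st.sol) (h1 : s.real 1 0 = O.value st.sol)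
    (hset : s.set 0 0 = insert e st.sol) :
    Runs O (chooseProgram P.Q) s (st.acc.length * 12 + P.k * 4 + 19) fun s' =>
      SameExcept [5, 6] [0, 3] [0] s s' ∧ s'.set 0 0 = s.set 0 0 ∧
        s'.word 5 0 = code (swapChoice P st e) := by
  classical
  have hn : s.word 0 0 = n := by rw [hs.word (by simp), hs₀.count]
  have hk : s.word 0 1 = P.k := by rw [hs.word (by simp), hs₀.rank]
  have h2 : s.word 2 0 = st.acc.length := by rw [hs.word (by simp), hs₀.acc_length]
  have h3 : ∀ i (hi : i < st.acc.length), s.word 3 i = (st.acc[i]).val := by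
    intro i hi; rw [hs.word (by simp), hs₀.acc_get i hi]
  have hlt : ∀ x ∈ st.acc, x.val < s.arrived := by rw [hs.arrived]; exact hs₀.acc_lt
  have hlev : s.real 2 0 = P.level := by rw [hs.real (by simp), hs₀.level]
  refine (Runs.seq (T₂ := st.acc.length * 12 + P.k * 4 + 14) (runs_considerProgram 0 itemCount)
    fun s1 hs1 => ?_).mono (by omega) fun _ h => h
  obtain ⟨f1, g1⟩ := hs1
  set b : ℝ × Option (Fin n) := bestOf
    (fun c => (∀ x ∈ c, x ∈ s1.set 0 0) ∧ O.indep (eraseOpt c (s1.set 0 0)))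
    (fun c => O.value (eraseOpt c (s1.set 0 0))) (O.value st.sol, some e) [none] with hb
  have g1' : (s1.real 0 0, s1.word 5 0) = (b.1, code b.2) := by
    have hbe : b = if O.indep (s.set 0 0) ∧ O.value st.sol < O.value (s.set 0 0) then
        (O.value (s.set 0 0), none) else (O.value st.sol, some e) := by
      rw [hb, f1.set (by simp)]; simp [bestOf, eraseOpt]
    rw [g1, hbe, h0, h5]
    split_ifs with p
    · simp [code, itemCount, WordExp.eval, hn]
    · rfl
  refine Runs.cons (T := st.acc.length * 12 + P.k * 4 + 12) (Runs.setWord rfl) ?_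
  refine (Runs.seq (T₂ := P.k * 4 + 10) (runs_swapScan (b := b) (l := st.acc) ?_ ?_ ?_ ?_ ?_)
    fun s2 hs2 => ?_).mono (by omega) fun _ h => h
  · simp only [WordExp.eval, write_apply]; rw [if_neg (by simp), f1.word (by simp), h2]
  · intro i hi
    simp only [WordExp.eval, write_apply]; rw [if_neg (by simp), f1.word (by simp), h3 i hi]
  · intro x hx
    exact (hlt x hx).trans_eq f1.arrived.symm
  · simp [write_apply, WordExp.eval]
  · rw [← g1']; simp [write_apply]
  obtain ⟨f2, e2, b', hb', g2⟩ := hs2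
  have hbest : b' = swapBest P st e := by
    rw [hb', hb, f1.set (by simp), hset, swapBest, hv, hI]
    rfl
  rw [Prod.mk.injEq] at g2
  refine Runs.cons (T := P.k * 4 + 8) (Runs.setReal rfl) (Runs.cons (T := P.k * 4 + 6)
    (Runs.setWord rfl) ?_)
  have F2 : SameExcept [5, 6] [0] [0] s s2 := (f1.trans ((sameExcept_word _ _ _ _).trans f2)).mono
    (by simp) (by simp) (by simp)
  refine (Runs.seq (T₂ := 2) (runs_scaleGain (k := P.k) ?_ ?_ ?_) fun s3 hs3 => ?_).mono (by omega)
    fun _ h => h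
  · simp only [write_apply]; rw [if_neg (by simp), F2.word (by simp), hk]
  · simp [write_apply, WordExp.eval]
  · simp [write_apply, WordExp.eval, RealExp.eval]
  obtain ⟨f3, g3⟩ := hs3
  have F3 : SameExcept [5, 6] [0, 3] [0] s s3 := (F2.trans ((sameExcept_real _ _ _ _).trans
    ((sameExcept_word _ _ _ _).trans f3))).mono (by simp) (by simp) (by simp)
  have w5 : s3.word 5 0 = s2.word 5 0 := by
    rw [f3.word (by simp)]; simp [write_apply]
  have k3 : s3.real 3 0 = P.k * ((swapBest P st e).1 - P.value st.sol) := by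
    rw [g3, ← hbest, ← g2.1, hv, ← h1, ← F2.real (b := 1) (by simp)]
    simp [write_apply]
  have S3 : s3.set 0 0 = s.set 0 0 := by
    rw [f3.set (by simp), e2, ← f1.set (by simp)]
  have hW : (Test.and (.realLt (rvar 2) ((rvar 3).times P.Q))
      (.realLt (rvar 1) ((rvar 3).times P.Q))).Holds O s3 ↔
      Worthwhile P st ((swapBest P st e).1 - P.value st.sol) := by
    simp only [Test.Holds, eval_times_real, RealExp.eval, rvar, WordExp.eval]
    rw [k3, F3.real (b := 1) (by simp), F3.real (b := 2) (by simp), hlev, h1, Worthwhile, hv]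
  refine Runs.ite (T := 1) (fun h => Runs.skip ?_) (fun h => Runs.setWord ?_)
  · rw [hW] at h
    exact ⟨F3, S3, by rw [w5, g2.2, hbest, swapChoice, if_pos h]⟩
  · rw [hW] at h
    refine ⟨(F3.trans (sameExcept_word _ _ _ _)).mono (by simp) (by simp) (by simp), S3, ?_⟩
    rw [swapChoice, if_neg h]
    simp only [write_apply, WordExp.eval, wvar, and_self, if_true]
    rw [F3.word (by simp), h4]; rfl

lemma swapChoice_mem (P : Params (Fin n)) (st : State (Fin n)) (e : Fin n) {x : Fin n}
    (hx : x ∈ swapChoice P st e) : x = e ∨ x ∈ st.acc := by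
  rw [swapChoice] at hx
  split_ifs at hx with h
  · rcases (bestOf_spec
      (fun c => (∀ x ∈ c, x ∈ insert e st.sol) ∧ P.indep (eraseOpt c (insert e st.sol)))
      (fun c => P.value (eraseOpt c (insert e st.sol))) (P.value st.sol, some e)
      (none :: st.acc.map some)).2.2 with h | ⟨y, hy, -, -, h⟩
    · rw [swapBest, h] at hx; exact Or.inl (Option.mem_some.1 hx).symm
    · rw [swapBest, h] at hx
      simp only at hx
      rw [Option.mem_def] at hx
      subst hx
      rcases List.mem_cons.1 hy with hy | hy
      · simp at hy
      · obtain ⟨z, hz, hzx⟩ := List.mem_map.1 hy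
        rw [← Option.some_injective _ hzx]; exact Or.inr hz
  · exact Or.inl (Option.mem_some.1 hx).symm

/-- Trying an item takes `O(N + k)` steps if `N` items have been accepted. -/
lemma runs_swapProgram {P : Params (Fin n)} {st : State (Fin n)} (hs : Represents P s st)
    (hv : P.value = O.value) (hI : P.indep = O.indep) {e : Fin n}
    (h4 : s.word 4 0 = e.val) (hea : e.val < s.arrived) :
    Runs O (swapProgram P.Q) s (st.acc.length * 12 + P.k * 4 + 29) fun s' =>
      SameExcept [5, 6] [0, 1, 3] [0] s s' ∧ s'.set 0 0 = swapped P st e ∧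
        s'.word 5 0 = code (swapChoice P st e) := by
  classical
  have hE : s.set 0 0 ∪ s.item (s.word 4 0) = insert e st.sol := by
    rw [h4, hs.sol]; exact union_item_code s (some e) (by simpa using hea) _
  refine (Runs.cons (T := st.acc.length * 12 + P.k * 4 + 27) (Runs.setReal rfl) <|
    Runs.cons (T := st.acc.length * 12 + P.k * 4 + 25) (Runs.setReal rfl) <|
    Runs.cons (T := st.acc.length * 12 + P.k * 4 + 23) (Runs.setWord rfl) <|
    Runs.cons (T := st.acc.length * 12 + P.k * 4 + 21) (Runs.insert rfl) ?_)
  have F1 : SameExcept [5] [0, 1] [0] s _ :=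
    ((sameExcept_real s 1 0 (O.value (s.set 0 0))).trans <| (sameExcept_real _ 0 0
      (O.value (s.set 0 0))).trans <| (sameExcept_word _ 5 0 (s.word 4 0)).trans <|
      sameExcept_set _ 0 0 (s.set 0 0 ∪ s.item (s.word 4 0))).mono (by simp) (by simp) (by simp)
  refine (Runs.seq (T₂ := 1) (runs_chooseProgram (s₀ := s) hs F1 hv hI (e := e) ?_ ?_ ?_ ?_ ?_)
    fun s' hs' => Runs.erase ?_).mono (by omega) fun _ h => h
  · simp [write_apply, h4]
  · simp [write_apply, h4]
  · simp [write_apply, hs.sol]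
  · simp [write_apply, hs.sol]
  · simp [write_apply, hE]
  obtain ⟨f1, g1, g2⟩ := hs'
  have F2 : SameExcept [5, 6] [0, 1, 3] [0] s s' := (F1.trans f1).mono
    (by simp) (by simp) (by simp)
  refine ⟨(F2.trans (sameExcept_set _ _ _ _)).mono (by simp) (by simp) (by simp), ?_, g2⟩
  simp only [write_apply, WordExp.eval, wvar, and_self, if_true]
  rw [g2, sdiff_item_code, g1, swapped]
  · simp [write_apply, hE]
  · intro x hx
    rw [F2.arrived]
    rcases swapChoice_mem P st e hx with rfl | hx
    · exact hea
    · exact hs.acc_lt x hx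

end Verification

/-! ### The local search as a program -/

section Search

variable {n : ℕ} {O : Oracle n} {s : Store n} {P : Params (Fin n)} {st : State (Fin n)}

/-- In contrast to `swapped_spec`, nothing is assumed about the oracles. -/
lemma swapped_eq_or (P : Params (Fin n)) (st : State (Fin n)) {e : Fin n} (he : e ∉ st.sol) :
    (swapChoice P st e = some e ∧ swapped P st e = st.sol) ∨
      (swapChoice P st e ≠ some e ∧ swapped P st e ⊆ insert e st.sol ∧
        P.indep (swapped P st e)) := by
  by_cases h : swapChoice P st e = some e
  · left
    exact ⟨h, by rw [swapped, h, eraseOpt, Option.elim, Finset.erase_insert he]⟩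
  · right
    refine ⟨h, ?_, ?_⟩
    · rw [swapped]
      cases swapChoice P st e with
      | none => exact subset_rfl
      | some g => exact Finset.erase_subset _ _
    · rw [swapChoice] at h
      split_ifs at h with hw
      · rcases (bestOf_spec
          (fun c => (∀ x ∈ c, x ∈ insert e st.sol) ∧ P.indep (eraseOpt c (insert e st.sol)))
          (fun c => P.value (eraseOpt c (insert e st.sol))) (P.value st.sol, some e)
          (none :: st.acc.map some)).2.2 with hb | ⟨y, -, hy, -, hb⟩
        · exact absurd (by rw [swapBest, hb]) h
        · rw [swapped, swapChoice, if_pos hw, swapBest, hb]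
          exact hy.2
      · exact absurd rfl h

/-- The conditions on a state that guarantee an admissible output. -/
structure Feasible (P : Params (Fin n)) (st : State (Fin n)) : Prop where
  indep : P.indep st.sol
  sol_acc : ∀ x ∈ st.sol, x ∈ st.acc
  length_le : st.acc.length ≤ P.N

lemma Feasible.arrive (h : Feasible P st) (e : Fin n) : Feasible P (arriveStep P st e) := by
  unfold arriveStep
  split_ifs with h1 h2
  · exact h
  · exact h
  rw [not_or, not_le] at h1
  rcases swapped_eq_or P st (e := e) (fun he => h1.2 (h.sol_acc e he)) with ⟨h3, -⟩ | ⟨-, h3, h4⟩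
  · exact absurd h3 h2
  · refine ⟨h4, fun x hx => ?_, by simpa using h1.1⟩
    rcases Finset.mem_insert.1 (h3 hx) with rfl | hx
    · simp
    · simp [h.sol_acc x hx]

lemma Feasible.retry (h : Feasible P st) (r : ℕ) : Feasible P (retryStep P st r) := by
  unfold retryStep
  cases hr : st.acc[r]? with
  | none => exact h
  | some e =>
    simp only
    split_ifs with he
    · exact h
    · rcases swapped_eq_or P st he with ⟨-, h3⟩ | ⟨-, h3, h4⟩
      · rw [h3]; exact h
      · refine ⟨h4, fun x hx => ?_, h.length_le⟩
        rcases Finset.mem_insert.1 (h3 hx) with rfl | hx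
        · exact List.mem_of_getElem? hr
        · exact h.sol_acc x hx

/-- The store `s` represents the state `st` after the arrival of `c` items. -/
structure Tracks (P : Params (Fin n)) (s : Store n) (st : State (Fin n)) (c : ℕ) : Prop
    extends Represents P s st where
  round : s.word 1 0 = c
  arrived : s.arrived = c
  shortlist : s.shortlist = st.acc.toFinset

lemma Tracks.of_sameExcept {c : ℕ} (h : Tracks P s st c) {s' : Store n}
    (hs : SameExcept [4, 5, 6, 7] [0, 1, 3] [0] s s') {S : Finset (Fin n)} (hS : s'.set 0 0 = S) :
    Tracks P s' ⟨st.acc, S⟩ c where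
  count := by rw [hs.word (by simp), h.count]
  rank := by rw [hs.word (by simp), h.rank]
  acc_length := by rw [hs.word (by simp), h.acc_length]
  acc_get := fun i hi => by rw [hs.word (by simp), h.acc_get i hi]
  acc_lt := by rw [hs.arrived]; exact h.acc_lt
  sol := hS
  level := by rw [hs.real (by simp), h.level]
  round := by rw [hs.word (by simp), h.round]
  arrived := by rw [hs.arrived, h.arrived]
  shortlist := by rw [hs.shortlist, h.shortlist]

lemma Tracks.of_sameExcept' {c : ℕ} (h : Tracks P s st c) {s' : Store n}
    (hs : SameExcept [4, 5, 6, 7] [0, 1, 3] [] s s') : Tracks P s' st c :=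
  h.of_sameExcept (hs.mono (by simp) (by simp) (by simp)) (by rw [hs.set (by simp), h.sol])

/-- The part of `retryProgram` that follows the random choice. -/
lemma runs_retry (hv : P.value = O.value) (hI : P.indep = O.indep) {c r : ℕ}
    (h : Tracks P s st c) (h7 : s.word 7 0 = r) :
    Runs O (.ite (.wordLt (wvar 7) (wvar 2))
      (.seq (.setWord 4 (.lit 0) (.read 3 (wvar 7))) <|
        .ite (.mem (wvar 4) 0 (.lit 0)) .skip (swapProgram P.Q))
      .skip) s (st.acc.length * 12 + P.k * 4 + 33) fun s' => Tracks P s' (retryStep P st r) c := by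
  refine Runs.ite (T := st.acc.length * 12 + P.k * 4 + 32) (fun hr => ?_) fun hr => ?_
  · simp only [Test.Holds, WordExp.eval, wvar, h7, h.acc_length] at hr
    have hget : st.acc[r]? = some st.acc[r] := List.getElem?_eq_getElem hr
    have hlt : st.acc[r].val < s.arrived := h.acc_lt _ (List.getElem_mem _)
    set s₁ : Store n := { s with word := write s.word 4 0 (s.word 3 (s.word 7 0)) } with hs₁
    have h1 : Tracks P s₁ st c := h.of_sameExcept'
      ((sameExcept_word s 4 0 _).mono (by simp) (by simp) (by simp))
    have h4 : s₁.word 4 0 = st.acc[r].val := by simp [hs₁, write_apply, h7, h.acc_get r hr]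
    have hmem : (Test.mem (wvar 4) 0 (.lit 0)).Holds O s₁ ↔ st.acc[r] ∈ st.sol := by
      rw [holds_mem (s := s₁) (x := wvar 4) (y := st.acc[r]) h4 hlt, ← h.sol]
      rfl
    refine Runs.cons (T := st.acc.length * 12 + P.k * 4 + 30) (s₁ := s₁) (Runs.setWord rfl) ?_
    refine Runs.ite (T := st.acc.length * 12 + P.k * 4 + 29) (fun he => ?_) fun he => ?_
    · rw [hmem] at he
      refine (Runs.skip ?_).mono (by omega) fun _ h => h
      rw [retryStep, hget]
      simp only [he, if_true]
      exact h1
    · rw [hmem] at he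
      refine (runs_swapProgram (e := st.acc[r]) h1.toRepresents hv hI h4 hlt).mono le_rfl
        fun s' hs' => ?_
      rw [retryStep, hget]
      simp only [he, if_false]
      exact h1.of_sameExcept (hs'.1.mono (by simp) (by simp) (by simp)) hs'.2.1
  · simp only [Test.Holds, WordExp.eval, wvar, h7, h.acc_length, not_lt] at hr
    refine (Runs.skip ?_).mono (by omega) fun _ h => h
    rw [retryStep, List.getElem?_eq_none hr]
    exact h

lemma runs_arriveProgram (hv : P.value = O.value) (hI : P.indep = O.indep) {N₀ : ℕ}
    (hN : P.N = N₀ * P.k) (hst : Feasible P st) {e : Fin n} (h : Tracks P s st (e.val + 1))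
    (he : e ∉ st.acc) :
    Runs O (arriveProgram P.Q N₀) s (st.acc.length * 12 + P.k * 4 + 40) fun s' =>
      Tracks P s' (arriveStep P st e) (e.val + 1) := by
  have hes : e ∉ st.sol := fun h => he (hst.sol_acc e h)
  refine Runs.ite (T := st.acc.length * 12 + P.k * 4 + 39) (fun hr => ?_) fun hr => ?_
  · simp only [Test.Holds, eval_times, WordExp.eval, wvar, rankWord, h.acc_length, h.rank,
      ← hN] at hr
    refine Runs.cons (T := st.acc.length * 12 + P.k * 4 + 37) (Runs.setWord rfl) ?_
    have F1 := sameExcept_word s 4 0 (s.word 1 0 - 1)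
    have h1 := h.of_sameExcept' (F1.mono (by simp) (by simp) (by simp))
    have h4 : s.word 1 0 - 1 = e.val := by rw [h.round]; rfl
    refine (Runs.seq (T₂ := 6) (runs_swapProgram (e := e) h1.toRepresents hv hI ?_ ?_)
      fun s' hs' => ?_).mono (by omega) fun _ h => h
    · simp [write_apply, h4]
    · exact (Nat.lt_succ_self _).trans_eq h.arrived.symm
    obtain ⟨f2, g2, g3⟩ := hs'
    have h2 := h1.of_sameExcept (f2.mono (by simp) (by simp) (by simp)) g2
    have h4' : s'.word 4 0 = e.val := by rw [f2.word (by simp)]; simp [write_apply, h4]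
    have hEq : (Test.and (.not (.wordLt (wvar 4) (wvar 5)))
        (.not (.wordLt (wvar 5) (wvar 4)))).Holds O s' ↔ swapChoice P st e = some e := by
      simp only [Test.Holds, WordExp.eval, wvar, not_lt]
      rw [h4', g3, ← le_antisymm_iff]
      exact code_injective.eq_iff (b := some e)
    have harr : arriveStep P st e =
        if swapChoice P st e = some e then st else ⟨st.acc ++ [e], swapped P st e⟩ := by
      rw [arriveStep, if_neg]
      rw [not_or, not_le]
      exact ⟨hr, he⟩
    refine Runs.ite (T := 5) (fun hc => ?_) fun hc => ?_
    · rw [hEq] at hc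
      refine (Runs.skip ?_).mono (by omega) fun _ h => h
      rw [harr, if_pos hc]
      rcases swapped_eq_or P st hes with ⟨-, hsw⟩ | ⟨hc', -⟩
      · rw [hsw] at h2; exact h2
      · exact absurd hc hc'
    · rw [hEq] at hc
      refine Runs.cons (T := 3) (Runs.setWord rfl) (Runs.cons (T := 1) (Runs.setWord rfl)
        (Runs.select ?_))
      rw [harr, if_neg hc]
      have hlen := h2.acc_length
      simp only at hlen
      exact
        { count := by simp [write_apply, h2.count]
          rank := by simp [write_apply, h2.rank]
          acc_length := by simp [write_apply, WordExp.eval, wvar, hlen]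
          acc_get := fun i hi => by
            simp only [List.length_append, List.length_singleton] at hi
            simp only [WordExp.eval, wvar, write_apply]
            rw [if_neg (by simp)]
            by_cases hi' : i = st.acc.length
            · subst hi'
              simp [hlen, h4']
            · rw [if_neg (by simp [hlen, hi'])]
              have : i < st.acc.length := by omega
              rw [List.getElem_append_left this]
              exact h2.acc_get i this
          acc_lt := fun x hx => by
            simp only [List.mem_append, List.mem_singleton] at hx
            rcases hx with hx | rfl
            · exact h2.acc_lt x hx
            · simp only [h2.arrived]; omega
          sol := h2.sol
          level := h2.level
          round := by simp [write_apply, h2.round]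
          arrived := h2.arrived
          shortlist := by
            simp only [h2.shortlist, h2.arrived, Nat.add_sub_cancel, List.toFinset_append]
            congr 1
            refine (item_val _ e ?_).trans (by simp)
            exact Nat.lt_succ_self _ }
  · simp only [Test.Holds, eval_times, WordExp.eval, wvar, rankWord, h.acc_length, h.rank,
      ← hN, not_lt] at hr
    refine (Runs.skip ?_).mono (by omega) fun _ h => h
    rw [arriveStep, if_pos (Or.inl hr)]
    exact h

variable {φ : Finset (Fin n) × Finset (Fin n) → ℝ}
  {Post : Finset (Fin n) × Finset (Fin n) → Prop}

lemma Guarantee.random_range {T N : ℕ} {K : List Program} {a : ℕ} {i m : WordExp} {V : ℕ → ℝ}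
    (hN : m.eval s + 1 = N)
    (h : ∀ r < N, Guarantee O φ Post T
      ⟨K, { s with word := write s.word a (i.eval s) r }⟩ (V r)) :
    Guarantee O φ Post (T + 1) ⟨.random a i m :: K, s⟩ ((∑ r ∈ Finset.range N, V r) / N) := by
  subst hN
  rw [← Fin.sum_univ_eq_sum_range]
  exact Guarantee.random fun r => h r.val r.2

/-- The program simulates the local search on the last `d` items, with `O(N + k)` steps for each of
them. -/
lemma guarantee_searchProgram (hv : P.value = O.value) (hI : P.indep = O.indep) (hQ : 0 < P.Q)
    {N₀ : ℕ} (hN : P.N = N₀ * P.k) (hN0 : 0 < P.N)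
    (hφ : ∀ A B, B ⊆ A → P.indep B → P.value B ≤ φ (A, B))
    (hPost : ∀ A B : Finset (Fin n), A.card ≤ P.N → B ⊆ A → P.indep B → Post (A, B)) (d : ℕ) :
    ∀ {c : ℕ} {s : Store n} {st : State (Fin n)}, c + d = n → Tracks P s st c → Feasible P st →
      Guarantee O φ Post (d * (P.N * 12 + P.k * 4 + 50) + 1) ⟨[searchProgram P.Q N₀], s⟩
        ((dynamics P).expect (fun st => P.value st.sol) ((List.finRange n).drop c) st) := by
  induction d with
  | zero =>
    intro c s st hc hs hst
    have hh : ¬ (Test.wordLt (wvar 1) itemCount).Holds O s := by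
      simp only [Test.Holds, WordExp.eval, wvar, itemCount, hs.round, hs.count]; omega
    refine (Guarantee.step_pure (c' := ⟨[], s⟩) (by simp only [searchProgram, step, hh, if_false])
      (Guarantee.halt ?_ ?_)).mono (by omega) le_rfl
    · rw [hs.shortlist, hs.sol]
      exact hPost _ _ ((List.toFinset_card_le _).trans hst.length_le)
        (fun x hx => by simpa using hst.sol_acc x hx) hst.indep
    · rw [hs.shortlist, hs.sol, List.drop_of_length_le (by simp; omega)]
      exact hφ _ _ (fun x hx => by simpa using hst.sol_acc x hx) hst.indep
  | succ d ih =>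
    intro c s st hc hs hst
    obtain ⟨B, hB⟩ : ∃ B, B = P.N * 12 + P.k * 4 := ⟨_, rfl⟩
    rw [← hB] at ih ⊢
    have hcn : c < n := by omega
    have hh : (Test.wordLt (wvar 1) itemCount).Holds O s := by
      simp only [Test.Holds, WordExp.eval, wvar, itemCount, hs.round, hs.count]; omega
    rw [List.drop_eq_getElem_cons (by simpa using hcn)]
    simp only [List.getElem_finRange, Fin.cast_mk, Dynamics.expect]
    set e : Fin n := ⟨c, hcn⟩ with he
    set val := (dynamics P).expect (fun st => P.value st.sol) ((List.finRange n).drop (c + 1))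
      with hval
    -- The item `e` arrives.
    set s₁ : Store n := { s with arrived := c + 1, word := write s.word 1 0 (c + 1) } with hs₁
    have h₁ : Tracks P s₁ st (c + 1) :=
      { count := by simp [hs₁, write_apply, hs.count]
        rank := by simp [hs₁, write_apply, hs.rank]
        acc_length := by simp [hs₁, write_apply, hs.acc_length]
        acc_get := fun i hi => by simp [hs₁, write_apply, hs.acc_get i hi]
        acc_lt := fun x hx => by
          have := hs.acc_lt x hx
          rw [hs.arrived] at this
          simp only [hs₁]; omega
        sol := hs.sol
        level := hs.level
        round := by simp [hs₁, write_apply]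
        arrived := rfl
        shortlist := hs.shortlist }
    have heacc : e ∉ st.acc := fun h => by
      have := hs.acc_lt e h
      rw [hs.arrived] at this
      exact lt_irrefl _ this
    have hlen : st.acc.length * 12 + P.k * 4 ≤ B := by have := hst.length_le; omega
    obtain ⟨D, hD⟩ : ∃ D, D = d * (B + 50) + 1 := ⟨_, rfl⟩
    rw [← hD] at ih
    have hcont : ∀ {s' st'}, Tracks P s' st' (c + 1) → Feasible P st' →
        Guarantee O φ Post D ⟨[searchProgram P.Q N₀], s'⟩ (val st') :=
      fun h1 h2 => ih (by omega) h1 h2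
    -- The two branches after the first random choice.
    have hbranch : ∀ r < P.Q, Guarantee O φ Post (B + 41 + D + 1)
        ⟨[.ite (.wordLt (wvar 7) (.lit 1)) (retryProgram P.Q N₀) (arriveProgram P.Q N₀),
          searchProgram P.Q N₀], { s₁ with word := write s₁.word 7 0 r }⟩
        (if r = 0 then (∑ r ∈ Finset.range P.N, val (retryStep P st r)) / P.N
          else val (arriveStep P st e)) := by
      intro r hr
      have h₂ := h₁.of_sameExcept' ((sameExcept_word s₁ 7 0 r).mono (by simp) (by simp) (by simp))
      set s₂ : Store n := { s₁ with word := write s₁.word 7 0 r } with hs₂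
      have hcond : (Test.wordLt (wvar 7) (.lit 1)).Holds O s₂ ↔ r = 0 := by
        simp [Test.Holds, WordExp.eval, wvar, hs₂, write_apply]
      split_ifs with hr0
      · refine Guarantee.step_pure (c' := ⟨[retryProgram P.Q N₀, searchProgram P.Q N₀], s₂⟩)
          (by simp only [step, hcond.2 hr0, if_true]) ?_
        refine (Guarantee.step_pure (by simp only [retryProgram, step]; rfl)
          (Guarantee.random_range (T := B + 33 + D) (N := P.N)
          (V := fun r => val (retryStep P st r)) ?_ fun r' hr' => ?_)).mono (by omega) le_rfl
        · simp only [WordExp.eval, eval_times, rankWord, h₂.rank, ← hN]; omega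
        · have h₃ := h₂.of_sameExcept' ((sameExcept_word s₂ 7 0 r').mono
            (by simp) (by simp) (by simp))
          exact (runs_retry hv hI h₃ (by simp [write_apply]) _ _ _ _ _
            fun s' hs' => hcont hs' (hst.retry r')).mono (by omega) le_rfl
      · refine Guarantee.step_pure (c' := ⟨[arriveProgram P.Q N₀, searchProgram P.Q N₀], s₂⟩)
          (by simp only [step]; rw [if_neg (fun h => hr0 (hcond.1 h))]) ?_
        exact (runs_arriveProgram hv hI hN hst h₂ heacc _ _ _ _ _
          fun s' hs' => hcont hs' (hst.arrive e)).mono (by omega) le_rfl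
    have hrand := Guarantee.random_range (s := s₁) (i := .lit 0) (m := .lit (P.Q - 1)) (N := P.Q)
      (by simp only [WordExp.eval]; omega) hbranch
    have hsum : (∑ r ∈ Finset.range P.Q,
        if r = 0 then (∑ r ∈ Finset.range P.N, val (retryStep P st r)) / P.N
          else val (arriveStep P st e)) / P.Q = (dynamics P).next val e st := by
      obtain ⟨q, hq⟩ : ∃ q, P.Q = q + 1 := ⟨P.Q - 1, by omega⟩
      have hq' : ((q : ℝ) + 1) ≠ 0 := by positivity
      rw [Dynamics.next, hq, Finset.sum_range_succ']
      simp only [Nat.add_eq_zero_iff, one_ne_zero, and_false, if_false, if_true, Finset.sum_const,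
        Finset.card_range, nsmul_eq_mul, dynamics, hq]
      push_cast
      field_simp
      ring
    rw [hsum] at hrand
    have hstep1 : step O ⟨[searchProgram P.Q N₀], s⟩ = PMF.pure ⟨[.seq .next <|
        .seq (increment 1) <| .seq (.random 7 (.lit 0) (.lit (P.Q - 1))) <|
        .ite (.wordLt (wvar 7) (.lit 1)) (retryProgram P.Q N₀) (arriveProgram P.Q N₀),
        searchProgram P.Q N₀], s⟩ := by
      simp only [searchProgram, step, hh, if_true]
    have harrived : min (s.arrived + 1) n = c + 1 := by rw [hs.arrived]; omega
    refine (Guarantee.step_pure hstep1 <| Guarantee.step_pure (by simp only [step]; rfl) <|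
      Guarantee.step_pure (by simp only [step]; rfl) <|
      Guarantee.step_pure (by simp only [step]; rfl) <|
      Guarantee.step_pure (by simp only [increment, step]; rfl) <|
      Guarantee.step_pure (T := B + 41 + D + 1 + 1) (by simp only [step]; rfl) ?_).mono ?_ le_rfl
    · simp only [harrived, WordExp.eval, wvar, hs.round]
      exact hrand
    · rw [Nat.succ_mul]; omega

end Search

/-! ### The algorithm as a program -/

section Main

variable {n : ℕ} {O : Oracle n} {φ : Finset (Fin n) × Finset (Fin n) → ℝ}
  {Post : Finset (Fin n) × Finset (Fin n) → Prop}

lemma runs_shortProgram {s : Store n} {k : ℕ} (hn : s.word 0 0 = n) (hk : s.word 0 1 = k)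
    (h1 : s.word 1 0 = 0) (harr : s.arrived = 0) (hset : s.set 0 0 = ∅) (hsl : s.shortlist = ∅) :
    Runs O shortProgram s (n * 6 + k * (n * 12 + 12) + 5) fun s' =>
      s'.shortlist = Finset.univ ∧
        s'.set 0 0 = greedy O.value O.indep (List.finRange n) k := by
  refine (Runs.seq (T₂ := k * (n * 12 + 12) + 3) (Runs.while
    (I := fun i s' => (s'.word 0 = s.word 0 ∧ s'.set 0 0 = ∅) ∧ s'.word 1 0 = i ∧ s'.arrived = i ∧
      s'.shortlist = Finset.univ.filter fun j : Fin n => j.val < i) (m := n) (T := 5) ?_ ?_ ?_)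
    fun s' hs' => ?_).mono (by omega) fun _ h => h
  · exact ⟨⟨rfl, hset⟩, h1, harr, by simp [hsl]⟩
  · rintro i s' hi ⟨⟨e0, e1⟩, e2, e3, e4⟩
    refine ⟨?_, Runs.cons (T := 3) (Runs.next rfl) (Runs.cons (T := 1) (Runs.setWord rfl)
      (Runs.select ?_))⟩
    · simp only [Test.Holds, WordExp.eval, wvar, itemCount, e2, e0, hn]; exact hi
    · have harr' : min (s'.arrived + 1) n = i + 1 := by omega
      refine ⟨⟨by simp [write_of_ne, e0], e1⟩, by simp [write_apply, WordExp.eval, wvar, e2],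
        harr', ?_⟩
      simp only [harr', Nat.add_sub_cancel, e4]
      ext j
      rw [Finset.mem_union, mem_item]
      simp only [Finset.mem_filter, Finset.mem_univ, true_and]
      omega
  · rintro s' ⟨⟨e0, e1⟩, e2, e3, e4⟩
    simp only [Test.Holds, WordExp.eval, wvar, itemCount, e2, e0, hn]; exact lt_irrefl _
  · obtain ⟨⟨e0, e1⟩, e2, e3, e4⟩ := hs'
    refine (runs_greedyProgram 0 (c := n) (k := k) le_rfl (by rw [e0, hn]) (by rw [e0, hk]) e2 e3
      e1).mono le_rfl ?_
    rintro s'' ⟨f1, f2⟩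
    refine ⟨by rw [f1.shortlist, e4]; simp, ?_⟩
    rw [f2, List.take_of_length_le (by simp)]

/-- The number of items in the sample, rounded up. -/
def sampleSize (n Q : ℕ) : ℕ := (n + Q - 1) / Q

/-- This is the test by which the program detects the end of the sample. -/
lemma lt_sampleSize {n Q i : ℕ} (hQ : 0 < Q) : i < sampleSize n Q ↔ Q * i < n := by
  rw [sampleSize, ← Nat.succ_le_iff, Nat.le_div_iff_mul_le hQ, Nat.succ_mul, mul_comm]
  omega

lemma sampleSize_le {n Q : ℕ} (hQ : 0 < Q) : sampleSize n Q ≤ n := by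
  by_contra h
  have := (lt_sampleSize hQ).1 (not_le.1 h)
  have := Nat.le_mul_of_pos_left n hQ
  omega

/-- Parameters of the local search with the level determined by the sample. -/
noncomputable def searchParams (O : Oracle n) (Q N₀ k : ℕ) : Params (Fin n) where
  value := O.value
  indep := O.indep
  level := O.value (greedy O.value O.indep ((List.finRange n).take (sampleSize n Q)) k)
  Q := Q
  k := k
  N := N₀ * k

lemma guarantee_longProgram {s : Store n} {k Q N₀ : ℕ} (hk0 : 0 < k) (hQ : 0 < Q) (hN₀ : 0 < N₀)
    (hs : s = (initial .skip n k).store) (hI : O.indep ∅)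
    (hφ : ∀ A B, B ⊆ A → O.indep B → O.value B ≤ φ (A, B))
    (hPost : ∀ A B : Finset (Fin n), A.card ≤ N₀ * k → B ⊆ A → O.indep B → Post (A, B)) :
    Guarantee O φ Post (n * 4 + k * (n * 12 + 12) + n * (N₀ * k * 12 + k * 4 + 50) + 10)
      ⟨[longProgram Q N₀], s⟩ ((dynamics (searchParams O Q N₀ k)).expect (fun st => O.value st.sol)
        ((List.finRange n).drop (sampleSize n Q)) ⟨[], ∅⟩) := by
  set c := sampleSize n Q with hc
  have hcn : c ≤ n := sampleSize_le hQ
  have hsample : Runs O (.while (.wordLt ((wvar 1).times Q) itemCount) <|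
      .seq .next (increment 1)) s (c * 4 + 1) fun s' =>
        SameExcept [1] [] [] s ⟨s'.word, s'.real, s'.set, s.arrived, s'.shortlist⟩ ∧
          s'.word 1 0 = c ∧ s'.arrived = c := by
    refine Runs.while (I := fun i s' =>
      SameExcept [1] [] [] s ⟨s'.word, s'.real, s'.set, s.arrived, s'.shortlist⟩ ∧
          s'.word 1 0 = i ∧ s'.arrived = i) (m := c) (T := 3) ?_ ?_ ?_
    · exact ⟨SameExcept.refl _ _ _ _, by simp [hs, initial], by simp [hs, initial]⟩
    · rintro i s' hi ⟨e1, e2, e3⟩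
      refine ⟨?_, Runs.cons (T := 1) (Runs.next rfl) (Runs.setWord ⟨?_, ?_, ?_⟩)⟩
      · simp only [Test.Holds, eval_times, WordExp.eval, wvar, itemCount, e2]
        have := e1.word (b := 0) (by simp)
        simp only at this
        rw [this, hs]
        exact (lt_sampleSize hQ).1 hi
      · exact (e1.trans (sameExcept_word _ 1 0 _)).mono (by simp) (by simp) (by simp)
      · simp [write_apply, WordExp.eval, wvar, e2]
      · simp only; omega
    · rintro s' ⟨e1, e2, e3⟩
      simp only [Test.Holds, eval_times, WordExp.eval, wvar, itemCount, e2]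
      have := e1.word (b := 0) (by simp)
      simp only at this
      rw [this, hs]
      exact fun h => lt_irrefl _ ((lt_sampleSize hQ).2 h)
  -- What follows the sampling.
  have hlong : ∀ s₁ : Store n,
      SameExcept [1] [] [] s ⟨s₁.word, s₁.real, s₁.set, s.arrived, s₁.shortlist⟩ ∧
        s₁.word 1 0 = c ∧ s₁.arrived = c →
      Guarantee O φ Post (k * (n * 12 + 12) + n * (N₀ * k * 12 + k * 4 + 50) + 8)
        ⟨[.seq (greedyProgram 1) <| .seq (.setReal 2 (.lit 0) (valueOf 1)) <| searchProgram Q N₀],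
          s₁⟩ ((dynamics (searchParams O Q N₀ k)).expect (fun st => O.value st.sol)
            ((List.finRange n).drop c) ⟨[], ∅⟩) := by
    rintro s₁ ⟨e1, e2, e3⟩
    have w0 : s₁.word 0 = s.word 0 := e1.word (by simp)
    have w2 : s₁.word 2 = s.word 2 := e1.word (by simp)
    have t0 : s₁.set 0 = s.set 0 := e1.set (by simp)
    have t1 : s₁.set 1 = s.set 1 := e1.set (by simp)
    have sl : s₁.shortlist = s.shortlist := e1.shortlist
    have hrun := runs_greedyProgram (O := O) (s := s₁) 1 (c := c) (k := k) hcn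
      (by rw [w0, hs]; rfl) (by rw [w0, hs]; rfl) e2 e3 (by rw [t1, hs]; rfl)
    refine (Guarantee.step_pure (by simp only [step]; rfl)
      (hrun φ Post _ (n * (N₀ * k * 12 + k * 4 + 50) + 3) _ fun s₂ hs₂ => ?_)).mono ?_ le_rfl
    · obtain ⟨f1, f2⟩ := hs₂
      refine (Guarantee.step_pure (by simp only [step]; rfl) <|
        Guarantee.step_pure (by simp only [step]; rfl) <|
        guarantee_searchProgram (P := searchParams O Q N₀ k) rfl rfl hQ rfl
          (Nat.mul_pos hN₀ hk0) hφ hPost (n - c) (c := c) (by omega) ?_ ?_).mono ?_ le_rfl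
      · exact
          { count := by
              show s₂.word 0 0 = n
              rw [f1.word (by simp), w0, hs]; rfl
            rank := by
              show s₂.word 0 1 = k
              rw [f1.word (by simp), w0, hs]; rfl
            acc_length := by
              show s₂.word 2 0 = 0
              rw [f1.word (by simp), w2, hs]; rfl
            acc_get := fun i hi => absurd hi (by simp)
            acc_lt := by simp
            sol := by
              show s₂.set 0 0 = ∅
              rw [f1.set (by simp), t0, hs]; rfl
            level := by
              simp [write_apply, WordExp.eval, RealExp.eval, valueOf, f2, searchParams, hc]
            round := by
              show s₂.word 1 0 = c
              rw [f1.word (by simp), e2]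
            arrived := f1.arrived.trans e3
            shortlist := by
              show s₂.shortlist = _
              rw [f1.shortlist, sl, hs]; rfl }
      · exact ⟨hI, by simp, by simp⟩
      · have : (n - c) * (N₀ * k * 12 + k * 4 + 50) ≤ n * (N₀ * k * 12 + k * 4 + 50) :=
          Nat.mul_le_mul_right _ (Nat.sub_le _ _)
        simp only [searchParams]
        omega
    · have : k * (c * 12 + 12) ≤ k * (n * 12 + 12) := Nat.mul_le_mul_left _ (by omega)
      omega
  refine (Guarantee.step_pure (by simp only [longProgram, step])
    (hsample φ Post _ _ _ hlong)).mono ?_ le_rfl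
  omega

/-- The running time, the output and the value of the whole algorithm for a fixed arrival order. -/
lemma guarantee_mainProgram {k Q N₀ K : ℕ} (hn : 0 < n) (hk : 0 < k) (hQ : 0 < Q) (hN₀ : 0 < N₀)
    (hI : O.indep ∅) (hφ : ∀ A B, B ⊆ A → O.indep B → O.value B ≤ φ (A, B))
    (hPost : ∀ A B : Finset (Fin n), A.card ≤ N₀ * k → B ⊆ A → O.indep B → Post (A, B))
    (hPost' : n ≤ K * k → Post (Finset.univ, greedy O.value O.indep (List.finRange n) k)) :
    Guarantee O φ Post ((N₀ * 12 + 100) * (n * k)) (initial (mainProgram Q N₀ K) n k)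
      (if K * k < n then
        (dynamics (searchParams O Q N₀ k)).expect (fun st => O.value st.sol)
          ((List.finRange n).drop (sampleSize n Q)) ⟨[], ∅⟩
      else φ (Finset.univ, greedy O.value O.indep (List.finRange n) k)) := by
  set s : Store n := (initial .skip n k).store with hs
  have hinit : initial (mainProgram Q N₀ K) n k = ⟨[mainProgram Q N₀ K], s⟩ := rfl
  have hcond : (Test.wordLt (rankWord.times K) itemCount).Holds O s ↔ K * k < n := by
    simp [Test.Holds, WordExp.eval, rankWord, itemCount, hs, initial]
  have hnk : n ≤ n * k := Nat.le_mul_of_pos_right n hk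
  have hkn : k ≤ n * k := Nat.le_mul_of_pos_left k hn
  have hpos : 1 ≤ n * k := Nat.mul_pos hn hk
  rw [hinit]
  split_ifs with h
  · refine (Guarantee.step_pure (c' := ⟨[longProgram Q N₀], s⟩)
      (by simp only [mainProgram, step]; rw [if_pos (hcond.2 h)])
      (guarantee_longProgram hk hQ hN₀ hs hI hφ hPost)).mono ?_ le_rfl
    have e1 : k * (n * 12 + 12) = 12 * (n * k) + 12 * k := by ring
    have e2 : n * (N₀ * k * 12 + k * 4 + 50) = (N₀ * 12) * (n * k) + 4 * (n * k) + 50 * n := by ring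
    rw [e1, e2, add_mul]
    omega
  · refine (Guarantee.step_pure (c' := ⟨[shortProgram], s⟩)
      (by simp only [mainProgram, step]; rw [if_neg (fun h' => h (hcond.1 h'))])
      (runs_shortProgram (k := k) rfl rfl rfl rfl rfl rfl φ Post [] 0 _ fun s' hs' =>
        Guarantee.halt ?_ ?_)).mono ?_ le_rfl
    · rw [hs'.1, hs'.2]; exact hPost' (not_lt.1 h)
    · rw [hs'.1, hs'.2]
    · have e1 : k * (n * 12 + 12) = 12 * (n * k) + 12 * k := by ring
      rw [e1, add_mul]
      omega

end Main

/-! ### Renaming the items -/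

section Renaming

lemma bestOf_map {γ γ' : Type*} (g : γ → γ') {cand : γ → Prop} {cand' : γ' → Prop} {val : γ → ℝ}
    {val' : γ' → ℝ} (hc : ∀ x, cand' (g x) ↔ cand x) (hv : ∀ x, val' (g x) = val x) (b : ℝ × γ)
    (l : List γ) :
    bestOf cand' val' (b.1, g b.2) (l.map g) =
      ((bestOf cand val b l).1, g (bestOf cand val b l).2) := by
  induction l generalizing b with
  | nil => rfl
  | cons x l ih =>
    simp only [bestOf, List.map_cons, List.foldl_cons] at ih ⊢
    rw [← ih]
    congr 1
    by_cases h : cand x ∧ b.1 < val x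
    · rw [if_pos h, if_pos (by rw [hc, hv]; exact h), hv]
    · rw [if_neg h, if_neg (by rw [hc, hv]; exact h)]

variable {β α : Type*} [DecidableEq β] [DecidableEq α] (j : β ↪ α)

lemma insertOpt_map (c : Option β) (G : Finset β) :
    insertOpt (c.map j) (G.map j) = (insertOpt c G).map j := by
  cases c with
  | none => rfl
  | some x => simp [insertOpt, Finset.map_insert]

lemma eraseOpt_map (c : Option β) (G : Finset β) :
    eraseOpt (c.map j) (G.map j) = (eraseOpt c G).map j := by
  cases c with
  | none => rfl
  | some x => simp [eraseOpt, Finset.map_erase]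

variable {F : Finset α → ℝ} {I : Finset α → Prop}

lemma greedyRound_map (l : List β) (G : Finset β) :
    greedyRound F I (l.map j) (G.map j) =
      (greedyRound (fun S => F (S.map j)) (fun S => I (S.map j)) l G).map j := by
  have h : greedyChoice F I (l.map j) (G.map j) =
      ((greedyChoice (fun S => F (S.map j)) (fun S => I (S.map j)) l G).1,
        (greedyChoice (fun S => F (S.map j)) (fun S => I (S.map j)) l G).2.map j) := by
    rw [greedyChoice, greedyChoice, ← bestOf_map (Option.map j)
      (cand' := fun c => (∀ x ∈ c, x ∉ G.map j) ∧ I (insertOpt c (G.map j)))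
      (val' := fun c => F (insertOpt c (G.map j)))]
    · simp only [List.map_map]
      rfl
    · intro c
      rw [insertOpt_map]
      cases c <;> simp
    · intro c
      rw [insertOpt_map]
  rw [greedyRound, h, insertOpt_map, greedyRound]

lemma greedy_map (l : List β) (k : ℕ) :
    greedy F I (l.map j) k =
      (greedy (fun S => F (S.map j)) (fun S => I (S.map j)) l k).map j := by
  induction k with
  | zero => simp [greedy]
  | succ k ih =>
    simp only [greedy, Function.iterate_succ_apply'] at ih ⊢
    rw [ih, greedyRound_map]

/-- The image of a state under a renaming of the items. -/
def State.map (s : State β) : State α := ⟨s.acc.map j, s.sol.map j⟩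

/-- The parameters of the local search on renamed items. -/
def Params.comap (P : Params α) : Params β where
  value S := P.value (S.map j)
  indep S := P.indep (S.map j)
  level := P.level
  Q := P.Q
  k := P.k
  N := P.N

variable (P : Params α)

lemma swapChoice_map (s : State β) (e : β) :
    swapChoice P (s.map j) (j e) = (swapChoice (P.comap j) s e).map j := by
  have h : swapBest P (s.map j) (j e) =
      ((swapBest (P.comap j) s e).1, (swapBest (P.comap j) s e).2.map j) := by
    rw [swapBest, swapBest, ← bestOf_map (Option.map j)
      (cand' := fun c => (∀ x ∈ c, x ∈ insert (j e) (s.map j).sol) ∧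
        P.indep (eraseOpt c (insert (j e) (s.map j).sol)))
      (val' := fun c => P.value (eraseOpt c (insert (j e) (s.map j).sol)))]
    · simp only [List.map_map, List.map_cons, State.map, Params.comap]
      rfl
    · intro c
      rw [State.map, ← Finset.map_insert, eraseOpt_map]
      cases c with
      | none => simp [Params.comap]
      | some x =>
        simp [Params.comap, -Finset.map_insert]
        exact fun _ => by rw [eq_comm]
    · intro c
      rw [State.map, ← Finset.map_insert, eraseOpt_map]
      rfl
  rw [swapChoice, swapChoice, h]
  have hw : Worthwhile P (s.map j) ((swapBest (P.comap j) s e).1 - P.value (s.map j).sol) ↔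
    Worthwhile (P.comap j) s ((swapBest (P.comap j) s e).1 - (P.comap j).value s.sol) := Iff.rfl
  by_cases hc : Worthwhile (P.comap j) s ((swapBest (P.comap j) s e).1 - (P.comap j).value s.sol)
  · rw [if_pos hc, if_pos (hw.2 hc)]
  · rw [if_neg hc, if_neg (fun h => hc (hw.1 h))]; rfl

lemma swapped_map (s : State β) (e : β) :
    swapped P (s.map j) (j e) = (swapped (P.comap j) s e).map j := by
  rw [swapped, swapChoice_map, State.map, ← Finset.map_insert, eraseOpt_map]
  rfl

lemma arriveStep_map (s : State β) (e : β) :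
    arriveStep P (s.map j) (j e) = (arriveStep (P.comap j) s e).map j := by
  have h1 : (P.N ≤ (s.map j).acc.length ∨ j e ∈ (s.map j).acc) ↔
      ((P.comap j).N ≤ s.acc.length ∨ e ∈ s.acc) := by
    simp [State.map, Params.comap]
  have h2 : swapChoice P (s.map j) (j e) = some (j e) ↔ swapChoice (P.comap j) s e = some e := by
    rw [swapChoice_map, ← Option.map_some]
    exact (Option.map_injective j.injective).eq_iff
  rw [arriveStep, arriveStep, swapped_map]
  by_cases c1 : (P.comap j).N ≤ s.acc.length ∨ e ∈ s.acc
  · rw [if_pos c1, if_pos (h1.2 c1)]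
  · rw [if_neg c1, if_neg (fun h => c1 (h1.1 h))]
    by_cases c2 : swapChoice (P.comap j) s e = some e
    · rw [if_pos c2, if_pos (h2.2 c2)]
    · rw [if_neg c2, if_neg (fun h => c2 (h2.1 h))]
      simp [State.map]

lemma retryStep_map (s : State β) (r : ℕ) :
    retryStep P (s.map j) r = (retryStep (P.comap j) s r).map j := by
  have h : (s.map j).acc[r]? = s.acc[r]?.map j := by simp [State.map]
  rw [retryStep, retryStep, h]
  cases s.acc[r]? with
  | none => rfl
  | some e =>
    simp only [Option.map_some]
    rw [swapped_map]
    by_cases c : e ∈ s.sol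
    · rw [if_pos c, if_pos (by simpa [State.map] using c)]
    · rw [if_neg c, if_neg (by simpa [State.map] using c)]
      rfl

/-- The local search does not depend on the names of the items. -/
lemma expect_dynamics_map (φ : State α → ℝ) (l : List β) (s : State β) :
    (dynamics P).expect φ (l.map j) (s.map j) =
      (dynamics (P.comap j)).expect (fun s => φ (s.map j)) l s := by
  induction l generalizing s with
  | nil => rfl
  | cons e l ih =>
    simp only [List.map_cons, Dynamics.expect, Dynamics.next, dynamics] at ih ⊢
    rw [arriveStep_map, ih]
    simp only [retryStep_map, ih]
    rfl

end Renaming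

/-! ### Averaging over the order of the items behind the sample -/

section Averaging

variable {α : Type*} {U : Finset α}

/-- The permutation `π` of the last `m` of `s + m` positions. -/
def permLast {n s m : ℕ} (h : s + m = n) (π : Equiv.Perm (Fin m)) : Equiv.Perm (Fin n) :=
  (finSumFinEquiv.trans (finCongr h)).permCongr (Equiv.Perm.sumCongr 1 π)

lemma permLast_of_lt {n s m : ℕ} (h : s + m = n) (π : Equiv.Perm (Fin m)) {i : ℕ} (hi : i < s) :
    permLast h π ⟨i, by omega⟩ = ⟨i, by omega⟩ := by
  have : (⟨i, by omega⟩ : Fin n) = (finSumFinEquiv.trans (finCongr h)) (Sum.inl ⟨i, hi⟩) := by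
    ext; simp
  rw [this, permLast, Equiv.permCongr_apply, Equiv.symm_apply_apply]
  simp

lemma permLast_add {n s m : ℕ} (h : s + m = n) (π : Equiv.Perm (Fin m)) (i : Fin m) :
    permLast h π ⟨s + i.val, by omega⟩ = ⟨s + (π i).val, by omega⟩ := by
  have (i : Fin m) : (⟨s + i.val, by omega⟩ : Fin n) =
      (finSumFinEquiv.trans (finCongr h)) (Sum.inr i) := by
    ext; simp
  rw [this, this, permLast, Equiv.permCongr_apply, Equiv.symm_apply_apply]
  simp

/-- The items in the order of their arrival. -/
def arrivals (σ : Order U) : List α := List.ofFn fun i => (σ i : α)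

/-- The item that arrives `i` rounds after the first `s` ones. -/
def later {s m : ℕ} (h : s + m = U.card) (σ : Order U) (i : Fin m) : α :=
  σ ⟨s + i.val, by omega⟩

lemma take_arrivals_permLast {s m : ℕ} (h : s + m = U.card) (σ : Order U)
    (π : Equiv.Perm (Fin m)) :
    (arrivals ((permLast h π).trans σ)).take s = (arrivals σ).take s := by
  refine List.ext_getElem (by simp [arrivals]) fun i h1 h2 => ?_
  have hi : i < s := by simp at h1; omega
  simp [arrivals, permLast_of_lt h π hi]

lemma drop_arrivals_permLast {s m : ℕ} (h : s + m = U.card) (σ : Order U)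
    (π : Equiv.Perm (Fin m)) :
    (arrivals ((permLast h π).trans σ)).drop s = arrange (later h σ) π := by
  refine List.ext_getElem (by simp [arrivals, arrange]; omega) fun i h1 h2 => ?_
  have hi : i < m := by simpa [arrange] using h2
  have := permLast_add h π ⟨i, hi⟩
  simp only at this
  simp [arrivals, arrange, later, this]

lemma mem_take_arrivals {σ : Order U} {s : ℕ} {x : α} :
    x ∈ (arrivals σ).take s ↔ x ∈ sample σ s := by
  simp only [sample, items, firstPositions, Finset.mem_map, Finset.mem_filter, Finset.mem_univ,
    true_and, List.mem_take_iff_getElem, arrivals, List.getElem_ofFn, List.length_ofFn]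
  constructor
  · rintro ⟨i, hi, rfl⟩
    exact ⟨⟨i, by omega⟩, by simp; omega, rfl⟩
  · rintro ⟨i, hi, rfl⟩
    exact ⟨i.val, by have := i.2; omega, rfl⟩

lemma later_injective {s m : ℕ} (h : s + m = U.card) (σ : Order U) :
    Function.Injective (later h σ) := by
  intro i i' hi
  have := σ.injective (Subtype.ext hi)
  simp only [Fin.mk.injEq] at this
  ext; omega

lemma mem_later [DecidableEq α] {s m : ℕ} (h : s + m = U.card) (σ : Order U) (x : α) :
    x ∈ U \ sample σ s ↔ ∃ i, later h σ i = x := by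
  simp only [Finset.mem_sdiff, sample, items, firstPositions, Finset.mem_map, Finset.mem_filter,
    Finset.mem_univ, true_and, not_exists, not_and, later]
  constructor
  · rintro ⟨hx, hs⟩
    have h1 : s ≤ (σ.symm ⟨x, hx⟩).val := by
      by_contra hlt
      exact hs _ (not_le.1 hlt) (by simp)
    refine ⟨⟨(σ.symm ⟨x, hx⟩).val - s, by have := (σ.symm ⟨x, hx⟩).2; omega⟩, ?_⟩
    have : (⟨s + ((σ.symm ⟨x, hx⟩).val - s), by have := (σ.symm ⟨x, hx⟩).2; omega⟩ : Fin U.card) =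
        σ.symm ⟨x, hx⟩ := by ext; simp only; omega
    rw [this, Equiv.apply_symm_apply]
  · rintro ⟨i, rfl⟩
    refine ⟨(σ _).2, fun j hj hji => ?_⟩
    have := σ.injective (Subtype.ext hji)
    rw [this] at hj
    simp only at hj
    omega

/-- A sum over all orders is a sum of averages over the orders of the last items. -/
lemma sum_order_eq_sum_average [DecidableEq α] {s m : ℕ} (h : s + m = U.card)
    (H : List α → List α → ℝ) :
    ∑ σ : Order U, H ((arrivals σ).take s) ((arrivals σ).drop s) =
      ∑ σ : Order U, (∑ π : Equiv.Perm (Fin m), H ((arrivals σ).take s) (arrange (later h σ) π)) /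
        m.factorial := by
  have hperm : ∀ π : Equiv.Perm (Fin m),
      ∑ σ : Order U, H ((arrivals σ).take s) (arrange (later h σ) π) =
        ∑ σ : Order U, H ((arrivals σ).take s) ((arrivals σ).drop s) := by
    intro π
    refine Fintype.sum_equiv ⟨fun σ => (permLast h π).trans σ, fun σ => (permLast h π).symm.trans σ,
      fun σ => by ext; simp, fun σ => by ext; simp⟩ _ _ fun σ => ?_
    simp only [Equiv.coe_fn_mk]
    rw [take_arrivals_permLast, drop_arrivals_permLast]
  rw [← Finset.sum_div, Finset.sum_comm, Finset.sum_congr rfl fun π _ => hperm π, Finset.sum_const,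
    Finset.card_univ, Fintype.card_perm, Fintype.card_fin, nsmul_eq_mul,
    mul_div_cancel_left₀ _ (by positivity)]

/-- The embedding of the positions into the items. -/
def itemAt (σ : Order U) : Fin U.card ↪ α := σ.toEmbedding.trans (Function.Embedding.subtype _)

lemma map_itemAt (σ : Order U) : (List.finRange U.card).map (itemAt σ) = arrivals σ := by
  rw [arrivals, List.ofFn_eq_map]
  rfl

end Averaging

/-! ### The competitive ratio -/

section Ratio

variable {α : Type*} [DecidableEq α] {M : Matroid α} {U : Finset α} {f : Finset α → ℝ} {k Q N : ℕ}

/-- The expected value of the solution of the local search when the items of `l'` arrive after those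
of the sample `l`. -/
noncomputable def searchValue (M : Matroid α) (f : Finset α → ℝ) (k Q N : ℕ) (l l' : List α) : ℝ :=
  (dynamics ⟨f, fun S => M.Indep (S : Set α), f (greedy f (fun S => M.Indep (S : Set α)) l k), Q, k,
    N⟩).expect (fun st => f st.sol) l' ⟨[], ∅⟩

/-- The local search on positions that the program simulates is the local search on items. -/
lemma expect_searchParams (σ : Order U) (Q N₀ k s : ℕ) (hs : s = sampleSize U.card Q) :
    (dynamics (searchParams (oracle M f σ) Q N₀ k)).expect (fun st => (oracle M f σ).value st.sol)
      ((List.finRange U.card).drop s) ⟨[], ∅⟩ =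
      searchValue M f k Q (N₀ * k) ((arrivals σ).take s) ((arrivals σ).drop s) := by
  rw [searchValue, ← map_itemAt, ← List.map_take, ← List.map_drop, greedy_map]
  have := expect_dynamics_map (itemAt σ) ⟨f, fun S => M.Indep (S : Set α),
    f ((greedy (fun S => f (S.map (itemAt σ))) (fun S => M.Indep (S.map (itemAt σ) : Set α))
      ((List.finRange U.card).take s) k).map (itemAt σ)), Q, k, N₀ * k⟩ (fun st => f st.sol)
      ((List.finRange U.card).drop s) ⟨[], ∅⟩
  refine Eq.trans ?_ this.symm
  subst hs
  rfl

lemma Dynamics.expect_nonneg {β τ : Type*} (D : Dynamics β τ) (hQ : 0 < D.Q) {φ : τ → ℝ}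
    (hφ : ∀ s, 0 ≤ φ s) (l : List β) (s : τ) : 0 ≤ D.expect φ l s := by
  induction l generalizing s with
  | nil => exact hφ s
  | cons e l ih =>
    have h1 : (1 : ℝ) / D.Q ≤ 1 := by
      rw [div_le_one (by exact_mod_cast hQ)]; exact_mod_cast hQ
    exact add_nonneg (div_nonneg (div_nonneg (Finset.sum_nonneg fun r _ => ih _)
      (Nat.cast_nonneg _)) (Nat.cast_nonneg _)) (mul_nonneg (sub_nonneg.2 h1) (ih _))

omit [DecidableEq α] in
lemma items_subset (σ : Order U) (S : Finset (Fin U.card)) : items σ S ⊆ U := by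
  intro a ha
  simp only [items, Finset.mem_map] at ha
  obtain ⟨i, -, rfl⟩ := ha
  exact (σ i).2

lemma searchValue_nonneg (hf : IsMonotoneSubmodularOn U f) (h0 : 0 ≤ f ∅) (hQ : 0 < Q) (N₀ : ℕ)
    (σ : Order U) (s : ℕ) (hs : s = sampleSize U.card Q) :
    0 ≤ searchValue M f k Q (N₀ * k) ((arrivals σ).take s) ((arrivals σ).drop s) := by
  -- On positions every state has a nonnegative value, whereas `f` may be negative outside `U`.
  rw [← expect_searchParams σ Q N₀ k s hs]
  exact Dynamics.expect_nonneg _ hQ (fun st => h0.trans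
    (hf.monotone _ _ (Finset.empty_subset _) (items_subset σ _))) _ _

/-- The local search after a sample that is calibrated. -/
lemma searchValue_average_ge (hf : IsMonotoneSubmodularOn U f) (h0 : 0 ≤ f ∅) (hQ : 0 < Q)
    (hk : 0 < k) (hrank : M.eRank = k) {s m : ℕ} (h : s + m = U.card) (hm : 2 ≤ m) {T : Finset α}
    {W : α → ℝ} {γ : ℝ} (hW : ∀ x ∈ T, 0 ≤ W x) (hγ : 0 < γ)
    (hN : (T.card : ℝ) * (1 + Q * k / γ) < N) {σ : Order U}
    (hcal : ∀ v, f ∅ ≤ v → (∀ R ⊆ sample σ s, M.Indep (R : Set α) → f R ≤ 2 * v) →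
      Calibrated M f (U \ sample σ s) T W γ v)
    {B : ℝ} (hfB : ∀ S ⊆ U, M.Indep (S : Set α) → f S ≤ B)
    {O : Finset α} (hO : O ⊆ U) (hOI : M.Indep (O : Set α)) :
    1 / 2 * (1 - Real.exp (-2)) * (f (O \ sample σ s) - 2 * B / Q) - (Q * N + 3) * B / m ≤
      (∑ π, searchValue M f k Q N ((arrivals σ).take s) (arrange (later h σ) π)) / m.factorial := by
  have hQ' : (0 : ℝ) < Q := by exact_mod_cast hQ
  set l := (arrivals σ).take s with hl
  set G := greedy f (fun S => M.Indep (S : Set α)) l k with hG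
  have hlU : ∀ x ∈ l, x ∈ U := fun x hx => sample_subset σ s (mem_take_arrivals.1 hx)
  obtain ⟨g1, g2, g3⟩ := greedy_spec hf h0 hrank hlU hG
  have hGU : G ⊆ U := fun x hx => hlU x (g1 x hx)
  have hcal' := hcal (f G) (hf.monotone _ _ (Finset.empty_subset _) hGU) fun R hR hRI =>
    g3 R (fun x hx => mem_take_arrivals.2 (hR hx)) hRI
  obtain ⟨ψ, w, hw, himp⟩ := dynamics_improves hf h0 hQ hk hrank Finset.sdiff_subset hW hγ rfl hN
    hcal' (hfB G hGU g2) hfB rfl (O := O \ sample σ s)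
    (Finset.sdiff_subset_sdiff hO subset_rfl)
    (hOI.subset (by exact_mod_cast Finset.sdiff_subset))
  have havg := himp.le_average (m := m) (y := later h σ)
    (Invariant.initial h0 hW (by positivity)) hm (later_injective h σ)
    (fun e => mem_later h σ e)
  simp only [dynamics] at havg
  refine le_trans ?_ havg
  have hκ : 0 ≤ 1 / 2 * (1 - Real.exp (-2)) := by
    have : Real.exp (-2) ≤ 1 := Real.exp_le_one_iff.2 (by norm_num)
    linarith
  have h1 : (∑ o ∈ O \ sample σ s, w o) / Q ≤ B / Q := div_le_div_of_nonneg_right hw hQ'.le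
  have h2 : f (O \ sample σ s) - 2 * B / Q ≤
      f (O \ sample σ s) - B / Q - (∑ o ∈ O \ sample σ s, w o) / Q := by
    have : 2 * B / Q = B / Q + B / Q := by ring
    linarith
  have := mul_le_mul_of_nonneg_left h2 hκ
  linarith

end Ratio

section Total

variable {α : Type*} [DecidableEq α] {M : Matroid α} {U : Finset α} {f : Finset α → ℝ} {k Q : ℕ}

lemma sampleSize_bounds {n : ℕ} (hQ : 4 ≤ Q) (hn : Q ≤ n) :
    0 < sampleSize n Q ∧ sampleSize n Q ≤ n ∧ n ≤ 2 * (n - sampleSize n Q) ∧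
      (1 / Q : ℝ) ≤ sampleSize n Q / n ∧ (sampleSize n Q / n : ℝ) ≤ 2 / Q := by
  have hQ0 : 0 < Q := by omega
  set s := sampleSize n Q with hs
  have h1 : n ≤ Q * s := by
    by_contra h
    exact lt_irrefl _ ((lt_sampleSize hQ0).2 (not_le.1 h))
  have hs0 : 0 < s := (lt_sampleSize hQ0).2 (by omega)
  have h2 : Q * (s - 1) < n := (lt_sampleSize hQ0).1 (by omega)
  have h3 : Q * s ≤ 2 * n := by
    obtain ⟨t, ht⟩ : ∃ t, s = t + 1 := ⟨s - 1, by omega⟩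
    rw [ht] at h2 ⊢
    rw [Nat.add_sub_cancel] at h2
    rw [mul_add]; omega
  have h4 : 4 * s ≤ Q * s := Nat.mul_le_mul_right _ hQ
  have hn' : (0 : ℝ) < n := by exact_mod_cast (show 0 < n by omega)
  have hQ' : (0 : ℝ) < Q := by exact_mod_cast hQ0
  refine ⟨hs0, sampleSize_le hQ0, by omega, ?_, ?_⟩
  · rw [div_le_div_iff₀ hQ' hn', one_mul, mul_comm]; exact_mod_cast h1
  · rw [div_le_div_iff₀ hn' hQ', mul_comm]; exact_mod_cast h3

/-- There are four errors of at most `B / Q`, where `B` is the optimum. They are due to the elements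
of an optimal set in the sample, to the samples that are not calibrated, to the ignored items and
the thresholds of the swaps, and to the delays of the retries. -/
lemma sum_searchValue_ge (hf : IsMonotoneSubmodularOn U f) (h0 : 0 ≤ f ∅) (hk : 0 < k)
    (hrank : M.eRank = k) (hQ : 4 ≤ Q) (hn : 410 * Q ^ 9 * k < U.card) {s : ℕ}
    (hs : s = sampleSize U.card Q) :
    Fintype.card (Order U) *
        ((1 / 2 * (1 - Real.exp (-2)) - 4 / Q) * bestValue M f U) ≤
      ∑ σ : Order U, searchValue M f k Q (200 * Q ^ 7 * k) ((arrivals σ).take s)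
        ((arrivals σ).drop s) := by
  set B := bestValue M f U with hB
  set κ := 1 / 2 * (1 - Real.exp (-2)) with hκ
  have hκ0 : 0 ≤ κ := by
    have : Real.exp (-2) ≤ 1 := Real.exp_le_one_iff.2 (by norm_num)
    rw [hκ]; linarith
  have hκ1 : κ ≤ 1 / 2 := by
    have := Real.exp_pos (-2)
    rw [hκ]; linarith
  have hQ0 : 0 < Q := by omega
  have hQ' : (0 : ℝ) < Q := by exact_mod_cast hQ0
  have hQ1 : (1 : ℝ) ≤ Q := by exact_mod_cast hQ0
  have hk1 : (1 : ℝ) ≤ k := by exact_mod_cast hk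
  have hQn : Q ≤ U.card := by
    have h1 : Q ≤ Q ^ 9 := Nat.le_self_pow (by norm_num) Q
    have h2 : Q ^ 9 ≤ Q ^ 9 * k := Nat.le_mul_of_pos_right _ hk
    have : 410 * Q ^ 9 * k = 410 * (Q ^ 9 * k) := by ring
    omega
  obtain ⟨hs0, hsn, hsm, hc1, hc2⟩ := sampleSize_bounds hQ hQn
  rw [← hs] at hs0 hsn hsm hc1 hc2
  set m := U.card - s with hm
  have hU : 0 < U.card := by omega
  have hfB : ∀ S ⊆ U, M.Indep (S : Set α) → f S ≤ B := fun S hS hI => le_bestValue hS hI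
  obtain ⟨O, hOU, hOI, hOB⟩ := exists_eq_bestValue M f U
  rw [← hB] at hOB
  have hB0 : 0 ≤ B := h0.trans (hfB ∅ (Finset.empty_subset _) (by simp))
  -- With these numbers `4 / L` and `4 * η * L`, the two terms of the exceptional orders, are
  -- both `1 / Q ^ 2`.
  set L : ℕ := 4 * Q ^ 2 with hL
  set η : ℝ := 1 / (16 * Q ^ 4) with hη
  set γ : ℝ := 1 / (48 * Q ^ 4) with hγ
  have hγ0 : 0 < γ := by positivity
  have hη1 : η ≤ 1 := by
    rw [hη, div_le_one (by positivity)]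
    have : (1 : ℝ) ≤ (Q : ℝ) ^ 4 := one_le_pow₀ hQ1
    linarith
  have hγs : 4 * γ ≤ s / U.card := by
    refine le_trans ?_ hc1
    rw [hγ, mul_one_div, div_le_div_iff₀ (by positivity) hQ']
    have : (Q : ℝ) ≤ (Q : ℝ) ^ 4 := le_self_pow₀ hQ1 (by norm_num)
    linarith
  obtain ⟨T, W, bad, hT, hW, hbad, hcal⟩ := exists_calibrated (M := M) hf h0 hs0 hsn
    (L := L) (by positivity) (η := η) (γ := γ) (by positivity) hη1
    (by rw [hη, hγ]; apply le_of_eq; field_simp; norm_num) hγs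
  set c : ℝ := s / U.card with hc
  -- At most a fraction `2 / Q` of the orders is exceptional.
  have hbad' : (bad.card : ℝ) ≤ 2 / Q * Fintype.card (Order U) := by
    have e1 : (4 / L + L * (4 * η) : ℝ) = 2 / Q * (1 / Q) := by
      rw [hL, hη]; push_cast; field_simp; norm_num
    rw [e1] at hbad
    have h1 : (bad.card : ℝ) * (1 / Q) ≤ bad.card * c :=
      mul_le_mul_of_nonneg_left hc1 (Nat.cast_nonneg _)
    have h2 : (bad.card : ℝ) * (1 / Q) ≤ (2 / Q * Fintype.card (Order U)) * (1 / Q) := by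
      linarith
    exact le_of_mul_le_mul_right h2 (by positivity)
  -- The number of items that may be accepted is not attained.
  have hN : (T.card : ℝ) * (1 + Q * k / γ) < (200 * Q ^ 7 * k : ℕ) := by
    have h1 : (T.card : ℝ) ≤ 4 * Q ^ 2 := by
      have : (T.card : ℝ) ≤ (L : ℕ) := by exact_mod_cast hT
      rw [hL] at this; push_cast at this; exact this
    have h2 : Q * k / γ = 48 * Q ^ 5 * (k : ℝ) := by rw [hγ]; field_simp
    have h3 : (4 * Q ^ 2 : ℝ) < 8 * Q ^ 7 * k := by
      have a1 : (Q ^ 2 : ℝ) ≤ Q ^ 7 := pow_le_pow_right₀ hQ1 (by norm_num)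
      have a2 : (Q ^ 7 : ℝ) ≤ Q ^ 7 * k := le_mul_of_one_le_right (by positivity) hk1
      have a3 : (0 : ℝ) < Q ^ 2 := by positivity
      linarith
    rw [h2]; push_cast
    calc (T.card : ℝ) * (1 + 48 * Q ^ 5 * k) ≤ 4 * Q ^ 2 * (1 + 48 * Q ^ 5 * k) :=
          mul_le_mul_of_nonneg_right h1 (by positivity)
      _ = 4 * Q ^ 2 + 192 * Q ^ 7 * k := by ring
      _ < 200 * Q ^ 7 * k := by linarith
  have hm' : (0 : ℝ) < m := by
    have : 0 < m := by omega
    exact_mod_cast this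
  have hlow : (Q * (200 * Q ^ 7 * k : ℕ) + 3) * B / m ≤ B / Q := by
    rw [div_le_div_iff₀ hm' hQ']
    have h1 : ((410 * Q ^ 9 * k : ℕ) : ℝ) ≤ 2 * m := by
      have : 410 * Q ^ 9 * k ≤ 2 * m := by omega
      exact_mod_cast this
    push_cast at h1 ⊢
    have h2 : (6 * Q : ℝ) ≤ 10 * Q ^ 9 * k := by
      have a1 : (Q : ℝ) ≤ Q ^ 9 := le_self_pow₀ hQ1 (by norm_num)
      have a2 : (Q ^ 9 : ℝ) ≤ Q ^ 9 * k := le_mul_of_one_le_right (by positivity) hk1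
      linarith
    have h3 : (Q * (200 * Q ^ 7 * k) + 3) * (Q : ℝ) ≤ m := by
      have : (Q * (200 * Q ^ 7 * k) + 3) * (Q : ℝ) = 200 * Q ^ 9 * k + 3 * Q := by ring
      linarith
    have := mul_le_mul_of_nonneg_left h3 hB0
    linarith
  have hm2 : 2 ≤ m := by
    have h1 : 1 ≤ Q ^ 9 * k := Nat.mul_pos (by positivity) hk
    have : 410 * Q ^ 9 * k = 410 * (Q ^ 9 * k) := by ring
    omega
  have hsm' : s + m = U.card := by omega
  set a : Order U → ℝ := fun σ => (∑ π, searchValue M f k Q (200 * Q ^ 7 * k)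
    ((arrivals σ).take s) (arrange (later hsm' σ) π)) / m.factorial with ha
  have hgood : ∀ σ ∉ bad, κ * (f (O \ sample σ s) - 2 * B / Q) - B / Q ≤ a σ := fun σ hσ =>
    (sub_le_sub_left hlow _).trans (searchValue_average_ge hf h0 hQ0 hk hrank hsm' hm2 hW hγ0 hN
      (hcal σ hσ) hfB hOU hOI)
  have hnonneg : ∀ σ, 0 ≤ a σ := by
    intro σ
    refine div_nonneg (Finset.sum_nonneg fun π _ => ?_) (Nat.cast_nonneg _)
    have := searchValue_nonneg (M := M) (k := k) hf h0 hQ0 (200 * Q ^ 7)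
      ((permLast hsm' π).trans σ) s hs
    rwa [take_arrivals_permLast, drop_arrivals_permLast] at this
  have hsub : ∀ σ : Order U, f (O \ sample σ s) ≤ B := fun σ =>
    hfB _ (Finset.sdiff_subset.trans hOU) (hOI.subset (by exact_mod_cast Finset.sdiff_subset))
  -- For exceptional orders the bound holds after subtraction of the maximal possible value.
  have hall : ∀ σ, κ * (f (O \ sample σ s) - 2 * B / Q) - B / Q -
      (if σ ∈ bad then κ * B else 0) ≤ a σ := by
    intro σ
    split_ifs with hσ
    · refine le_trans ?_ (hnonneg σ)
      have h1 := mul_le_mul_of_nonneg_left (hsub σ) hκ0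
      have h2 : 0 ≤ κ * (2 * B / Q) := by positivity
      have h3 : 0 ≤ B / Q := by positivity
      linarith
    · rw [sub_zero]; exact hgood σ hσ
  have hsum := Finset.sum_le_sum fun σ (_ : σ ∈ Finset.univ) => hall σ
  have hO := sum_sdiff_sample_ge hf h0 hOU hOI hsn hU
  rw [sum_order_eq_sum_average hsm']
  refine le_trans ?_ hsum
  rw [Finset.sum_sub_distrib, Finset.sum_sub_distrib, ← Finset.mul_sum, Finset.sum_sub_distrib,
    Finset.sum_ite_mem, Finset.univ_inter]
  simp only [Finset.sum_const, Finset.card_univ, nsmul_eq_mul]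
  rw [hOB] at hO
  set X : ℝ := (Fintype.card (Order U) : ℝ) with hX
  have hX0 : 0 ≤ X := Nat.cast_nonneg _
  have h1 := mul_le_mul_of_nonneg_left hO hκ0
  have h2 : κ * (X * (c * B)) ≤ 1 / 2 * (X * (2 / Q * B)) :=
    mul_le_mul hκ1 (mul_le_mul_of_nonneg_left (mul_le_mul_of_nonneg_right hc2 hB0) hX0)
      (by positivity) (by norm_num)
  have h3 : κ * (X * (2 * B / Q)) ≤ 1 / 2 * (X * (2 * B / Q)) :=
    mul_le_mul_of_nonneg_right hκ1 (by positivity)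
  have h4 : bad.card * (κ * B) ≤ 2 / Q * X * (1 / 2 * B) :=
    mul_le_mul hbad' (mul_le_mul_of_nonneg_right hκ1 hB0) (by positivity) (by positivity)
  have e : X * ((κ - 4 / Q) * B) = κ * (X * B) - 1 / 2 * (X * (2 / Q * B)) -
      1 / 2 * (X * (2 * B / Q)) - X * (B / Q) - 2 / Q * X * (1 / 2 * B) := by
    ring
  rw [e]
  have e1 : κ * (X * ((1 - c) * B)) = κ * (X * B) - κ * (X * (c * B)) := by ring
  rw [e1] at h1
  rw [mul_sub]
  linarith

end Total

section Final

variable {α : Type*} [DecidableEq α] {M : Matroid α} {U : Finset α} {f : Finset α → ℝ} {k Q : ℕ}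

omit [DecidableEq α] in
lemma items_mono (σ : Order U) {S T : Finset (Fin U.card)} (h : S ⊆ T) : items σ S ⊆ items σ T :=
  Finset.map_subset_map.2 h

/-- What the algorithm guarantees in expectation and in every run, for any evaluation `g` of the
output that is at least the value of the solution. -/
lemma mainProgram_spec (hf : IsMonotoneSubmodularOn U f) (h0 : 0 ≤ f ∅) (hU : U.Nonempty)
    (hk : 0 < k) (hrank : M.eRank = k) (hQ : 4 ≤ Q) {g : Finset α → Finset α → ℝ}
    (hg : ∀ A ⊆ U, ∀ B ⊆ A, M.Indep (B : Set α) → f B ≤ g A B) :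
    (∀ σ : Order U, ∀ c ∈ (run M f (mainProgram Q (200 * Q ^ 7) (410 * Q ^ 9)) k
      ((200 * Q ^ 7 * 12 + 100) * (U.card * k)) σ).support,
        c.Halted ∧ c.output.1.card ≤ 410 * Q ^ 9 * k ∧ c.output.2 ⊆ c.output.1 ∧
          M.Indep (items σ c.output.2 : Set α)) ∧
      (1 / 2 * (1 - Real.exp (-2)) - 4 / Q) * bestValue M f U ≤
        expectation M f U (mainProgram Q (200 * Q ^ 7) (410 * Q ^ 9)) k
          ((200 * Q ^ 7 * 12 + 100) * (U.card * k)) g := by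
  have hQ0 : 0 < Q := by omega
  have hn : 0 < U.card := hU.card_pos
  set G : Finset α → Prop := fun S => M.Indep (S : Set α) with hG
  have hgreedy : ∀ σ : Order U, items σ (greedy (oracle M f σ).value (oracle M f σ).indep
      (List.finRange U.card) k) = greedy f G (arrivals σ) k := by
    intro σ
    rw [← map_itemAt, greedy_map]
    rfl
  have hspec : ∀ σ : Order U, (∀ x ∈ greedy f G (arrivals σ) k, x ∈ U) ∧
      M.Indep (greedy f G (arrivals σ) k : Set α) ∧
      bestValue M f U ≤ 2 * f (greedy f G (arrivals σ) k) := by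
    intro σ
    have hmem : ∀ x, x ∈ arrivals σ ↔ x ∈ U := fun x => by
      rw [arrivals, List.mem_ofFn]
      exact ⟨fun ⟨i, hi⟩ => hi ▸ (σ i).2, fun hx => ⟨σ.symm ⟨x, hx⟩, by simp⟩⟩
    obtain ⟨g1, g2, g3⟩ := greedy_spec hf h0 hrank (fun x hx => (hmem x).1 hx)
      (rfl : greedy f G (arrivals σ) k = _)
    obtain ⟨S, hS, hSI, hSB⟩ := exists_eq_bestValue M f U
    exact ⟨fun x hx => (hmem x).1 (g1 x hx), g2, hSB ▸ g3 S (fun x hx => (hmem x).2 (hS hx)) hSI⟩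
  have hNK : 200 * Q ^ 7 * k ≤ 410 * Q ^ 9 * k :=
    Nat.mul_le_mul_right _ (Nat.mul_le_mul (by norm_num) (Nat.pow_le_pow_right hQ0 (by norm_num)))
  -- The number of accepted items is at most `200 * Q ^ 7 * k`, but short instances are shortlisted
  -- as a whole.
  have hguar := fun σ : Order U => guarantee_mainProgram (O := oracle M f σ)
    (φ := fun o => g (items σ o.1) (items σ o.2))
    (Post := fun o => o.1.card ≤ 410 * Q ^ 9 * k ∧ o.2 ⊆ o.1 ∧ M.Indep (items σ o.2 : Set α))
    (N₀ := 200 * Q ^ 7) (K := 410 * Q ^ 9) hn hk hQ0 (by positivity) (by simp [oracle, items])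
    (fun A B hBA hB => hg _ (items_subset σ A) _ (items_mono σ hBA) hB)
    (fun A B hA hBA hB => ⟨hA.trans hNK, hBA, hB⟩)
    (fun hnK => ⟨by simpa using hnK, Finset.subset_univ _, by
      rw [hgreedy]; exact (hspec σ).2.1⟩)
  refine ⟨fun σ c hc => (hguar σ _ le_rfl).1 c hc, ?_⟩
  have hcard : 0 < Fintype.card (Order U) := Fintype.card_pos_iff.2 ⟨U.equivFin.symm⟩
  have hB0 : 0 ≤ bestValue M f U :=
    h0.trans (le_bestValue (Finset.empty_subset _) (by simp))
  rw [expectation, le_div_iff₀ (by exact_mod_cast hcard), mul_comm]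
  refine le_trans ?_ (Finset.sum_le_sum fun σ _ => (hguar σ _ le_rfl).2)
  by_cases h : 410 * Q ^ 9 * k < U.card
  · simp only [if_pos h]
    refine (sum_searchValue_ge hf h0 hk hrank hQ h rfl).trans (le_of_eq ?_)
    exact Finset.sum_congr rfl fun σ _ => (expect_searchParams σ Q (200 * Q ^ 7) k _ rfl).symm
  · simp only [if_neg h]
    have hterm : ∀ σ : Order U, (1 / 2 * (1 - Real.exp (-2)) - 4 / Q) * bestValue M f U ≤
        g (items σ Finset.univ) (items σ (greedy (oracle M f σ).value (oracle M f σ).indep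
          (List.finRange U.card) k)) := by
      intro σ
      have h1 := hg _ (items_subset σ Finset.univ) _ (items_mono σ (Finset.subset_univ _))
        (by rw [hgreedy]; exact (hspec σ).2.1)
      rw [hgreedy] at h1 ⊢
      refine le_trans ?_ h1
      have h2 := (hspec σ).2.2
      have h3 : 1 / 2 * (1 - Real.exp (-2)) - 4 / Q ≤ (1 / 2 : ℝ) := by
        have := Real.exp_pos (-2)
        have : (0 : ℝ) ≤ 4 / Q := by positivity
        linarith
      have := mul_le_mul_of_nonneg_right h3 hB0
      linarith
    refine le_trans (le_of_eq ?_) (Finset.sum_le_sum fun σ _ => hterm σ)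
    rw [Finset.sum_const, Finset.card_univ, nsmul_eq_mul]

end Final

end Shortlist

theorem mainTheorem1 :
    ∃ (p : Polynomial ℝ) (C₀ : ℝ), ∀ ε : ℝ, 0 < ε →
      ∃ (P : Shortlist.Program) (C : ℕ) (D : ℝ),
        ∀ (α : Type*) [DecidableEq α] (M : Matroid α) (U : Finset α) (f : Finset α → ℝ) (k : ℕ),
          (U : Set α) ⊆ M.E → U.Nonempty → M.eRank = k → 1 ≤ k →
          Shortlist.IsMonotoneSubmodularOn U f → 0 ≤ f ∅ →
          (∀ σ : Shortlist.Order U,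
            ∀ c ∈ (Shortlist.run M f P k (C * (U.card * k)) σ).support,
              c.Halted ∧
              (c.output.1.card : ℝ) ≤ C₀ * (2 : ℝ) ^ (p.eval (1 / ε)) * k ∧
              c.output.2 ⊆ c.output.1 ∧
              M.Indep (Shortlist.items σ c.output.2 : Set α)) ∧
          (1 / 2 * (1 - 1 / Real.exp 1 ^ 2 - ε - D / k)) * Shortlist.bestValue M f U ≤
            Shortlist.expectation M f U P k (C * (U.card * k))
              (fun A _ => Shortlist.bestValue M f A) ∧
          (1 / 2 * (1 - 1 / Real.exp 1 ^ 2 - ε - D / k)) * Shortlist.bestValue M f U ≤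
            Shortlist.expectation M f U P k (C * (U.card * k)) (fun _ B => f B) := by
  refine ⟨Polynomial.C 72 * Polynomial.X + Polynomial.C 45, 410, fun ε hε => ?_⟩
  -- The ratio is `(1 - exp (-2)) / 2 - 4 / Q`, so that `8 / ε ≤ Q` suffices. For the shortlist,
  -- `Q ^ 9 ≤ 2 ^ (9 * Q)` and `9 * Q ≤ 72 / ε + 45`.
  set Q := ⌈8 / ε⌉₊ + 4 with hQ
  have hQ4 : 4 ≤ Q := by omega
  have hQ0 : (0 : ℝ) < Q := by exact_mod_cast (by omega : 0 < Q)
  have hQε : 8 / ε ≤ Q := by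
    rw [hQ]; push_cast
    linarith [Nat.le_ceil (8 / ε)]
  have hQε' : (Q : ℝ) ≤ 8 / ε + 5 := by
    rw [hQ]; push_cast
    linarith [Nat.ceil_lt_add_one (show 0 ≤ 8 / ε by positivity)]
  refine ⟨Shortlist.mainProgram Q (200 * Q ^ 7) (410 * Q ^ 9), 200 * Q ^ 7 * 12 + 100, 0, ?_⟩
  intro α _ M U f k _ hU hk hk1 hf h0
  have hB0 : 0 ≤ Shortlist.bestValue M f U :=
    h0.trans (Shortlist.le_bestValue (Finset.empty_subset _) (by simp))
  have hratio : (1 / 2 * (1 - 1 / Real.exp 1 ^ 2 - ε - 0 / k)) * Shortlist.bestValue M f U ≤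
      (1 / 2 * (1 - Real.exp (-2)) - 4 / Q) * Shortlist.bestValue M f U := by
    refine mul_le_mul_of_nonneg_right ?_ hB0
    have h1 : 1 / Real.exp 1 ^ 2 = Real.exp (-2) := by
      rw [← Real.exp_nat_mul, Real.exp_neg, one_div]; norm_num
    have h2 : 4 / (Q : ℝ) ≤ ε / 2 := by
      rw [div_le_iff₀ hε] at hQε
      rw [div_le_div_iff₀ hQ0 (by norm_num)]
      linarith
    rw [h1, zero_div]
    linarith
  have hlist : ((410 * Q ^ 9 : ℕ) : ℝ) ≤
      410 * (2 : ℝ) ^ ((Polynomial.C 72 * Polynomial.X + Polynomial.C 45 : Polynomial ℝ).eval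
        (1 / ε)) := by
    push_cast
    refine mul_le_mul_of_nonneg_left ?_ (by norm_num)
    have h1 : (Q : ℝ) ≤ (2 : ℝ) ^ Q := by exact_mod_cast Nat.lt_two_pow_self.le
    calc (Q : ℝ) ^ 9 ≤ ((2 : ℝ) ^ Q) ^ 9 := pow_le_pow_left₀ hQ0.le h1 9
      _ = (2 : ℝ) ^ ((Q * 9 : ℕ) : ℝ) := by rw [Real.rpow_natCast, pow_mul]
      _ ≤ _ := by
        refine Real.rpow_le_rpow_of_exponent_le (by norm_num) ?_
        simp only [Polynomial.eval_add, Polynomial.eval_mul, Polynomial.eval_C, Polynomial.eval_X]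
        push_cast
        have : 72 * (1 / ε) = 9 * (8 / ε) := by ring
        linarith
  obtain ⟨h1, h2⟩ := Shortlist.mainProgram_spec hf h0 hU hk1 hk hQ4
    (g := fun A _ => Shortlist.bestValue M f A) fun A _ B hBA hB => Shortlist.le_bestValue hBA hB
  obtain ⟨-, h3⟩ := Shortlist.mainProgram_spec hf h0 hU hk1 hk hQ4
    (g := fun _ B => f B) fun A _ B _ _ => le_rfl
  refine ⟨fun σ c hc => ?_, hratio.trans h2, hratio.trans h3⟩
  obtain ⟨e1, e2, e3, e4⟩ := h1 σ c hc
  refine ⟨e1, ?_, e3, e4⟩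
  have e5 : (c.output.1.card : ℝ) ≤ ((410 * Q ^ 9 : ℕ) : ℝ) * k := by exact_mod_cast e2
  exact e5.trans (mul_le_mul_of_nonneg_right hlist (Nat.cast_nonneg _))
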